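/- Let $n\ge 2$, $L>0$, $Q>0$. There are constants $C_1,C_2,C_3,C_4>0$ depending only on $n$, $L$ and $Q$ such that the following holds for all $r,\rho_0>0$ and every bounded domain (nonempty connected open set) $D\subset\mathbb{R}^n$ with boundary of Lipschitz class with constants $r\rho_0$, $L$ and with $\operatorname{diam}(D)\le Q r\rho_0$. Here $\partial D$ is of Lipschitz class with constants $\rho, M>0$ if for every $P\in\partial D$ there are a rigid change of coordinates $x=(x',x_n)$ with $P=0$ and a Lipschitz function $\psi$ on $\{|x'|<\rho/M\}\subset\mathbb{R}^{n-1}$ with $\psi(0)=0$ and $\sup|\psi|+\rho\,\mathrm{Lip}(\psi)\le M\rho$ such that, for all $x$ with $|x'|<\rho/M$ and $|x_n|<\rho$, one has $x\in D$ if and only if $x_n>\psi(x')$. Let $D^{r\rho_0}=\{x\in\mathbb{R}^n : 0<\operatorname{dist}(x,D)<r\rho_0\}$ and write $u_D=\frac1{|D|}\int_D u$, $u_{\partial D}=\frac1{|\partial D|}\int_{\partial D}u$, where boundary integrals are with respect to $(n-1)$-dimensional surface measure. Boundary values on $\partial D$ of $u\in H^1(D)$ or $u\in H^1(D^{r\rho_0})$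 are traces: for $U=D$ or $U=D^{r\rho_0}$ respectively, the trace of $u$ is the function $h$ on $\partial D$ with $\lim_{\varepsilon\to0}\frac{1}{|U\cap B_\varepsilon(x)|}\int_{U\cap B_\varepsilon(x)}|u(y)-h(x)|\,dy=0$ for almost every $x\in\partial D$. In both cases the trace exists and belongs to $L^2(\partial D)$. 1. For every $u\in H^1(D)$, $$\int_D|u-u_D|^2\le C_1r^2\rho_0^2\int_D|\nabla u|^2,\qquad \int_{\partial D}|u-u_{\partial D}|^2\le C_2r\rho_0\int_D|\nabla u|^2 .$$ 2. If $\mathbb{R}^n\setminus\overline D$ is connected, then for every $u\in H^1(D^{r\rho_0})$, $$\int_{\partial D}|u-u_{\partial D}|^2\le C_3r\rho_0\int_{D^{r\rho_0}}|\nabla u|^2 .$$ 3. For every $u\in H^1(D^{r\rho_0})$ with $u=0$ on $\partial D$, $$\int_{D^{r\rho_0}}u^2\le C_4r^2\rho_0^2\int_{D^{r\rho_0}}|\nabla u|^2 .$$ -/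

import Mathlib

open MeasureTheory Set Filter Topology
open scoped ContDiff NNReal

/-- `D` (a subset of `ℝⁿ`) has boundary of Lipschitz class with constants `ρ`, `M`: around each
boundary point `P` there are a rigid change of coordinates `x ↦ (x', xₙ)` sending `P` to `0` and a
Lipschitz function `ψ` on the ball `{|x'| < ρ / M}` of `ℝⁿ⁻¹` with `ψ 0 = 0` such that, in the
cylinder `{|x'| < ρ / M, |xₙ| < ρ}`, the set `D` is `{xₙ > ψ x'}`. The bound `a + ρ * K ≤ M * ρ`,
with `a` a bound for `|ψ|` and `K` a Lipschitz constant of `ψ`, says that the dimensionally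
homogeneous norm `sup |ψ| + ρ * Lip ψ` of `ψ` in `C^{0,1}` is at most `M * ρ`. -/
def IsLipschitzClass {n : ℕ} (D : Set (EuclideanSpace ℝ (Fin n))) (ρ M : ℝ) : Prop :=
  ∀ P ∈ frontier D,
    ∃ (e : EuclideanSpace ℝ (Fin n) ≃ᵃⁱ[ℝ] WithLp 2 (EuclideanSpace ℝ (Fin (n - 1)) × ℝ))
      (ψ : EuclideanSpace ℝ (Fin (n - 1)) → ℝ) (a : ℝ) (K : ℝ≥0),
      e P = 0 ∧ ψ 0 = 0 ∧
      (∀ y ∈ Metric.ball (0 : EuclideanSpace ℝ (Fin (n - 1))) (ρ / M), |ψ y| ≤ a) ∧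
      LipschitzOnWith K ψ (Metric.ball 0 (ρ / M)) ∧
      a + ρ * K ≤ M * ρ ∧
      ∀ x, ‖(e x).fst‖ < ρ / M → |(e x).snd| < ρ → (x ∈ D ↔ ψ (e x).fst < (e x).snd)

/-- The exterior neighbourhood `{x | 0 < dist(x, D) < δ}` of `D`. -/
def extNbhd {n : ℕ} (D : Set (EuclideanSpace ℝ (Fin n))) (δ : ℝ) :
    Set (EuclideanSpace ℝ (Fin n)) :=
  {x | 0 < Metric.infDist x D ∧ Metric.infDist x D < δ}

/-- `u` belongs to `H¹(U)` and its weak gradient in `U` is `g`: both are square integrable in `U`,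
and `∫_U u ∂_v φ = - ∫_U φ ⟨g, v⟩` for all test functions `φ ∈ C_c^∞(U)` and all directions `v`. -/
structure MemH1 {n : ℕ} (U : Set (EuclideanSpace ℝ (Fin n))) (u : EuclideanSpace ℝ (Fin n) → ℝ)
    (g : EuclideanSpace ℝ (Fin n) → EuclideanSpace ℝ (Fin n)) : Prop where
  memLp : MemLp u 2 (volume.restrict U)
  memLp_grad : MemLp g 2 (volume.restrict U)
  weak_grad : ∀ φ : EuclideanSpace ℝ (Fin n) → ℝ,
    ContDiff ℝ ∞ φ → HasCompactSupport φ → tsupport φ ⊆ U → ∀ v : EuclideanSpace ℝ (Fin n),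
      ∫ x in U, u x * fderiv ℝ φ x v = - ∫ x in U, φ x * inner ℝ (g x) v

/-- The surface measure on the boundary `∂D` of a subset `D` of `ℝⁿ`: the `(n-1)`-dimensional
Hausdorff measure (normalized to agree with Lebesgue measure on hyperplanes) restricted to `∂D`. -/
noncomputable def surfaceMeasure {n : ℕ} (D : Set (EuclideanSpace ℝ (Fin n))) :
    Measure (EuclideanSpace ℝ (Fin n)) :=
  (Measure.euclideanHausdorffMeasure (n - 1)).restrict (frontier D)

/-- `h` is the trace on `∂D`, from the side of `U`, of the function `u` on `U`: for almost every
point `x` of `∂D` with respect to surface measure, the mean value of `|u - h x|` over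
`U ∩ B(x, ε)` tends to `0` as `ε → 0`. Here `U` will be `D` or an exterior neighbourhood of `D`. -/
def IsTrace {n : ℕ} (U D : Set (EuclideanSpace ℝ (Fin n)))
    (u h : EuclideanSpace ℝ (Fin n) → ℝ) : Prop :=
  ∀ᵐ x ∂(surfaceMeasure D),
    Tendsto (fun ε : ℝ => ⨍ y in U ∩ Metric.ball x ε, |u y - h x|) (𝓝[>] 0) (𝓝 0)

/-! The argument is quantitative and local; it uses neither compactness of embeddings nor extension
operators. Let `U` satisfy a uniform truncated cone condition at scale `δ`. Two points of `U ∩ B(x,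
η)` are compared through a third point ranging over a ball `W` that every point of `U ∩ B(x, η)`
sees along segments inside `U`. Integrating the fundamental theorem of calculus for weak gradients
over these segments bounds `∫∫ |u y - u z|²` by `η ^ (n + 2)` times the energy in a ball of radius
`4 η / κ` (`MemH1.lintegral_segment_le`, `MemH1.lintegral_pair_ball_le`). Hence `u` is close in `L²`
to its ball means, and means over nearby balls are close to each other. A connected set of diameter
at most `R δ` is crossed by a chain of boundedly many balls of radius `δ`, so all means at scale `δ`
along it are comparable (`exists_ballMean_sub_le`). Summing over a cover gives the Poincaré
inequality in `D` (`exists_poincare`).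

For traces, means over balls shrinking to a boundary point are telescoped. The increments are
controlled by a weighted sum of energies over scales, whose integral over the boundary is at most a
multiple of `δ` times the total energy, because a ball of radius `r` has surface measure at most a
multiple of `r ^ (n - 1)`. This gives existence of the trace and its `L²` distance to the mean at
scale `δ` (`exists_trace_estimate`); chaining turns it into the boundary Poincaré inequality
(`exists_boundary_poincare`).

A Lipschitz boundary supplies the cone condition, with `κ = 1 / (1 + L)` and `δ` a fixed fraction of
`ρ = r ρ₀`, for `D` and, near `∂D`, for the exterior neighbourhood; its graph charts give two-sided
bounds on surface measure. In statement 2 the chain runs in a thin exterior layer, connected because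
`ℝⁿ` is unicoherent (`isPreconnected_inter_of_union_eq_univ`). In statement 3 a zero trace makes the
means near `∂D` small, which bounds `u` in a layer of width `δ`; a point farther out sees a ball
inside that layer (`exists_poincare_of_zero_trace`). -/

open scoped ENNReal

/-! ### Cauchy–Schwarz for integrals. -/

section Jensen
variable {α : Type*} [MeasurableSpace α] {μ : Measure α}

/-- Cauchy–Schwarz against the constant function `1`. -/
theorem lintegral_sq_le_measure_mul {f : α → ℝ≥0∞} (hf : AEMeasurable f μ) :
    (∫⁻ x, f x ∂μ) ^ 2 ≤ μ univ * ∫⁻ x, f x ^ 2 ∂μ := by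
  have h := ENNReal.lintegral_mul_le_Lp_mul_Lq μ Real.HolderConjugate.two_two
    (aemeasurable_const (b := (1 : ℝ≥0∞))) hf
  simp only [Pi.mul_apply, one_mul, ENNReal.rpow_ofNat, one_pow, lintegral_const] at h
  calc (∫⁻ x, f x ∂μ) ^ 2 ≤ (μ univ ^ (1 / 2 : ℝ) * (∫⁻ x, f x ^ 2 ∂μ) ^ (1 / 2 : ℝ)) ^ 2 := by
        gcongr
    _ = _ := by
        rw [mul_pow, ← ENNReal.rpow_natCast, ← ENNReal.rpow_mul, ← ENNReal.rpow_natCast,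
          ← ENNReal.rpow_mul]
        norm_num

theorem enorm_integral_sq_le {F : Type*} [NormedAddCommGroup F] [NormedSpace ℝ F] {f : α → F}
    (hf : AEStronglyMeasurable f μ) :
    ‖∫ x, f x ∂μ‖ₑ ^ 2 ≤ μ univ * ∫⁻ x, ‖f x‖ₑ ^ 2 ∂μ :=
  (pow_le_pow_left' (enorm_integral_le_lintegral_enorm f) 2).trans
    (lintegral_sq_le_measure_mul hf.enorm)

end Jensen

/-! ### Differences of an `H¹` function along segments. -/

section Translation
variable {n : ℕ}
local notation "E" => EuclideanSpace ℝ (Fin n)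

/-- The points from which the translation by `v` stays in `U` all along the way. -/
def sweepSet (U : Set E) (v : E) : Set E := {x | ∀ t ∈ Icc (0 : ℝ) 1, x + t • v ∈ U}

/-- Tube lemma: the complement is the projection of a closed set along the compact interval `[0,
1]`. -/
theorem isOpen_sweepSet {U : Set E} (hU : IsOpen U) (v : E) : IsOpen (sweepSet U v) := by
  have h : sweepSet U v = (Prod.fst '' ({p : E × ℝ | p.2 ∈ Icc (0 : ℝ) 1} ∩
      {p : E × ℝ | p.1 + p.2 • v ∈ Uᶜ}))ᶜ := by
    ext x; simp [sweepSet]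
  rw [h, isOpen_compl_iff]
  have hc : IsClosed {p : E × ℝ | p.1 + p.2 • v ∈ Uᶜ} :=
    hU.isClosed_compl.preimage (by fun_prop)
  have := isClosedMap_fst_of_compactSpace (X := E) (Y := Icc (0:ℝ) 1)
    ({p : E × Icc (0:ℝ) 1 | p.1 + (p.2 : ℝ) • v ∈ Uᶜ}) (hU.isClosed_compl.preimage (by fun_prop))
  convert this using 1
  ext x; simp

theorem measurePreserving_shear (v : E) :
    MeasurePreserving (fun p : ℝ × E => (p.1, p.2 + p.1 • v))
      ((volume.restrict (Icc (0 : ℝ) 1)).prod volume)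
      ((volume.restrict (Icc (0 : ℝ) 1)).prod volume) :=
  MeasurePreserving.skew_product (f := id) (g := fun (t : ℝ) (x : E) => x + t • v)
    (MeasurePreserving.id _) (by fun_prop)
    (ae_of_all _ fun t => (measurePreserving_add_right volume (t • v)).map_eq)

theorem memLp_comp_shear {f : E → ℝ} (hf : MemLp f 2 volume) (v : E) :
    MemLp (fun p : ℝ × E => f (p.2 + p.1 • v)) 2
      ((volume.restrict (Icc (0 : ℝ) 1)).prod volume) :=
  (hf.comp_snd (volume.restrict (Icc (0 : ℝ) 1))).comp_measurePreserving (measurePreserving_shear v)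

/-- The fundamental theorem of calculus for weak gradients, by duality. Against a test function `φ`
supported in `sweepSet U v`, the difference of `u` becomes a difference of `φ`, to which the
classical theorem applies. Each translate `φ (· - t • v)` is again supported in `U`, so the
derivative can be moved back onto `u`; Fubini then exchanges `t` and `x`. -/
theorem ae_sub_eq_integral {U : Set E} (hU : IsOpen U) {u : E → ℝ} {g : E → E}
    (hu : MemLp u 2 volume) (hg : MemLp g 2 volume)
    (hw : ∀ φ : E → ℝ, ContDiff ℝ ∞ φ → HasCompactSupport φ → tsupport φ ⊆ U → ∀ v : E,
      ∫ x, u x * fderiv ℝ φ x v = - ∫ x, φ x * inner ℝ (g x) v) (v : E) :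
    ∀ᵐ x, x ∈ sweepSet U v →
      u (x + v) - u x - ∫ t in Icc (0 : ℝ) 1, inner ℝ (g (x + t • v)) v = 0 := by
  have hgv : MemLp (fun x => inner ℝ (g x) v : E → ℝ) 2 volume := by
    refine MemLp.of_le_mul (c := ‖v‖) hg (hg.1.inner aestronglyMeasurable_const)
      (ae_of_all _ fun x => ?_)
    rw [mul_comm]; exact norm_inner_le_norm _ _
  have hF := memLp_comp_shear hgv v
  have hL2 : MemLp (fun x => ∫ t in Icc (0 : ℝ) 1, inner ℝ (g (x + t • v)) v : E → ℝ) 2 volume := by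
    have hm := hF.1.prod_swap.integral_prod_right'
    refine ⟨hm, ?_⟩
    rw [eLpNorm_lt_top_iff_lintegral_rpow_enorm_lt_top (by simp) (by simp)]
    have h2 := hF.2
    rw [eLpNorm_lt_top_iff_lintegral_rpow_enorm_lt_top (by simp) (by simp)] at h2
    simp only [ENNReal.toReal_ofNat, ENNReal.rpow_ofNat] at h2 ⊢
    rw [lintegral_prod_symm _ (hF.1.enorm.pow_const 2)] at h2
    refine lt_of_le_of_lt (lintegral_mono_ae ?_) h2
    filter_upwards [hF.1.prod_swap.prodMk_left] with x hx
    refine (enorm_integral_sq_le hx).trans ?_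
    simp
  refine (isOpen_sweepSet hU v).ae_eq_zero_of_integral_contDiff_smul_eq_zero ?_ ?_
  · refine LocallyIntegrable.locallyIntegrableOn ?_ _
    exact (((hu.comp_measurePreserving (measurePreserving_add_right volume v)).sub hu).sub
      hL2).locallyIntegrable (by norm_num)
  intro φ hφ hφc hφU
  have hφ2 : MemLp φ 2 volume := hφ.continuous.memLp_of_hasCompactSupport hφc
  have hdφ2 : MemLp (fun x => fderiv ℝ φ x v) 2 volume :=
    Continuous.memLp_of_hasCompactSupport
      ((hφ.continuous_fderiv (by simp)).clm_apply continuous_const)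
      ((hφc.fderiv ℝ).comp_left (g := fun T : E →L[ℝ] ℝ => T v) (by simp))
  have hint1 : Integrable (fun p : ℝ × E => u p.2 * fderiv ℝ φ (p.2 + p.1 • (-v)) v)
      ((volume.restrict (Icc (0 : ℝ) 1)).prod volume) :=
    (hu.comp_snd (volume.restrict (Icc (0 : ℝ) 1))).integrable_mul (memLp_comp_shear hdφ2 (-v))
  have hint2 : Integrable (fun p : ℝ × E => φ p.2 * inner ℝ (g (p.2 + p.1 • v)) v)
      ((volume.restrict (Icc (0 : ℝ) 1)).prod volume) :=
    (hφ2.comp_snd (volume.restrict (Icc (0 : ℝ) 1))).integrable_mul hF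
  have key : ∀ t ∈ Icc (0 : ℝ) 1, ∫ x, u x * fderiv ℝ φ (x + t • (-v)) v =
      - ∫ x, φ x * inner ℝ (g (x + t • v)) v := by
    intro t ht
    -- The support of this translate is that of `φ` moved by `t • v`, and it stays in `U` by
    -- definition of `sweepSet`.
    have h1 := hw (fun x => φ (x + t • (-v))) (hφ.comp (by fun_prop))
      (hφc.comp_homeomorph (Homeomorph.addRight (t • (-v)))) ?_ v
    · simp only [fderiv_comp_add_right] at h1
      rw [h1, ← integral_add_right_eq_self _ (t • v)]
      simp
    · have : tsupport (fun x => φ (x + t • (-v))) = (fun x => x + t • (-v)) ⁻¹' tsupport φ :=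
        tsupport_comp_eq_preimage φ (Homeomorph.addRight (t • (-v)))
      rw [this]
      intro x hx
      have := hφU hx t ht
      simpa using this
  have hI : ∫ x, u x * (φ x - φ (x - v)) =
      - ∫ x, φ x * ∫ t in Icc (0 : ℝ) 1, inner ℝ (g (x + t • v)) v := by
    have e1 : ∀ x, u x * (φ (x - v) - φ x) =
        - ∫ t in Icc (0 : ℝ) 1, u x * fderiv ℝ φ (x + t • (-v)) v := by
      intro x
      rw [integral_const_mul, ← mul_neg]
      congr 1
      have hd : ∀ t ∈ uIcc (0 : ℝ) 1, HasDerivAt (fun t : ℝ => φ (x + t • (-v)))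
          (- fderiv ℝ φ (x + t • (-v)) v) t := by
        intro t _
        have h1 : HasDerivAt (fun t : ℝ => x + t • (-v)) (-v) t := by
          simpa using ((hasDerivAt_id t).smul_const (-v)).const_add x
        have h2 := ((hφ.differentiable (by simp)) (x + t • (-v))).hasFDerivAt.comp_hasDerivAt t h1
        simpa [Function.comp_def] using h2
      have := intervalIntegral.integral_eq_sub_of_hasDerivAt hd
        (Continuous.intervalIntegrable (by
          have := hφ.continuous_fderiv (by simp)
          fun_prop) _ _)
      rw [intervalIntegral.integral_of_le zero_le_one, ← integral_Icc_eq_integral_Ioc,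
        integral_neg] at this
      rw [this]
      simp [sub_eq_add_neg]
    have e2 : ∫ x, u x * (φ (x - v) - φ x) = ∫ x, φ x * ∫ t in Icc (0 : ℝ) 1,
        inner ℝ (g (x + t • v)) v := by
      simp_rw [e1, ← integral_const_mul]
      rw [integral_neg, ← integral_integral_swap (f := fun t x => u x * fderiv ℝ φ (x + t • (-v)) v)
        hint1, ← integral_integral_swap (f := fun t x => φ x * inner ℝ (g (x + t • v)) v) hint2,
        ← integral_neg]
      refine setIntegral_congr_fun measurableSet_Icc fun t ht => ?_
      simp only [key t ht, neg_neg]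
    rw [← e2, ← integral_neg]
    congr 1; ext x; ring
  have i1 : Integrable (fun x => φ x * u (x + v)) volume :=
    hφ2.integrable_mul (hu.comp_measurePreserving (measurePreserving_add_right volume v))
  have i2 : Integrable (fun x => φ x * u x) volume := hφ2.integrable_mul hu
  have i3 : Integrable (fun x => φ x * ∫ t in Icc (0 : ℝ) 1, inner ℝ (g (x + t • v)) v) volume :=
    hφ2.integrable_mul hL2
  have i5 : Integrable (fun x => φ x * u (x + v) - φ x * u x) volume := i1.sub i2
  have i4 : Integrable (fun x => u x * φ (x - v)) volume := by
    refine hu.integrable_mul (q := 2) ?_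
    simpa [sub_eq_add_neg, Function.comp_def] using
      hφ2.comp_measurePreserving (measurePreserving_add_right volume (-v))
  have e3 : ∫ x, φ x * u (x + v) = ∫ x, u x * φ (x - v) := by
    rw [← integral_add_right_eq_self (fun x => u x * φ (x - v)) v]
    simp [mul_comm]
  simp only [smul_eq_mul, mul_sub]
  rw [integral_sub i5 i3, integral_sub i1 i2, e3]
  simp only [mul_sub] at hI
  rw [integral_sub (by simpa only [mul_comm] using i2) i4] at hI
  simp only [mul_comm (φ _) (u _)]
  linarith

/-- Cauchy–Schwarz in `t` applied to the previous formula; after Fubini, translation invariance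
makes the `x`-integral independent of `t`. The functions are extended by zero so that integrals over
the whole space can be translated. -/
theorem MemH1.setLIntegral_sweepSet_le {U : Set E} (hU : IsOpen U) {u : E → ℝ} {g : E → E}
    (h : MemH1 U u g) (v : E) :
    ∫⁻ x in sweepSet U v, ‖u (x + v) - u x‖ₑ ^ 2 ≤ ‖v‖ₑ ^ 2 * ∫⁻ x in U, ‖g x‖ₑ ^ 2 := by
  have hUm := hU.measurableSet
  set u₀ := U.indicator u with hu₀
  set g₀ := U.indicator g with hg₀
  have hu : MemLp u₀ 2 volume := (memLp_indicator_iff_restrict hUm).2 h.memLp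
  have hg : MemLp g₀ 2 volume := (memLp_indicator_iff_restrict hUm).2 h.memLp_grad
  have hae := ae_sub_eq_integral hU hu hg (fun φ h1 h2 h3 w => by
    have := h.weak_grad φ h1 h2 h3 w
    rw [← integral_indicator hUm, ← integral_indicator hUm] at this
    have e1 : ∀ x, u₀ x * fderiv ℝ φ x w = U.indicator (fun x => u x * fderiv ℝ φ x w) x := by
      intro x; by_cases hx : x ∈ U <;> simp [hu₀, hx]
    have e2 : ∀ x, φ x * inner ℝ (g₀ x) w = U.indicator (fun x => φ x * inner ℝ (g x) w) x := by
      intro x; by_cases hx : x ∈ U <;> simp [hg₀, hx]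
    simpa only [e1, e2] using this) v
  have hgv : MemLp (fun x => inner ℝ (g₀ x) v : E → ℝ) 2 volume := by
    refine MemLp.of_le_mul (c := ‖v‖) hg (hg.1.inner aestronglyMeasurable_const)
      (ae_of_all _ fun x => ?_)
    rw [mul_comm]; exact norm_inner_le_norm _ _
  have hF := memLp_comp_shear hgv v
  calc ∫⁻ x in sweepSet U v, ‖u (x + v) - u x‖ₑ ^ 2
      ≤ ∫⁻ x in sweepSet U v, ∫⁻ t in Icc (0 : ℝ) 1, ‖(inner ℝ (g₀ (x + t • v)) v : ℝ)‖ₑ ^ 2 := by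
        refine setLIntegral_mono_ae' (isOpen_sweepSet hU v).measurableSet ?_
        filter_upwards [hae, hF.1.prod_swap.prodMk_left] with x hx hm hxs
        have h0 : x ∈ U := by simpa using hxs 0 (by simp)
        have h1 : x + v ∈ U := by simpa using hxs 1 (by simp)
        have := hx hxs
        rw [sub_eq_zero, hu₀, indicator_of_mem h0, indicator_of_mem h1] at this
        rw [this]
        refine (enorm_integral_sq_le hm).trans ?_
        simp
    _ ≤ ∫⁻ x, ∫⁻ t in Icc (0 : ℝ) 1, ‖(inner ℝ (g₀ (x + t • v)) v : ℝ)‖ₑ ^ 2 :=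
        setLIntegral_le_lintegral _ _
    _ = ∫⁻ t in Icc (0 : ℝ) 1, ∫⁻ x, ‖(inner ℝ (g₀ (x + t • v)) v : ℝ)‖ₑ ^ 2 :=
        (lintegral_lintegral_swap (f := fun t x => ‖(inner ℝ (g₀ (x + t • v)) v : ℝ)‖ₑ ^ 2)
          (hF.1.enorm.pow_const 2)).symm
    _ = ∫⁻ t in Icc (0 : ℝ) 1, ∫⁻ x, ‖(inner ℝ (g₀ x) v : ℝ)‖ₑ ^ 2 := by
        congr 1; ext t
        exact lintegral_add_right_eq_self (fun x => ‖(inner ℝ (g₀ x) v : ℝ)‖ₑ ^ 2) (t • v)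
    _ = ∫⁻ x, ‖(inner ℝ (g₀ x) v : ℝ)‖ₑ ^ 2 := by simp
    _ ≤ ∫⁻ x, ‖v‖ₑ ^ 2 * ‖g₀ x‖ₑ ^ 2 := by
        refine lintegral_mono fun x => ?_
        rw [← mul_pow]
        gcongr
        rw [mul_comm, ← ofReal_norm, ← ofReal_norm, ← ofReal_norm, ← ENNReal.ofReal_mul (by simp)]
        exact ENNReal.ofReal_le_ofReal (norm_inner_le_norm _ _)
    _ = ‖v‖ₑ ^ 2 * ∫⁻ x, ‖g₀ x‖ₑ ^ 2 := lintegral_const_mul' _ _ (by simp)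
    _ = _ := by
        congr 1
        rw [← lintegral_indicator hUm]
        congr 1; ext x; by_cases hx : x ∈ U <;> simp [hg₀, hx]

/-- Poincaré inequality over pairs of points joined by a segment in `U`. -/
theorem MemH1.lintegral_segment_le {U : Set E} (hU : IsOpen U) {u : E → ℝ} {g : E → E}
    (h : MemH1 U u g) (hum : Measurable u) {Z : Set (E × E)} (hZ : MeasurableSet Z) {R : ℝ}
    (hZU : ∀ p ∈ Z, segment ℝ p.1 p.2 ⊆ U ∧ dist p.1 p.2 ≤ R) :
    ∫⁻ y, ∫⁻ w, Z.indicator (fun p => ‖u p.1 - u p.2‖ₑ ^ 2) (y, w) ≤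
      ENNReal.ofReal R ^ 2 * volume (Metric.closedBall (0 : E) R) * ∫⁻ x in U, ‖g x‖ₑ ^ 2 := by
  set F : E × E → ℝ≥0∞ := Z.indicator (fun p => ‖u p.1 - u p.2‖ₑ ^ 2) with hF
  have hFm : Measurable F := by
    refine Measurable.indicator ?_ hZ
    fun_prop
  -- With the displacement `v = w - y` integrated last, the admissible `y` for fixed `v` lie in
  -- `sweepSet U v`, and only `‖v‖ ≤ R` contributes.
  calc ∫⁻ y, ∫⁻ w, F (y, w) = ∫⁻ y, ∫⁻ v, F (y, y + v) := by
        congr 1; ext y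
        exact (lintegral_add_left_eq_self (fun w => F (y, w)) y).symm
    _ = ∫⁻ v, ∫⁻ y, F (y, y + v) := lintegral_lintegral_swap (by fun_prop)
    _ ≤ ∫⁻ v, (Metric.closedBall (0 : E) R).indicator
          (fun _ => ENNReal.ofReal R ^ 2 * ∫⁻ x in U, ‖g x‖ₑ ^ 2) v := by
        refine lintegral_mono fun v => ?_
        by_cases hv : v ∈ Metric.closedBall (0 : E) R
        · rw [indicator_of_mem hv]
          calc ∫⁻ y, F (y, y + v) ≤ ∫⁻ y, (sweepSet U v).indicator
                (fun y => ‖u (y + v) - u y‖ₑ ^ 2) y := by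
                refine lintegral_mono fun y => ?_
                by_cases hy : (y, y + v) ∈ Z
                · have hs : y ∈ sweepSet U v := by
                    intro t ht
                    refine (hZU _ hy).1 ?_
                    rw [segment_eq_image']
                    exact ⟨t, ht, by simp⟩
                  rw [hF, indicator_of_mem hy, indicator_of_mem hs, ← enorm_neg]
                  simp
                · rw [hF, indicator_of_notMem hy]; exact zero_le
            _ = ∫⁻ y in sweepSet U v, ‖u (y + v) - u y‖ₑ ^ 2 :=
                lintegral_indicator (isOpen_sweepSet hU v).measurableSet _
            _ ≤ _ := h.setLIntegral_sweepSet_le hU v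
            _ ≤ _ := by
                gcongr
                rw [← ofReal_norm]
                exact ENNReal.ofReal_le_ofReal (by simpa using hv)
        · rw [indicator_of_notMem hv]
          refine le_of_eq ?_
          rw [lintegral_eq_zero_iff (by fun_prop)]
          refine ae_of_all _ fun y => ?_
          have : (y, y + v) ∉ Z := fun hy => hv (by simpa using (hZU _ hy).2)
          simp [hF, this]
    _ = _ := by
        rw [lintegral_indicator Metric.isClosed_closedBall.measurableSet]
        simp only [lintegral_const, MeasurableSet.univ, Measure.restrict_apply, univ_inter]
        ring

theorem MemH1.mono {U V : Set E} (hU : MeasurableSet U) {u : E → ℝ}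
    {g : E → E} (h : MemH1 U u g) (hVU : V ⊆ U) : MemH1 V u g where
  memLp := h.memLp.mono_measure (Measure.restrict_mono hVU le_rfl)
  memLp_grad := h.memLp_grad.mono_measure (Measure.restrict_mono hVU le_rfl)
  weak_grad φ h1 h2 h3 v := by
    have := h.weak_grad φ h1 h2 (h3.trans hVU) v
    have e1 : ∫ x in V, u x * fderiv ℝ φ x v = ∫ x in U, u x * fderiv ℝ φ x v :=
      (setIntegral_eq_of_subset_of_forall_sdiff_eq_zero hU hVU fun x hx => by
        rw [fderiv_of_notMem_tsupport (𝕜 := ℝ) fun hx' => hx.2 (h3 hx')]; simp).symm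
    have e2 : ∫ x in V, φ x * inner ℝ (g x) v = ∫ x in U, φ x * inner ℝ (g x) v :=
      (setIntegral_eq_of_subset_of_forall_sdiff_eq_zero hU hVU fun x hx => by
        rw [image_eq_zero_of_notMem_tsupport fun hx' => hx.2 (h3 hx')]; simp).symm
    rw [e1, e2, this]

theorem MemH1.exists_measurable {U : Set E} {u : E → ℝ} {g : E → E} (h : MemH1 U u g) :
    ∃ u', Measurable u' ∧ u =ᵐ[volume.restrict U] u' ∧ MemH1 U u' g := by
  obtain ⟨u', hm, hu'⟩ := h.memLp.1
  refine ⟨u', hm.measurable, hu', (memLp_congr_ae hu').1 h.memLp, h.memLp_grad, ?_⟩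
  intro φ h1 h2 h3 v
  rw [← h.weak_grad φ h1 h2 h3 v]
  refine integral_congr_ae ?_
  filter_upwards [hu'] with x hx
  rw [hx]

end Translation

/-! ### The cone condition and local Poincaré inequalities. -/

section Cone
variable {n : ℕ}
local notation "E" => EuclideanSpace ℝ (Fin n)

/-- Interior cone property at `x`: near `x`, the set `U` is stable under the truncated cone
generated by the ball of radius `κ` around a unit vector. -/
def ConeAt (U : Set E) (x : E) (Δ κ : ℝ) : Prop :=
  ∃ e : E, ‖e‖ = 1 ∧ ∀ y ∈ U, dist y x < Δ → ∀ s : ℝ, 0 < s → s ≤ 2 * Δ / κ →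
    ∀ v : E, ‖v‖ ≤ κ → y + s • (e + v) ∈ U

theorem ConeAt.mono {U : Set E} {x : E} {Δ Δ' κ : ℝ} (h : ConeAt U x Δ κ) (hκ : 0 < κ)
    (hΔ : Δ' ≤ Δ) : ConeAt U x Δ' κ := by
  obtain ⟨e, he, h⟩ := h
  refine ⟨e, he, fun y hy hyx s hs hsΔ v hv => h y hy (hyx.trans_le hΔ) s hs (hsΔ.trans ?_) v hv⟩
  gcongr

/-- The volume of the unit ball. -/
noncomputable def unitVol (n : ℕ) : ℝ :=
  (volume (Metric.ball (0 : EuclideanSpace ℝ (Fin n)) 1)).toReal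

theorem unitVol_pos (n : ℕ) : 0 < unitVol n :=
  ENNReal.toReal_pos (Metric.measure_ball_pos _ _ one_pos).ne' measure_ball_lt_top.ne

theorem volume_ball_eq (x : E) {r : ℝ} (hr : 0 < r) :
    volume (Metric.ball x r) = ENNReal.ofReal (unitVol n * r ^ n) := by
  rw [Measure.addHaar_ball_of_pos _ _ hr, unitVol, mul_comm,
    ENNReal.ofReal_mul ENNReal.toReal_nonneg, ENNReal.ofReal_toReal measure_ball_lt_top.ne]
  simp

theorem volume_closedBall_eq (x : E) {r : ℝ} (hr : 0 < r) :
    volume (Metric.closedBall x r) = ENNReal.ofReal (unitVol n * r ^ n) := by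
  rw [Measure.addHaar_closedBall _ _ hr.le, unitVol, mul_comm,
    ENNReal.ofReal_mul ENNReal.toReal_nonneg, ENNReal.ofReal_toReal measure_ball_lt_top.ne]
  simp

/-- The ball of radius `κ η / 4` about `x + (η / 2) • e` lies in `U`: it is contained in the cone
from a point of `U` within `κ η / 4` of `x`, since the two errors add up to at most `κ` times the
height `η / 2`. -/
theorem ConeAt.volume_ge {U : Set E} {x : E} {Δ κ η : ℝ} (h : ConeAt U x Δ κ)
    (hx : x ∈ closure U) (hκ : 0 < κ) (hκ1 : κ ≤ 1) (hη : 0 < η) (hηΔ : η ≤ Δ) :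
    ENNReal.ofReal (unitVol n * (κ / 4 * η) ^ n) ≤ volume (U ∩ Metric.ball x η) := by
  obtain ⟨e, he, h⟩ := h
  rw [← volume_ball_eq (x + (η / 2) • e) (by positivity)]
  refine measure_mono fun w hw => ⟨?_, ?_⟩
  · obtain ⟨y, hy, hyx⟩ := Metric.mem_closure_iff.1 hx (κ / 4 * η) (by positivity)
    have h1 : κ / 4 * η < Δ := by nlinarith
    have := h y hy (by rw [dist_comm]; exact hyx.trans h1) (η / 2) (by positivity) ?_
      ((η / 2)⁻¹ • (w - y) - e) ?_
    · rwa [add_sub_cancel, smul_inv_smul₀ (by positivity), add_sub_cancel] at this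
    · rw [le_div_iff₀ hκ]; nlinarith
    · have e1 : (η / 2)⁻¹ • (w - y) - e = (η / 2)⁻¹ • ((w - (x + (η / 2) • e)) + (x - y)) := by
        rw [show (w - (x + (η / 2) • e)) + (x - y) = w - y - (η / 2) • e by abel, smul_sub _ (w - y),
          inv_smul_smul₀ (by positivity)]
      rw [e1, norm_smul, norm_inv, Real.norm_of_nonneg (by positivity : 0 ≤ η / 2),
        inv_mul_le_iff₀ (by positivity)]
      refine (norm_add_le _ _).trans ?_
      rw [dist_eq_norm] at hyx
      rw [Metric.mem_ball, dist_eq_norm] at hw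
      linarith
  · rw [Metric.mem_ball, dist_eq_norm] at hw ⊢
    have e1 : w - x = (w - (x + (η / 2) • e)) + (η / 2) • e := by abel
    rw [e1]
    refine (norm_add_le _ _).trans_lt ?_
    rw [norm_smul, he, Real.norm_of_nonneg (by positivity)]
    nlinarith

/-- The gradient energy, as a measure. -/
noncomputable def energy (U : Set E) (g : E → E) : Measure E :=
  (volume.restrict U).withDensity fun x => ‖g x‖ₑ ^ 2

theorem energy_apply {U : Set E} (g : E → E) {A : Set E} (hA : MeasurableSet A) :
    energy U g A = ∫⁻ x in U ∩ A, ‖g x‖ₑ ^ 2 := by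
  rw [energy, withDensity_apply _ hA, Measure.restrict_restrict hA, inter_comm]

theorem energy_univ (U : Set E) (g : E → E) : energy U g univ = ∫⁻ x in U, ‖g x‖ₑ ^ 2 := by
  rw [energy_apply g MeasurableSet.univ, inter_univ]

theorem lintegral_enorm_sq_lt_top {α F : Type*} [MeasurableSpace α] [NormedAddCommGroup F]
    {μ : Measure α} {f : α → F} (hf : MemLp f 2 μ) : ∫⁻ x, ‖f x‖ₑ ^ 2 ∂μ < ⊤ := by
  have := hf.2
  rw [eLpNorm_lt_top_iff_lintegral_rpow_enorm_lt_top (by simp) (by simp)] at this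
  simpa using this

theorem MemH1.energy_lt_top {U : Set E} {u : E → ℝ} {g : E → E} (h : MemH1 U u g) :
    energy U g univ < ⊤ := by
  rw [energy_univ]; exact lintegral_enorm_sq_lt_top h.memLp_grad

theorem enorm_sub_sq_le (a b c : ℝ) :
    ‖a - b‖ₑ ^ 2 ≤ 2 * ‖a - c‖ₑ ^ 2 + 2 * ‖b - c‖ₑ ^ 2 := by
  have h : ∀ r : ℝ, ‖r‖ₑ ^ 2 = ENNReal.ofReal (r ^ 2) := fun r => by
    rw [← ofReal_norm, ← ENNReal.ofReal_pow (norm_nonneg _), Real.norm_eq_abs, sq_abs]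
  rw [h, h, h, ← ENNReal.ofReal_ofNat 2, ← ENNReal.ofReal_mul (by norm_num),
    ← ENNReal.ofReal_mul (by norm_num), ← ENNReal.ofReal_add (by positivity) (by positivity)]
  refine ENNReal.ofReal_le_ofReal ?_
  nlinarith [sq_nonneg (a - c + (b - c))]

/-- Insert `u w` and average over `w ∈ W`. The two resulting terms are equal by symmetry, and `μ A ≤
μ W` absorbs the integration over the idle variable. This permits comparing points of `A` that are
not joined by a segment. -/
theorem lintegral_pair_le_of_intermediate {α : Type*} [MeasurableSpace α] {μ : Measure α}
    [SFinite μ] {u : α → ℝ} (hu : Measurable u) {A W : Set α}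
    (hW0 : μ W ≠ 0) (hWt : μ W ≠ ⊤) (hAW : μ A ≤ μ W) :
    ∫⁻ y in A, ∫⁻ z in A, ‖u y - u z‖ₑ ^ 2 ∂μ ∂μ ≤
      4 * ∫⁻ y in A, ∫⁻ w in W, ‖u y - u w‖ₑ ^ 2 ∂μ ∂μ := by
  set I := ∫⁻ y in A, ∫⁻ w in W, ‖u y - u w‖ₑ ^ 2 ∂μ ∂μ with hI
  have hm : Measurable fun y => ∫⁻ w in W, ‖u y - u w‖ₑ ^ 2 ∂μ :=
    Measurable.lintegral_prod_right' (f := fun p : α × α => ‖u p.1 - u p.2‖ₑ ^ 2) (by fun_prop)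
  have h1 : μ W * ∫⁻ y in A, ∫⁻ z in A, ‖u y - u z‖ₑ ^ 2 ∂μ ∂μ ≤ μ W * (4 * I) := by
    calc μ W * ∫⁻ y in A, ∫⁻ z in A, ‖u y - u z‖ₑ ^ 2 ∂μ ∂μ
        = ∫⁻ y in A, ∫⁻ z in A, ∫⁻ _ in W, ‖u y - u z‖ₑ ^ 2 ∂μ ∂μ ∂μ := by
          rw [← lintegral_const_mul' _ _ hWt]
          simp_rw [← lintegral_const_mul' _ _ hWt, lintegral_const, Measure.restrict_apply_univ,
            mul_comm]
      _ ≤ ∫⁻ y in A, ∫⁻ z in A, ((2 * ∫⁻ w in W, ‖u y - u w‖ₑ ^ 2 ∂μ) +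
            2 * ∫⁻ w in W, ‖u z - u w‖ₑ ^ 2 ∂μ) ∂μ ∂μ := by
          gcongr with y z
          rw [← lintegral_const_mul _ (by fun_prop), ← lintegral_const_mul _ (by fun_prop),
            ← lintegral_add_left (by fun_prop)]
          gcongr
          exact enorm_sub_sq_le _ _ _
      _ = μ A * (4 * I) := by
          simp_rw [lintegral_add_left measurable_const, lintegral_const,
            Measure.restrict_apply_univ]
          rw [lintegral_add_right _ measurable_const, lintegral_const,
            lintegral_mul_const _ (by fun_prop), lintegral_const_mul _ hm, ← hI,
            Measure.restrict_apply_univ]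
          ring
      _ ≤ _ := by gcongr
  exact (ENNReal.mul_le_mul_iff_right hW0 hWt).1 h1

/-- Local Poincaré inequality for pairs under the cone property. -/
theorem MemH1.lintegral_pair_ball_le {U : Set E} (hU : IsOpen U) {u : E → ℝ} {g : E → E}
    (h : MemH1 U u g) (hum : Measurable u) {x : E} {Δ κ η : ℝ} (hc : ConeAt U x Δ κ)
    (hκ : 0 < κ) (hκ1 : κ ≤ 1) (hη : 0 < η) (hηΔ : η ≤ Δ) :
    ∫⁻ y in U ∩ Metric.ball x η, ∫⁻ z in U ∩ Metric.ball x η, ‖u y - u z‖ₑ ^ 2 ≤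
      ENNReal.ofReal (4 * unitVol n * (4 / κ) ^ (n + 2) * η ^ (n + 2)) *
        energy U g (Metric.ball x (4 / κ * η)) := by
  obtain ⟨e, he, hc⟩ := hc
  set A := U ∩ Metric.ball x η with hA
  -- At this height the cone has radius `κ s = 2 η`, so from every point of `U ∩ B(x, η)` it
  -- contains all of `W`. The segments stay in the ball of radius `2 s = 4 / κ * η`.
  set s := 2 * η / κ with hs
  have hs0 : 0 < s := by positivity
  have hκs : κ * s = 2 * η := by rw [hs]; field_simp
  have hK : 4 / κ * η = 2 * s := by rw [hs]; ring
  have hηs : 2 * η ≤ s := by rw [← hκs]; nlinarith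
  set W := Metric.ball (x + s • e) η with hW
  have hAm : MeasurableSet A := hU.measurableSet.inter measurableSet_ball
  refine (lintegral_pair_le_of_intermediate (W := W) hum (Metric.measure_ball_pos _ _ hη).ne'
    measure_ball_lt_top.ne ?_).trans ?_
  · rw [volume_ball_eq _ hη, ← volume_ball_eq x hη]
    exact measure_mono inter_subset_right
  have hseg : ∀ p ∈ A ×ˢ W, segment ℝ p.1 p.2 ⊆ U ∩ Metric.ball x (2 * s) ∧
      dist p.1 p.2 ≤ 2 * s := by
    rintro ⟨y, w⟩ ⟨⟨hyU, hy⟩, hw⟩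
    simp only [hW, Metric.mem_ball] at hy hw
    simp only at *
    have hwx : dist w x < s + η := by
      have : dist (x + s • e) x = s := by
        rw [dist_eq_norm, add_sub_cancel_left, norm_smul, he, Real.norm_of_nonneg hs0.le, mul_one]
      linarith [dist_triangle w (x + s • e) x]
    refine ⟨subset_inter ?_ ?_, ?_⟩
    · rw [segment_eq_image']
      rintro _ ⟨t, ⟨ht0, ht1⟩, rfl⟩
      rcases ht0.eq_or_lt with rfl | ht0
      · simpa using hyU
      have := hc y hyU (hy.trans_le hηΔ) (t * s) (by positivity) ?_ (s⁻¹ • (w - y) - e) ?_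
      · rwa [add_sub_cancel, smul_smul, mul_assoc, mul_inv_cancel₀ hs0.ne', mul_one] at this
      · calc t * s ≤ 1 * s := by gcongr
          _ ≤ _ := by rw [one_mul, hs]; gcongr
      · have e1 : s⁻¹ • (w - y) - e = s⁻¹ • ((w - (x + s • e)) - (y - x)) := by
          rw [show (w - (x + s • e)) - (y - x) = w - y - s • e by abel, smul_sub _ (w - y),
            inv_smul_smul₀ hs0.ne']
        rw [e1, norm_smul, norm_inv, Real.norm_of_nonneg hs0.le, inv_mul_le_iff₀ hs0]
        refine (norm_sub_le _ _).trans ?_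
        rw [dist_eq_norm] at hy hw
        nlinarith
    · refine (convex_ball x (2 * s)).segment_subset ?_ ?_
      · exact Metric.mem_ball.2 (by linarith)
      · exact Metric.mem_ball.2 (by linarith)
    · have e1 : dist y w ≤ dist y x + dist x (x + s • e) + dist (x + s • e) w :=
        dist_triangle4 _ _ _ _
      have : dist x (x + s • e) = s := by
        rw [dist_comm, dist_eq_norm, add_sub_cancel_left, norm_smul, he,
          Real.norm_of_nonneg hs0.le, mul_one]
      rw [dist_comm w] at hw
      linarith
  have hV : IsOpen (U ∩ Metric.ball x (2 * s)) := hU.inter Metric.isOpen_ball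
  have hmain := (h.mono hU.measurableSet
    (inter_subset_left (t := Metric.ball x (2 * s)))).lintegral_segment_le hV hum
    (hAm.prod measurableSet_ball) hseg
  have hrw : ∫⁻ y in A, ∫⁻ w in W, ‖u y - u w‖ₑ ^ 2 = ∫⁻ y, ∫⁻ w,
      (A ×ˢ W).indicator (fun p : E × E => ‖u p.1 - u p.2‖ₑ ^ 2) (y, w) := by
    rw [← lintegral_indicator hAm]
    refine lintegral_congr fun y => ?_
    by_cases hy : y ∈ A
    · rw [indicator_of_mem hy, ← lintegral_indicator measurableSet_ball]
      refine lintegral_congr fun w => ?_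
      by_cases hw : w ∈ W <;>
        simp only [indicator, mem_prod, hy, hw, true_and, if_true, if_false, ← hW]
    · simp [hy]
  rw [hrw, energy_apply g measurableSet_ball, hK]
  refine (mul_le_mul_right hmain 4).trans (le_of_eq ?_)
  rw [volume_closedBall_eq _ (by positivity), ← mul_assoc]
  congr 1
  rw [← ENNReal.ofReal_pow (by positivity), ← ENNReal.ofReal_mul (by positivity),
    ← ENNReal.ofReal_ofNat 4, ← ENNReal.ofReal_mul (by norm_num), ← hK]
  congr 1; ring

/-- Jensen's inequality with the total mass multiplied out, so that the zero measure needs no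
separate hypothesis. -/
theorem measure_mul_enorm_sub_average_sq_le {α : Type*} [MeasurableSpace α] {μ : Measure α}
    [IsFiniteMeasure μ] {u : α → ℝ} (hu : Integrable u μ) (a : ℝ) :
    μ univ * ‖a - ⨍ x, u x ∂μ‖ₑ ^ 2 ≤ ∫⁻ x, ‖a - u x‖ₑ ^ 2 ∂μ := by
  rcases eq_or_ne μ 0 with rfl | hμ
  · simp
  have h0 : μ univ ≠ 0 := by simpa using hμ
  have ht : μ univ ≠ ⊤ := measure_ne_top _ _
  have h1 : ∫ x, (a - u x) ∂μ = μ.real univ * (a - ⨍ x, u x ∂μ) := by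
    rw [integral_sub (integrable_const _) hu, average_eq, integral_const, smul_eq_mul, smul_eq_mul,
      mul_sub, mul_inv_cancel_left₀]
    simpa [Measure.real, ENNReal.toReal_eq_zero_iff, ht] using hμ
  have h2 := enorm_integral_sq_le (((integrable_const a).sub hu).1)
  have h3 : ‖μ.real univ‖ₑ = μ univ := by
    rw [Real.enorm_eq_ofReal measureReal_nonneg, ofReal_measureReal]
  simp only [Pi.sub_apply] at h2
  rw [h1, enorm_mul, mul_pow, h3, sq, mul_assoc] at h2
  exact (ENNReal.mul_le_mul_iff_right h0 ht).1 h2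

theorem le_ofReal_div_mul {a b : ℝ≥0∞} {s t : ℝ} (hs : 0 < s)
    (h : ENNReal.ofReal s * a ≤ ENNReal.ofReal t * b) : a ≤ ENNReal.ofReal (t / s) * b := by
  have h0 : ENNReal.ofReal s ≠ 0 := by simpa using hs
  rw [ENNReal.ofReal_div_of_pos hs, ENNReal.div_eq_inv_mul, mul_assoc, ← ENNReal.div_eq_inv_mul,
    ENNReal.le_div_iff_mul_le (Or.inl h0) (Or.inl ENNReal.ofReal_ne_top), mul_comm]
  exact h

/-- The mean of `u` over the part of a ball that lies in `U`. -/
noncomputable def ballMean (U : Set E) (u : E → ℝ) (x : E) (r : ℝ) : ℝ :=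
  ⨍ y in U ∩ Metric.ball x r, u y

theorem MemH1.integrableOn_inter_ball {U : Set E} {u : E → ℝ} {g : E → E} (h : MemH1 U u g)
    (x : E) (r : ℝ) : IntegrableOn u (U ∩ Metric.ball x r) := by
  have : IsFiniteMeasure (volume.restrict (U ∩ Metric.ball x r)) :=
    ⟨by rw [Measure.restrict_apply_univ]
        exact (measure_mono inter_subset_right).trans_lt measure_ball_lt_top⟩
  exact (h.memLp.mono_measure (Measure.restrict_mono inter_subset_left le_rfl)).integrable
    (by norm_num)

theorem measure_mul_lintegral_sub_average_le {α : Type*} [MeasurableSpace α] {μ : Measure α}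
    {u : α → ℝ} {A B : Set α} (hA : μ A ≠ ⊤) (hu : IntegrableOn u A μ) :
    μ A * ∫⁻ y in B, ‖u y - ⨍ x in A, u x ∂μ‖ₑ ^ 2 ∂μ ≤
      ∫⁻ y in B, ∫⁻ z in A, ‖u y - u z‖ₑ ^ 2 ∂μ ∂μ := by
  have : IsFiniteMeasure (μ.restrict A) := ⟨by rwa [Measure.restrict_apply_univ, lt_top_iff_ne_top]⟩
  rw [← lintegral_const_mul' _ _ hA]
  refine lintegral_mono fun y => ?_
  simpa using measure_mul_enorm_sub_average_sq_le hu (u y)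

theorem measure_mul_measure_mul_enorm_average_sub_le {α : Type*} [MeasurableSpace α]
    {μ : Measure α} {u : α → ℝ} {A B : Set α} (hA : μ A ≠ ⊤) (hB : μ B ≠ ⊤)
    (hu : IntegrableOn u A μ) (hu' : IntegrableOn u B μ) :
    μ A * (μ B * ‖(⨍ x in B, u x ∂μ) - ⨍ x in A, u x ∂μ‖ₑ ^ 2) ≤
      ∫⁻ y in B, ∫⁻ z in A, ‖u y - u z‖ₑ ^ 2 ∂μ ∂μ := by
  have : IsFiniteMeasure (μ.restrict B) := ⟨by rwa [Measure.restrict_apply_univ, lt_top_iff_ne_top]⟩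
  refine le_trans ?_ (measure_mul_lintegral_sub_average_le hA hu)
  gcongr
  have := measure_mul_enorm_sub_average_sq_le hu' (⨍ x in A, u x ∂μ)
  rw [Measure.restrict_apply_univ] at this
  simpa only [← enorm_neg (_ - u _), ← enorm_neg ((⨍ x in A, u x ∂μ) - _), neg_sub] using this

/-- The pair inequality divided by the volume of `U ∩ B(x, η)`, which the cone condition keeps
comparable to `η ^ n`. -/
theorem MemH1.lintegral_sub_ballMean_le {U : Set E} (hU : IsOpen U) {u : E → ℝ} {g : E → E}
    (h : MemH1 U u g) (hum : Measurable u) {x : E} {Δ κ η : ℝ} (hc : ConeAt U x Δ κ)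
    (hx : x ∈ closure U) (hκ : 0 < κ) (hκ1 : κ ≤ 1) (hη : 0 < η) (hηΔ : η ≤ Δ) :
    ∫⁻ y in U ∩ Metric.ball x η, ‖u y - ballMean U u x η‖ₑ ^ 2 ≤
      ENNReal.ofReal (4 * (4 / κ) ^ (2 * n + 2) * η ^ 2) *
        energy U g (Metric.ball x (4 / κ * η)) := by
  have hω := unitVol_pos n
  have ht : volume (U ∩ Metric.ball x η) ≠ ⊤ :=
    ((measure_mono inter_subset_right).trans_lt measure_ball_lt_top).ne
  have h1 := (mul_le_mul_left (hc.volume_ge hx hκ hκ1 hη hηΔ) _).trans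
    ((measure_mul_lintegral_sub_average_le ht (h.integrableOn_inter_ball x η)).trans
    (h.lintegral_pair_ball_le hU hum hc hκ hκ1 hη hηΔ))
  refine (le_ofReal_div_mul (by positivity) h1).trans (le_of_eq ?_)
  congr 2
  rw [div_eq_iff (by positivity)]
  have : (4 / κ) ^ n * (κ / 4) ^ n = 1 := by
    rw [← mul_pow]; field_simp; simp
  calc _ = 4 * unitVol n * (4 / κ) ^ (n + 2) * η ^ (n + 2) * 1 := by ring
    _ = _ := by rw [← this]; ring

/-- Jensen in both variables bounds the difference of means by the pair integral over the common
enclosing ball. It serves both for neighbouring balls of a chain and for concentric balls at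
successive scales. -/
theorem MemH1.ballMean_sub_ballMean_le {U : Set E} (hU : IsOpen U) {u : E → ℝ} {g : E → E}
    (h : MemH1 U u g) (hum : Measurable u) {x : E} {Δ κ η : ℝ} (hc : ConeAt U x Δ κ)
    (hκ : 0 < κ) (hκ1 : κ ≤ 1) (hη : 0 < η) (hηΔ : η ≤ Δ)
    {y z : E} {r t c : ℝ} (hc0 : 0 < c)
    (hy : Metric.ball y r ⊆ Metric.ball x η) (hz : Metric.ball z t ⊆ Metric.ball x η)
    (hyc : ENNReal.ofReal (c * η ^ n) ≤ volume (U ∩ Metric.ball y r))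
    (hzc : ENNReal.ofReal (c * η ^ n) ≤ volume (U ∩ Metric.ball z t)) :
    ‖ballMean U u y r - ballMean U u z t‖ₑ ^ 2 ≤
      ENNReal.ofReal (4 * unitVol n * (4 / κ) ^ (n + 2) / c ^ 2 * (η ^ 2 / η ^ n)) *
        energy U g (Metric.ball x (4 / κ * η)) := by
  have hω := unitVol_pos n
  have ht (x : E) (η : ℝ) : volume (U ∩ Metric.ball x η) ≠ ⊤ :=
    ((measure_mono inter_subset_right).trans_lt measure_ball_lt_top).ne
  have h1 := (measure_mul_measure_mul_enorm_average_sub_le (ht z t) (ht y r)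
    (h.integrableOn_inter_ball z t) (h.integrableOn_inter_ball y r))
  have h2 : ∫⁻ a in U ∩ Metric.ball y r, ∫⁻ b in U ∩ Metric.ball z t, ‖u a - u b‖ₑ ^ 2 ≤
      ∫⁻ a in U ∩ Metric.ball x η, ∫⁻ b in U ∩ Metric.ball x η, ‖u a - u b‖ₑ ^ 2 :=
    (lintegral_mono_set (inter_subset_inter_right _ hy)).trans
      (lintegral_mono fun a => lintegral_mono_set (inter_subset_inter_right _ hz))
  have h3 := h1.trans (h2.trans (h.lintegral_pair_ball_le hU hum hc hκ hκ1 hη hηΔ))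
  have h4 := (mul_le_mul' hzc (mul_le_mul_left hyc _)).trans h3
  rw [← mul_assoc, ← ENNReal.ofReal_mul (by positivity)] at h4
  refine (le_ofReal_div_mul (by positivity) h4).trans (le_of_eq ?_)
  congr 2
  field_simp
  ring

end Cone

/-! ### Chains of balls along a connected set. -/

section Chain
variable {n : ℕ}
local notation "E" => EuclideanSpace ℝ (Fin n)

/-- After rescaling by `δ`, the set lies in a closed ball of radius `R`, which finitely many balls
of radius `1 / 2` cover. Replacing each centre whose ball meets `S` by a point of `S` doubles the
radius, so the count depends only on `n` and `R`. -/
theorem exists_card_cover_le (R : ℝ) : ∃ N : ℕ, ∀ δ : ℝ, 0 < δ → ∀ S : Set E,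
    (∀ x ∈ S, ∀ y ∈ S, dist x y ≤ R * δ) →
    ∃ t : Finset E, ↑t ⊆ S ∧ t.card ≤ N ∧ S ⊆ ⋃ x ∈ t, Metric.ball x δ := by
  classical
  obtain ⟨F, -, hFf, hF⟩ := finite_cover_balls_of_compact
    (isCompact_closedBall (0 : E) R) (e := 1 / 2) (by norm_num)
  refine ⟨hFf.toFinset.card, fun δ hδ S hS => ?_⟩
  rcases S.eq_empty_or_nonempty with rfl | ⟨x₀, hx₀⟩
  · exact ⟨∅, by simp⟩
  have hpick : ∀ z : E, ∃ p ∈ S, ∀ x ∈ S, dist x (x₀ + δ • z) < δ / 2 →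
      dist p (x₀ + δ • z) < δ / 2 := by
    intro z
    by_cases h : ∃ p ∈ S, dist p (x₀ + δ • z) < δ / 2
    · obtain ⟨p, hp, hpz⟩ := h
      exact ⟨p, hp, fun _ _ _ => hpz⟩
    · push Not at h
      exact ⟨x₀, hx₀, fun x hx hxz => absurd hxz (not_lt.2 (h x hx))⟩
  choose f hfS hf using hpick
  refine ⟨hFf.toFinset.image f, ?_, Finset.card_image_le, ?_⟩
  · intro p hp
    simp only [Finset.coe_image, mem_image] at hp
    obtain ⟨z, -, rfl⟩ := hp
    exact hfS z
  · intro x hx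
    have h1 : δ⁻¹ • (x - x₀) ∈ Metric.closedBall (0 : E) R := by
      rw [mem_closedBall_zero_iff, norm_smul, norm_inv, Real.norm_of_nonneg hδ.le,
        inv_mul_le_iff₀ hδ, ← dist_eq_norm, mul_comm]
      exact hS x hx x₀ hx₀
    obtain ⟨z, hz, hxz⟩ := mem_iUnion₂.1 (hF h1)
    have h2 : dist x (x₀ + δ • z) < δ / 2 := by
      have : x - (x₀ + δ • z) = δ • (δ⁻¹ • (x - x₀) - z) := by
        rw [smul_sub, smul_inv_smul₀ hδ.ne']; abel
      rw [dist_eq_norm, this, norm_smul, Real.norm_of_nonneg hδ.le, ← dist_eq_norm]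
      rw [Metric.mem_ball] at hxz
      nlinarith
    have h3 := hf z x hx h2
    refine mem_iUnion₂.2 ⟨f z, Finset.mem_image_of_mem _ (hFf.mem_toFinset.2 hz), ?_⟩
    rw [Metric.mem_ball]
    linarith [dist_triangle_right x (f z) (x₀ + δ • z)]

/-- Join two centres when they are less than `2 * δ` apart. This graph is connected, since otherwise
the balls around two classes of centres would disconnect `T`. A path visits each centre at most
once, and two further steps link `x` and `y` to their centres. -/
theorem edist_le_of_chain {X Y : Type*} [PseudoMetricSpace X] [PseudoEMetricSpace Y] {T : Set X}
    (hT : IsPreconnected T) {δ : ℝ} {t : Finset X} (htT : ↑t ⊆ T)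
    (hcov : T ⊆ ⋃ x ∈ t, Metric.ball x δ) {m : X → Y} {M : ℝ≥0∞}
    (hm : ∀ x ∈ T, ∀ y ∈ T, dist x y < 2 * δ → edist (m x) (m y) ≤ M) {x y : X}
    (hx : x ∈ T) (hy : y ∈ T) : edist (m x) (m y) ≤ (t.card + 2 : ℕ) * M := by
  classical
  let G : SimpleGraph t := SimpleGraph.fromRel fun i j => dist (i : X) j < 2 * δ
  obtain ⟨i, hi, hxi⟩ := mem_iUnion₂.1 (hcov hx)
  obtain ⟨j, hj, hyj⟩ := mem_iUnion₂.1 (hcov hy)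
  have hδ : 0 < δ := dist_nonneg.trans_lt hxi
  have hG : ∀ a b : t, G.Adj a b → dist (a : X) b < 2 * δ := by
    intro a b hab
    rw [SimpleGraph.fromRel_adj] at hab
    rcases hab.2 with h | h
    · exact h
    · rwa [dist_comm]
  have hreach : G.Reachable ⟨i, hi⟩ ⟨j, hj⟩ := by
    by_contra hn
    let A : Set X := ⋃ a ∈ {a : t | G.Reachable ⟨i, hi⟩ a}, Metric.ball (a : X) δ
    let B : Set X := ⋃ a ∈ {a : t | ¬ G.Reachable ⟨i, hi⟩ a}, Metric.ball (a : X) δ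
    have hA : IsOpen A := isOpen_biUnion fun _ _ => Metric.isOpen_ball
    have hB : IsOpen B := isOpen_biUnion fun _ _ => Metric.isOpen_ball
    have hAB : T ⊆ A ∪ B := by
      intro z hz
      obtain ⟨a, ha, hza⟩ := mem_iUnion₂.1 (hcov hz)
      by_cases h : G.Reachable ⟨i, hi⟩ ⟨a, ha⟩
      · exact Or.inl (mem_iUnion₂.2 ⟨⟨a, ha⟩, h, hza⟩)
      · exact Or.inr (mem_iUnion₂.2 ⟨⟨a, ha⟩, h, hza⟩)
    obtain ⟨z, -, hzA, hzB⟩ := hT A B hA hB hAB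
      ⟨i, htT hi, mem_iUnion₂.2 ⟨⟨i, hi⟩, SimpleGraph.Reachable.refl _, Metric.mem_ball_self hδ⟩⟩
      ⟨j, htT hj, mem_iUnion₂.2 ⟨⟨j, hj⟩, hn, Metric.mem_ball_self hδ⟩⟩
    obtain ⟨a, ha, hza⟩ := mem_iUnion₂.1 hzA
    obtain ⟨b, hb, hzb⟩ := mem_iUnion₂.1 hzB
    refine hb (SimpleGraph.Reachable.trans ha ?_)
    by_cases hab : a = b
    · rw [hab]
    refine SimpleGraph.Adj.reachable ?_
    rw [SimpleGraph.fromRel_adj]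
    refine ⟨hab, Or.inl ?_⟩
    rw [Metric.mem_ball] at hza hzb
    linarith [dist_triangle_left (a : X) b z]
  obtain ⟨p⟩ := hreach
  have hwalk : ∀ (a b : t) (p : G.Walk a b), edist (m a) (m b) ≤ p.length * M := by
    intro a b p
    induction p with
    | nil => simp
    | cons h p ih =>
      rw [SimpleGraph.Walk.length_cons, Nat.cast_add, Nat.cast_one, add_mul, one_mul, add_comm]
      exact (edist_triangle _ _ _).trans
        (add_le_add (hm _ (htT (Subtype.coe_prop _)) _ (htT (Subtype.coe_prop _)) (hG _ _ h)) ih)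
  have h1 := hwalk _ _ p.toPath.1
  have h2 : p.toPath.1.length ≤ t.card := by
    have := p.toPath.2.length_lt
    rw [Fintype.card_coe] at this
    exact this.le
  rw [Metric.mem_ball] at hxi hyj
  calc edist (m x) (m y) ≤ edist (m x) (m i) + edist (m i) (m j) + edist (m j) (m y) :=
        edist_triangle4 _ _ _ _
    _ ≤ M + t.card * M + M := by
        gcongr
        · exact hm x hx i (htT hi) (by linarith)
        · exact h1.trans (by gcongr)
        · exact hm j (htT hj) y hy (by rw [dist_comm]; linarith)
    _ = _ := by push_cast; ring

/-- Means over balls of comparable size along a connected set with the cone property differ by a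
controlled multiple of the gradient energy. -/
theorem exists_ballMean_sub_le {κ : ℝ} (hκ : 0 < κ) (hκ1 : κ ≤ 1) (R : ℝ) :
    ∃ C : ℝ, 0 < C ∧ ∀ (U T : Set E) (δ : ℝ) (u : E → ℝ) (g : E → E), IsOpen U →
      MemH1 U u g → Measurable u → 0 < δ → IsPreconnected T → T ⊆ closure U →
      (∀ x ∈ T, ConeAt U x (3 * δ) κ) → (∀ x ∈ T, ∀ y ∈ T, dist x y ≤ R * δ) →
      ∀ x ∈ T, ∀ y ∈ T, ‖ballMean U u x δ - ballMean U u y δ‖ₑ ^ 2 ≤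
        ENNReal.ofReal (C * (δ ^ 2 / δ ^ n)) * energy U g univ := by
  obtain ⟨N, hN⟩ := exists_card_cover_le (n := n) R
  have hω := unitVol_pos n
  set c := unitVol n * (κ / 4 / 3) ^ n with hc
  have hc0 : 0 < c := by positivity
  set C₀ := 4 * unitVol n * (4 / κ) ^ (n + 2) / c ^ 2 * (3 ^ 2 / 3 ^ n) with hC₀
  have hC₀0 : 0 < C₀ := by positivity
  refine ⟨((N + 2 : ℕ) : ℝ) ^ 2 * C₀, by positivity, ?_⟩
  intro U T δ u g hU h hum hδ hT hTU hcone hR x hx y hy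
  obtain ⟨t, htT, htN, hcov⟩ := hN δ hδ T hR
  set B := ENNReal.ofReal (C₀ * (δ ^ 2 / δ ^ n)) * energy U g univ with hB
  have hvol : ∀ z ∈ T, ENNReal.ofReal (c * (3 * δ) ^ n) ≤ volume (U ∩ Metric.ball z δ) := by
    intro z hz
    refine le_trans (le_of_eq ?_) ((hcone z hz).volume_ge (hTU hz) hκ hκ1 hδ (by linarith))
    rw [hc, mul_assoc, ← mul_pow]
    congr 3; ring
  -- Both balls of radius `δ` lie in the ball of radius `3 * δ` about `a`; hence the cone condition
  -- at scale `3 * δ`.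
  have hstep : ∀ a ∈ T, ∀ b ∈ T, dist a b < 2 * δ →
      edist (ballMean U u a δ) (ballMean U u b δ) ≤ B ^ (1 / 2 : ℝ) := by
    intro a ha b hb hab
    have h1 := h.ballMean_sub_ballMean_le hU hum (hcone a ha) hκ hκ1 (by positivity) le_rfl hc0
      (y := a) (z := b) (r := δ) (t := δ) (Metric.ball_subset_ball (by linarith))
      (Metric.ball_subset_ball' (by rw [dist_comm]; linarith)) (hvol a ha) (hvol b hb)
    rw [edist_eq_enorm_sub]
    have h2 : ‖ballMean U u a δ - ballMean U u b δ‖ₑ ^ 2 ≤ B := by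
      refine h1.trans ?_
      rw [hB]
      refine mul_le_mul' (le_of_eq ?_) (measure_mono (subset_univ _))
      rw [hC₀]
      congr 1
      rw [mul_pow, mul_pow]
      field_simp
      rw [mul_pow]
    rw [one_div, ENNReal.le_rpow_inv_iff (by norm_num)]
    simpa using h2
  have := edist_le_of_chain hT htT hcov hstep hx hy
  rw [edist_eq_enorm_sub] at this
  calc _ ≤ (((N + 2 : ℕ) : ℝ≥0∞) * B ^ (1 / 2 : ℝ)) ^ 2 := by
        gcongr
        exact this.trans (by gcongr)
    _ = ((N + 2 : ℕ) : ℝ≥0∞) ^ 2 * B := by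
        rw [mul_pow, ← ENNReal.rpow_natCast (B ^ _), ← ENNReal.rpow_mul]; norm_num
    _ = _ := by
        rw [hB, ← mul_assoc, mul_assoc _ C₀, ENNReal.ofReal_mul (p := ((N + 2 : ℕ) : ℝ) ^ 2)
          (by positivity), ENNReal.ofReal_pow (by positivity), ENNReal.ofReal_natCast]

end Chain

/-! ### Existence of the trace at a boundary point. -/

section Trace
variable {n : ℕ}
local notation "E" => EuclideanSpace ℝ (Fin n)

/-- Weighted sum over scales of the gradient energy near `x`. It is finite at almost every boundary
point, and it controls the oscillation of the means of `u` near `x`. -/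
noncomputable def scaleSum (U : Set E) (g : E → E) (κ δ : ℝ) (x : E) : ℝ≥0∞ :=
  ∑' k : ℕ, ENNReal.ofReal (4 ^ k * ((δ / 16 ^ k) ^ 2 / (δ / 16 ^ k) ^ n)) *
    energy U g (Metric.ball x (4 / κ * (δ / 16 ^ k)))

theorem measurable_measure_ball (ν : Measure E) [SFinite ν] (r : ℝ) :
    Measurable fun x => ν (Metric.ball x r) := by
  have h : MeasurableSet {p : E × E | dist p.2 p.1 < r} :=
    (isOpen_lt (by fun_prop) continuous_const).measurableSet
  exact measurable_measure_prodMk_left h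

/-- Fubini: `y ∈ B(x, r)` is symmetric in `x` and `y`. -/
theorem lintegral_measure_ball_le {σ ν : Measure E} [SFinite σ] [SFinite ν] {r : ℝ} {c : ℝ≥0∞}
    (h : ∀ y, σ (Metric.ball y r) ≤ c) : ∫⁻ x, ν (Metric.ball x r) ∂σ ≤ c * ν univ := by
  have hm : MeasurableSet {p : E × E | dist p.2 p.1 < r} :=
    (isOpen_lt (by fun_prop) continuous_const).measurableSet
  calc ∫⁻ x, ν (Metric.ball x r) ∂σ = (σ.prod ν) {p : E × E | dist p.2 p.1 < r} :=
        (Measure.prod_apply hm).symm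
    _ = ∫⁻ y, σ (Metric.ball y r) ∂ν := by
        rw [Measure.prod_apply_symm hm]
        congr 1; ext y; congr 1; ext x
        simp [dist_comm]
    _ ≤ ∫⁻ _, c ∂ν := lintegral_mono h
    _ = _ := lintegral_const _

/-- At scale `η = δ / 16 ^ k`, integrating the energy of a ball against `σ` costs a factor of order
`η ^ (n - 1)`, so the term is of order `4 ^ k * η = δ / 4 ^ k`. The ratio `16` leaves room for the
weight `4 ^ k`, which later gives the increments of the means geometric decay. -/
theorem lintegral_scaleSum_le (hn : 1 ≤ n) {U : Set E} {g : E → E} (hg : energy U g univ ≠ ⊤)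
    {κ δ c : ℝ} (hκ : 0 < κ) (hδ : 0 < δ) (hc : 0 ≤ c) {σ : Measure E} [SFinite σ]
    (hσ : ∀ y r, 0 < r → r ≤ 4 / κ * δ → σ (Metric.ball y r) ≤ ENNReal.ofReal (c * r ^ (n - 1))) :
    ∫⁻ x, scaleSum U g κ δ x ∂σ ≤
      ENNReal.ofReal (4 / 3 * (c * (4 / κ) ^ (n - 1)) * δ) * energy U g univ := by
  have : IsFiniteMeasure (energy U g) := ⟨lt_top_iff_ne_top.2 hg⟩
  unfold scaleSum
  rw [lintegral_tsum fun k => ((measurable_measure_ball _ _).const_mul _).aemeasurable]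
  have hterm : ∀ k : ℕ, ∫⁻ x, ENNReal.ofReal (4 ^ k * ((δ / 16 ^ k) ^ 2 / (δ / 16 ^ k) ^ n)) *
      energy U g (Metric.ball x (4 / κ * (δ / 16 ^ k))) ∂σ ≤
      ENNReal.ofReal (c * (4 / κ) ^ (n - 1) * δ * (1 / 4) ^ k) * energy U g univ := by
    intro k
    rw [lintegral_const_mul _ (measurable_measure_ball _ _)]
    have h1 : δ / 16 ^ k ≤ δ := div_le_self hδ.le (one_le_pow₀ (by norm_num))
    have h2 : 0 < δ / 16 ^ k := by positivity
    refine (mul_le_mul_right (lintegral_measure_ball_le fun y =>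
      hσ y (4 / κ * (δ / 16 ^ k)) (by positivity) (by gcongr)) _).trans (le_of_eq ?_)
    rw [← mul_assoc, ← ENNReal.ofReal_mul (by positivity)]
    congr 2
    obtain ⟨m, rfl⟩ : ∃ m, n = m + 1 := ⟨n - 1, by omega⟩
    have e16 : (16 : ℝ) ^ k = 4 ^ k * 4 ^ k := by rw [← mul_pow]; norm_num
    rw [Nat.add_sub_cancel, mul_pow (4 / κ)]
    have : (δ / 16 ^ k) ^ 2 / (δ / 16 ^ k) ^ (m + 1) * (δ / 16 ^ k) ^ m = δ / 16 ^ k := by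
      generalize δ / 16 ^ k = a at h2
      field_simp
      ring
    calc _ = c * (4 / κ) ^ m * 4 ^ k *
          ((δ / 16 ^ k) ^ 2 / (δ / 16 ^ k) ^ (m + 1) * (δ / 16 ^ k) ^ m) := by ring
      _ = _ := by
        rw [this, e16, one_div, inv_pow]
        field_simp
  refine (ENNReal.tsum_le_tsum hterm).trans (le_of_eq ?_)
  rw [ENNReal.tsum_mul_right, ← ENNReal.ofReal_tsum_of_nonneg (fun k => by positivity)
    ((summable_geometric_of_lt_one (by norm_num) (by norm_num)).mul_left _), tsum_mul_left,
    tsum_geometric_of_lt_one (by norm_num) (by norm_num)]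
  congr 2
  ring

theorem sq_le_of_enorm_sq_le {a c : ℝ} {B : ℝ≥0∞} (hB : B ≠ ⊤) (hc : 0 ≤ c)
    (h : ‖a‖ₑ ^ 2 ≤ ENNReal.ofReal c * B) : a ^ 2 ≤ c * B.toReal := by
  have := ENNReal.toReal_mono (ENNReal.mul_ne_top ENNReal.ofReal_ne_top hB) h
  simpa [ENNReal.toReal_ofReal hc] using this

theorem enorm_sq_eq (r : ℝ) : ‖r‖ₑ ^ 2 = ENNReal.ofReal (r ^ 2) := by
  rw [← ofReal_norm, ← ENNReal.ofReal_pow (norm_nonneg _), Real.norm_eq_abs, sq_abs]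

theorem le_scaleSum (U : Set E) (g : E → E) {κ δ : ℝ} (x : E) (k : ℕ) :
    ENNReal.ofReal ((δ / 16 ^ k) ^ 2 / (δ / 16 ^ k) ^ n) *
      energy U g (Metric.ball x (4 / κ * (δ / 16 ^ k))) ≤
      ENNReal.ofReal ((1 / 4) ^ k) * scaleSum U g κ δ x := by
  have h := ENNReal.le_tsum (f := fun k : ℕ =>
    ENNReal.ofReal (4 ^ k * ((δ / 16 ^ k) ^ 2 / (δ / 16 ^ k) ^ n)) *
    energy U g (Metric.ball x (4 / κ * (δ / 16 ^ k)))) k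
  refine le_trans (le_of_eq ?_) (mul_le_mul_right h _)
  rw [← mul_assoc, ← ENNReal.ofReal_mul (by positivity), ← mul_assoc, ← mul_pow]
  norm_num

theorem volume_inter_ball_ne_top (U : Set E) (x : E) (r : ℝ) :
    volume (U ∩ Metric.ball x r) ≠ ⊤ :=
  ((measure_mono inter_subset_right).trans_lt measure_ball_lt_top).ne

/-- A mean value is controlled by the `L²` norm. -/
theorem sq_setAverage_abs_le {α : Type*} [MeasurableSpace α] {μ : Measure α} {f : α → ℝ}
    (hf : Measurable f) {A : Set α} {b : ℝ} (hA : μ A ≠ ⊤) (hb : 0 ≤ b)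
    (h : ∫⁻ x in A, ‖f x‖ₑ ^ 2 ∂μ ≤ ENNReal.ofReal b * μ A) : (⨍ x in A, |f x| ∂μ) ^ 2 ≤ b := by
  have h1 := enorm_integral_sq_le (μ := μ.restrict A) hf.abs.aestronglyMeasurable
  simp only [Real.enorm_abs, Measure.restrict_apply_univ] at h1
  have h2 : ‖∫ x in A, |f x| ∂μ‖ₑ ^ 2 ≤ ENNReal.ofReal b * (μ A) ^ 2 := by
    refine h1.trans ((mul_le_mul_right h _).trans (le_of_eq ?_)); ring
  have h3 := sq_le_of_enorm_sq_le (ENNReal.pow_ne_top hA) hb h2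
  rw [setAverage_eq, smul_eq_mul, mul_pow, Measure.real]
  rw [ENNReal.toReal_pow] at h3
  rcases (ENNReal.toReal_nonneg (a := μ A)).eq_or_lt with h0 | h0
  · rw [← h0]; simpa using hb
  · rw [inv_pow, inv_mul_le_iff₀ (by positivity)]; linarith

/-- Means at consecutive scales differ by at most a constant times `2 ^ (-k)` times the square root
of `scaleSum`, so they converge. The local Poincaré inequality upgrades this to convergence of the
means of `|u - t|`, and a radius between two scales is handled because the volumes are comparable.
-/
theorem exists_trace_of_scaleSum_ne_top {κ : ℝ} (hκ : 0 < κ) (hκ1 : κ ≤ 1) :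
    ∃ C : ℝ, 0 < C ∧ ∀ (U : Set E) (u : E → ℝ) (g : E → E), IsOpen U → MemH1 U u g →
      Measurable u → ∀ (x : E) (δ : ℝ), 0 < δ → x ∈ closure U → ConeAt U x δ κ →
      scaleSum U g κ δ x ≠ ⊤ →
      ∃ h : ℝ, Tendsto (fun ε : ℝ => ⨍ y in U ∩ Metric.ball x ε, |u y - h|) (𝓝[>] 0) (𝓝 0) ∧
        ‖h - ballMean U u x δ‖ₑ ^ 2 ≤ ENNReal.ofReal C * scaleSum U g κ δ x := by
  have hω := unitVol_pos n
  set c := unitVol n * (κ / 4 / 16) ^ n with hc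
  have hc0 : 0 < c := by positivity
  set C₁ := 4 * unitVol n * (4 / κ) ^ (n + 2) / c ^ 2 with hC₁
  have hC₁0 : 0 < C₁ := by positivity
  refine ⟨4 * C₁, by positivity, ?_⟩
  intro U u g hU h hum x δ hδ hx hcone hG
  set G := scaleSum U g κ δ x with hGdef
  set Gr := G.toReal with hGr
  have hGr0 : 0 ≤ Gr := ENNReal.toReal_nonneg
  set η : ℕ → ℝ := fun k => δ / 16 ^ k with hη
  have hη0 : ∀ k, 0 < η k := fun k => by simp only [hη]; positivity
  have hηδ : ∀ k, η k ≤ δ := fun k => div_le_self hδ.le (one_le_pow₀ (by norm_num))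
  have hηs : ∀ k, η (k + 1) = η k / 16 := fun k => by simp only [hη, pow_succ]; field_simp
  set m : ℕ → ℝ := fun k => ballMean U u x (η k) with hm
  have hvol : ∀ k r, η (k + 1) ≤ r →
      ENNReal.ofReal (c * η k ^ n) ≤ volume (U ∩ Metric.ball x r) := by
    intro k r hr
    refine le_trans (le_of_eq ?_) ((hcone.volume_ge hx hκ hκ1 (hη0 (k + 1)) (hηδ (k + 1))).trans
      (measure_mono (inter_subset_inter_right _ (Metric.ball_subset_ball hr))))
    rw [hc, mul_assoc, ← mul_pow, hηs]
    congr 3; ring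
  have hstep : ∀ k, (m k - m (k + 1)) ^ 2 ≤ C₁ * ((1 / 4) ^ k * Gr) := by
    intro k
    have h1 := h.ballMean_sub_ballMean_le hU hum hcone hκ hκ1 (hη0 k) (hηδ k) hc0
      (y := x) (z := x) (r := η k) (t := η (k + 1)) subset_rfl
      (Metric.ball_subset_ball (by rw [hηs]; linarith [hη0 k]))
      (hvol k _ (by rw [hηs]; linarith [hη0 k])) (hvol k _ le_rfl)
    rw [ENNReal.ofReal_mul (by positivity), mul_assoc] at h1
    have h2 := h1.trans (mul_le_mul_right (le_scaleSum U g x k) _)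
    rw [← mul_assoc, ← ENNReal.ofReal_mul (by positivity)] at h2
    rw [← mul_assoc]
    exact sq_le_of_enorm_sq_le hG (by positivity) h2
  set A := Real.sqrt (C₁ * Gr) with hA
  have hA2 : A ^ 2 = C₁ * Gr := Real.sq_sqrt (by positivity)
  have hA0 : 0 ≤ A := Real.sqrt_nonneg _
  have hdist : ∀ k, dist (m k) (m (k + 1)) ≤ A * (1 / 2) ^ k := by
    intro k
    rw [Real.dist_eq]
    refine abs_le_of_sq_le_sq ?_ (by positivity)
    refine (hstep k).trans (le_of_eq ?_)
    rw [mul_pow, hA2, ← pow_mul, mul_comm k 2, pow_mul]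
    norm_num; ring
  obtain ⟨t, ht⟩ := cauchySeq_tendsto_of_complete
    (cauchySeq_of_le_geometric (1 / 2) A (by norm_num) hdist)
  have hmt : ∀ k, (t - m k) ^ 2 ≤ 4 * C₁ * ((1 / 4) ^ k * Gr) := by
    intro k
    have h1 := dist_le_of_le_geometric_of_tendsto (1 / 2) A (by norm_num) hdist ht k
    have h2 : |t - m k| ≤ 2 * A * (1 / 2) ^ k := by
      rw [← Real.dist_eq, dist_comm]; refine h1.trans (le_of_eq ?_); ring
    rw [← sq_abs]
    refine (pow_le_pow_left₀ (abs_nonneg _) h2 2).trans (le_of_eq ?_)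
    rw [mul_pow, mul_pow, hA2, ← pow_mul, mul_comm k 2, pow_mul]
    norm_num; ring
  refine ⟨t, ?_, ?_⟩
  swap
  · have h0 := hmt 0
    have e0 : m 0 = ballMean U u x δ := by simp [hm, hη]
    rw [pow_zero, one_mul, e0] at h0
    rw [enorm_sq_eq]
    refine (ENNReal.ofReal_le_ofReal h0).trans (le_of_eq ?_)
    rw [ENNReal.ofReal_mul (by positivity), ENNReal.ofReal_toReal hG]
  set C₂ := (2 * (4 * (4 / κ) ^ (2 * n + 2)) + 2 * (4 * C₁) * unitVol n) / c with hC₂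
  have hC₂0 : 0 < C₂ := by positivity
  have havg : ∀ k ε, η (k + 1) < ε → ε ≤ η k →
      (⨍ y in U ∩ Metric.ball x ε, |u y - t|) ^ 2 ≤ C₂ * ((1 / 4) ^ k * Gr) := by
    intro k ε hε1 hε2
    refine sq_setAverage_abs_le (hum.sub_const t) (volume_inter_ball_ne_top _ _ _)
      (by positivity) ?_
    have h1 := h.lintegral_sub_ballMean_le hU hum hcone hx hκ hκ1 (hη0 k) (hηδ k)
    have h2 : ENNReal.ofReal (η k ^ 2) * energy U g (Metric.ball x (4 / κ * η k)) ≤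
        ENNReal.ofReal (η k ^ n * ((1 / 4) ^ k * Gr)) := by
      have h3 := mul_le_mul_right (le_scaleSum U g (κ := κ) (δ := δ) x k) (ENNReal.ofReal (η k ^ n))
      rw [← mul_assoc, ← ENNReal.ofReal_mul (by have := hη0 k; positivity),
        mul_div_cancel₀ _ (pow_pos (hη0 k) n).ne'] at h3
      refine h3.trans (le_of_eq ?_)
      rw [ENNReal.ofReal_mul (by have := hη0 k; positivity),
        ENNReal.ofReal_mul (p := (1 / 4) ^ k) (by positivity), ENNReal.ofReal_toReal hG]
    calc ∫⁻ y in U ∩ Metric.ball x ε, ‖u y - t‖ₑ ^ 2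
        ≤ ∫⁻ y in U ∩ Metric.ball x (η k), ‖u y - t‖ₑ ^ 2 :=
          lintegral_mono_set (inter_subset_inter_right _ (Metric.ball_subset_ball hε2))
      _ ≤ ∫⁻ y in U ∩ Metric.ball x (η k), (2 * ‖u y - m k‖ₑ ^ 2 + 2 * ‖t - m k‖ₑ ^ 2) :=
          lintegral_mono fun y => enorm_sub_sq_le _ _ _
      _ = 2 * (∫⁻ y in U ∩ Metric.ball x (η k), ‖u y - m k‖ₑ ^ 2) +
            2 * ‖t - m k‖ₑ ^ 2 * volume (U ∩ Metric.ball x (η k)) := by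
          rw [lintegral_add_right _ measurable_const, lintegral_const_mul _ (by fun_prop),
            lintegral_const, Measure.restrict_apply_univ]
      _ ≤ 2 * (ENNReal.ofReal (4 * (4 / κ) ^ (2 * n + 2)) *
            ENNReal.ofReal (η k ^ n * ((1 / 4) ^ k * Gr))) +
            2 * ENNReal.ofReal (4 * C₁ * ((1 / 4) ^ k * Gr)) *
              ENNReal.ofReal (unitVol n * η k ^ n) := by
          gcongr
          · refine h1.trans ?_
            rw [ENNReal.ofReal_mul (by positivity), mul_assoc]
            gcongr
          · rw [enorm_sq_eq]; exact ENNReal.ofReal_le_ofReal (hmt k)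
          · rw [← volume_ball_eq x (hη0 k)]; exact measure_mono inter_subset_right
      _ = ENNReal.ofReal (C₂ * ((1 / 4) ^ k * Gr)) * ENNReal.ofReal (c * η k ^ n) := by
          have := hη0 k
          rw [← ENNReal.ofReal_ofNat 2]
          rw [← ENNReal.ofReal_mul (by positivity), ← ENNReal.ofReal_mul (by positivity),
            ← ENNReal.ofReal_mul (by positivity), ← ENNReal.ofReal_mul (by positivity),
            ← ENNReal.ofReal_mul (by positivity), ← ENNReal.ofReal_add (by positivity)
            (by positivity), hC₂]
          congr 1
          field_simp
      _ ≤ _ := mul_le_mul_right (hvol k ε hε1.le) _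
  rw [Metric.tendsto_nhdsWithin_nhds]
  intro τ hτ
  have hlim : Tendsto (fun k : ℕ => C₂ * ((1 / 4 : ℝ) ^ k * Gr)) atTop (𝓝 (C₂ * (0 * Gr))) :=
    ((tendsto_pow_atTop_nhds_zero_of_lt_one (by norm_num) (by norm_num)).mul_const _).const_mul _
  rw [zero_mul, mul_zero] at hlim
  obtain ⟨K, hK⟩ := (hlim.eventually (gt_mem_nhds (show (0 : ℝ) < τ ^ 2 by positivity))).exists
  refine ⟨η K, hη0 K, fun ε hε0 hεK => ?_⟩
  rw [mem_Ioi] at hε0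
  rw [Real.dist_eq, sub_zero, abs_of_pos hε0] at hεK
  -- The scale with `η (k + 1) < ε ≤ η k`.
  obtain ⟨k, hk1, hk2⟩ := exists_nat_pow_near_of_lt_one (x := ε / δ) (y := 1 / 16)
    (by positivity) (by rw [div_le_one hδ]; exact hεK.le.trans (hηδ K)) (by norm_num) (by norm_num)
  rw [lt_div_iff₀ hδ] at hk1
  rw [div_le_iff₀ hδ] at hk2
  have e1 : ∀ j : ℕ, (1 / 16 : ℝ) ^ j * δ = η j := fun j => by
    simp only [hη, one_div, inv_pow]; field_simp
  rw [e1] at hk1 hk2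
  have hKk : K ≤ k := by
    by_contra hlt
    push Not at hlt
    have : η K ≤ η (k + 1) := by
      simp only [hη]
      gcongr
      · norm_num
      · omega
    linarith
  have h5 := havg k ε hk1 hk2
  rw [Real.dist_eq, sub_zero]
  refine abs_lt_of_sq_lt_sq (h5.trans_lt (lt_of_le_of_lt ?_ hK)) hτ.le
  have : (1 / 4 : ℝ) ^ k ≤ (1 / 4) ^ K := pow_le_pow_of_le_one (by norm_num) (by norm_num) hKk
  gcongr

/-- If the means of `|u - h|` tend to `0`, then the means of `u` tend to `h`. -/
theorem tendsto_ballMean_of_tendsto {U : Set E} {u : E → ℝ} {x : E} {h : ℝ}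
    (hpos : ∀ ε, 0 < ε → volume (U ∩ Metric.ball x ε) ≠ 0)
    (hint : ∀ ε, IntegrableOn u (U ∩ Metric.ball x ε))
    (hlim : Tendsto (fun ε : ℝ => ⨍ y in U ∩ Metric.ball x ε, |u y - h|) (𝓝[>] 0) (𝓝 0)) :
    Tendsto (fun ε => ballMean U u x ε) (𝓝[>] 0) (𝓝 h) := by
  rw [tendsto_iff_dist_tendsto_zero]
  refine squeeze_zero' (Eventually.of_forall fun _ => dist_nonneg) ?_ hlim
  filter_upwards [self_mem_nhdsWithin] with ε hε
  have h0 := hpos ε hε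
  have ht := volume_inter_ball_ne_top U x ε
  have hr : 0 < (volume (U ∩ Metric.ball x ε)).toReal := ENNReal.toReal_pos h0 ht
  have h1 : ∫ y in U ∩ Metric.ball x ε, (u y - h) =
      (volume (U ∩ Metric.ball x ε)).toReal * (ballMean U u x ε - h) := by
    rw [integral_sub (hint ε) (integrableOn_const ht), setIntegral_const,
      ballMean, setAverage_eq, smul_eq_mul, smul_eq_mul, Measure.real, mul_sub,
      mul_inv_cancel_left₀ hr.ne']
  have h2 := norm_integral_le_integral_norm (μ := volume.restrict (U ∩ Metric.ball x ε))
    (fun y => u y - h)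
  rw [h1, norm_mul, Real.norm_of_nonneg hr.le] at h2
  rw [Real.dist_eq, setAverage_eq, smul_eq_mul, Measure.real, ← div_eq_inv_mul, le_div_iff₀ hr,
    mul_comm]
  exact h2

end Trace

/-! ### Poincaré inequalities under the cone condition. -/

section BoundaryInequality
variable {n : ℕ}
local notation "E" => EuclideanSpace ℝ (Fin n)

theorem lintegral_biUnion_finset_le {α ι : Type*} [MeasurableSpace α] {μ : Measure α} (t : Finset ι)
    (s : ι → Set α) (f : α → ℝ≥0∞) :
    ∫⁻ y in ⋃ i ∈ t, s i, f y ∂μ ≤ ∑ i ∈ t, ∫⁻ y in s i, f y ∂μ := by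
  classical
  induction t using Finset.induction_on with
  | empty => simp
  | insert a t ha ih =>
    rw [Finset.set_biUnion_insert, Finset.sum_insert ha]
    exact (lintegral_union_le _ _ _).trans (by gcongr)

theorem measurable_ballMean {U : Set E} {u : E → ℝ} (hu : Measurable u)
    (r : ℝ) : Measurable fun x => ballMean U u x r := by
  have hm : MeasurableSet {p : E × E | dist p.2 p.1 < r} :=
    (isOpen_lt (by fun_prop) continuous_const).measurableSet
  have h1 : Measurable fun x => ∫ y in U, ({p : E × E | dist p.2 p.1 < r}.indicator
      (fun p => u p.2)) (x, y) :=
    (StronglyMeasurable.integral_prod_right' (ν := volume.restrict U)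
      (((hu.comp measurable_snd).indicator hm).stronglyMeasurable)).measurable
  have h2 : Measurable fun x => (volume.restrict U (Metric.ball x r)).toReal :=
    (measurable_measure_ball _ r).ennreal_toReal
  convert h2.inv.mul h1 using 1
  ext x
  have e1 : ∫ y in U, ({p : E × E | dist p.2 p.1 < r}.indicator (fun p => u p.2)) (x, y) =
      ∫ y in U ∩ Metric.ball x r, u y := by
    rw [← setIntegral_indicator measurableSet_ball]
    rfl
  rw [ballMean, setAverage_eq, smul_eq_mul, Measure.real, Pi.mul_apply, Pi.inv_apply, e1,
    Measure.restrict_apply measurableSet_ball, inter_comm U]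

theorem integral_sub_sq_eq {α : Type*} [MeasurableSpace α] {μ : Measure α}
    {f : α → ℝ} (hf : AEStronglyMeasurable f μ) (c : ℝ) :
    ∫ x, (f x - c) ^ 2 ∂μ = (∫⁻ x, ‖f x - c‖ₑ ^ 2 ∂μ).toReal := by
  have hm : AEStronglyMeasurable (fun x => (f x - c) ^ 2) μ :=
    (hf.sub aestronglyMeasurable_const).pow 2
  rw [integral_eq_lintegral_of_nonneg_ae (ae_of_all _ fun x => sq_nonneg _) hm]
  simp only [enorm_sq_eq]

/-- The mean is the best constant in `L²`; the means in the theorem may thus be replaced by any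
convenient ball mean. -/
theorem integral_sub_average_sq_le {α : Type*} [MeasurableSpace α] {μ : Measure α}
    [IsFiniteMeasure μ] {f : α → ℝ} (hf : MemLp f 2 μ) (c : ℝ) :
    ∫ x, (f x - ⨍ y, f y ∂μ) ^ 2 ∂μ ≤ ∫ x, (f x - c) ^ 2 ∂μ := by
  set a := ⨍ y, f y ∂μ with ha
  have hfi : Integrable f μ := hf.integrable (by norm_num)
  have h2 : Integrable (fun x => (f x - a) ^ 2) μ := (hf.sub (memLp_const a)).integrable_sq
  have h3 : Integrable (fun x => (2 * (a - c)) * (f x - a)) μ :=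
    (hfi.sub (integrable_const a)).const_mul _
  have h4 : ∫ x, (f x - a) ∂μ = 0 := by
    rw [ha]; exact integral_sub_average μ f
  have h5 : ∫ x, (f x - c) ^ 2 ∂μ = ∫ x, (f x - a) ^ 2 ∂μ + μ.real univ * (a - c) ^ 2 := by
    have : ∀ x, (f x - c) ^ 2 = (f x - a) ^ 2 + (2 * (a - c)) * (f x - a) + (a - c) ^ 2 := by
      intro x; ring
    simp_rw [this]
    have h23 : Integrable (fun x => (f x - a) ^ 2 + 2 * (a - c) * (f x - a)) μ := h2.add h3
    rw [integral_add h23 (integrable_const _), integral_add h2 h3, integral_const_mul, h4,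
      integral_const, smul_eq_mul]
    ring
  rw [h5]
  have : 0 ≤ μ.real univ * (a - c) ^ 2 := by positivity
  linarith

theorem integral_norm_sq_eq {U : Set E} {u : E → ℝ} {g : E → E} (h : MemH1 U u g) :
    ∫ x in U, ‖g x‖ ^ 2 = (energy U g univ).toReal := by
  rw [energy_univ, integral_eq_lintegral_of_nonneg_ae (ae_of_all _ fun x => sq_nonneg _)
    (h.memLp_grad.1.norm.pow 2)]
  congr 2; ext x
  rw [← ofReal_norm, ENNReal.ofReal_pow (norm_nonneg _)]

theorem MemH1.enorm_ballMean_sq_le {U : Set E} {u : E → ℝ} {g : E → E} (h : MemH1 U u g)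
    {x : E} {r c : ℝ} (hc : 0 < c)
    (hv : ENNReal.ofReal c ≤ volume (U ∩ Metric.ball x r)) :
    ‖ballMean U u x r‖ₑ ^ 2 ≤ ENNReal.ofReal (1 / c) * ∫⁻ y in U, ‖u y‖ₑ ^ 2 := by
  have : IsFiniteMeasure (volume.restrict (U ∩ Metric.ball x r)) :=
    ⟨by rw [Measure.restrict_apply_univ]
        exact (measure_mono inter_subset_right).trans_lt measure_ball_lt_top⟩
  have h1 := measure_mul_enorm_sub_average_sq_le (h.integrableOn_inter_ball x r) 0
  simp only [zero_sub, enorm_neg, Measure.restrict_apply_univ] at h1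
  refine le_ofReal_div_mul hc ?_
  rw [ENNReal.ofReal_one, one_mul]
  exact (mul_le_mul_left hv _).trans (h1.trans (lintegral_mono_set inter_subset_left))

/-- The sum over scales is `σ`-integrable, hence finite almost everywhere, and the pointwise
construction applies. Any trace is almost everywhere the limit of the ball means, so it agrees with
the constructed one and inherits the estimate. -/
theorem exists_trace_estimate (hn : 1 ≤ n) {κ : ℝ} (hκ : 0 < κ) (hκ1 : κ ≤ 1) {c : ℝ}
    (hc : 0 < c) :
    ∃ C : ℝ, 0 < C ∧ ∀ (U : Set E) (u : E → ℝ) (g : E → E) (δ : ℝ) (σ : Measure E),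
      IsOpen U → MemH1 U u g → Measurable u → 0 < δ → IsFiniteMeasure σ →
      (∀ᵐ x ∂σ, x ∈ closure U ∧ ConeAt U x δ κ) →
      (∀ y r, 0 < r → r ≤ 4 / κ * δ → σ (Metric.ball y r) ≤ ENNReal.ofReal (c * r ^ (n - 1))) →
      (∃ h : E → ℝ, ∀ᵐ x ∂σ,
        Tendsto (fun ε : ℝ => ⨍ y in U ∩ Metric.ball x ε, |u y - h x|) (𝓝[>] 0) (𝓝 0)) ∧
      ∀ h : E → ℝ, (∀ᵐ x ∂σ,
        Tendsto (fun ε : ℝ => ⨍ y in U ∩ Metric.ball x ε, |u y - h x|) (𝓝[>] 0) (𝓝 0)) →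
        MemLp h 2 σ ∧ ∫⁻ x, ‖h x - ballMean U u x δ‖ₑ ^ 2 ∂σ ≤
          ENNReal.ofReal (C * δ) * energy U g univ := by
  obtain ⟨C, hC0, hC⟩ := exists_trace_of_scaleSum_ne_top (n := n) hκ hκ1
  refine ⟨C * (4 / 3 * (c * (4 / κ) ^ (n - 1))), by positivity, ?_⟩
  intro U u g δ σ hU h hum hδ hσf hcone hσ
  have hω := unitVol_pos n
  have hE := h.energy_lt_top.ne
  have : IsFiniteMeasure (energy U g) := ⟨h.energy_lt_top⟩
  have hG := lintegral_scaleSum_le hn hE hκ hδ hc.le hσ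
  have hGm : Measurable (scaleSum U g κ δ) :=
    Measurable.tsum fun k => (measurable_measure_ball _ _).const_mul _
  have hGfin : ∀ᵐ x ∂σ, scaleSum U g κ δ x ≠ ⊤ := by
    filter_upwards [ae_lt_top hGm (hG.trans_lt
      (ENNReal.mul_lt_top ENNReal.ofReal_lt_top h.energy_lt_top)).ne] with x hx using hx.ne
  have hex : ∀ᵐ x ∂σ, ∃ t : ℝ,
      Tendsto (fun ε : ℝ => ⨍ y in U ∩ Metric.ball x ε, |u y - t|) (𝓝[>] 0) (𝓝 0) ∧
        ‖t - ballMean U u x δ‖ₑ ^ 2 ≤ ENNReal.ofReal C * scaleSum U g κ δ x := by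
    filter_upwards [hGfin, hcone] with x hx hc
    exact hC U u g hU h hum x δ hδ hc.1 hc.2 hx
  refine ⟨?_, ?_⟩
  · classical
    refine ⟨fun x => if hx : ∃ t : ℝ,
      Tendsto (fun ε : ℝ => ⨍ y in U ∩ Metric.ball x ε, |u y - t|) (𝓝[>] 0) (𝓝 0) ∧
        ‖t - ballMean U u x δ‖ₑ ^ 2 ≤ ENNReal.ofReal C * scaleSum U g κ δ x
        then hx.choose else 0, ?_⟩
    filter_upwards [hex] with x hx
    simp only [dif_pos hx]
    exact hx.choose_spec.1
  intro t ht
  have hpos : ∀ᵐ x ∂σ, ∀ ε, 0 < ε → volume (U ∩ Metric.ball x ε) ≠ 0 := by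
    filter_upwards [hcone] with x hx ε hε
    have h1 := hx.2.volume_ge hx.1 hκ hκ1 (lt_min hε hδ) (min_le_right ε δ)
    have h2 : 0 < min ε δ := lt_min hε hδ
    have h3 : 0 < ENNReal.ofReal (unitVol n * (κ / 4 * min ε δ) ^ n) :=
      ENNReal.ofReal_pos.2 (by positivity)
    exact (h3.trans_le (h1.trans (measure_mono (inter_subset_inter_right _
      (Metric.ball_subset_ball (min_le_left _ _)))))).ne'
  have hlim : ∀ᵐ x ∂σ, Tendsto (fun ε => ballMean U u x ε) (𝓝[>] 0) (𝓝 (t x)) := by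
    filter_upwards [ht, hpos] with x hx hp
    exact tendsto_ballMean_of_tendsto hp (h.integrableOn_inter_ball x) hx
  have hle : ∫⁻ x, ‖t x - ballMean U u x δ‖ₑ ^ 2 ∂σ ≤
      ENNReal.ofReal (C * (4 / 3 * (c * (4 / κ) ^ (n - 1))) * δ) * energy U g univ := by
    calc ∫⁻ x, ‖t x - ballMean U u x δ‖ₑ ^ 2 ∂σ
        ≤ ∫⁻ x, ENNReal.ofReal C * scaleSum U g κ δ x ∂σ := by
          refine lintegral_mono_ae ?_
          filter_upwards [hlim, hex, hpos] with x hx1 hx2 hp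
          obtain ⟨s, hs1, hs2⟩ := hx2
          have := tendsto_nhds_unique hx1
            (tendsto_ballMean_of_tendsto hp (h.integrableOn_inter_ball x) hs1)
          rwa [this]
      _ = ENNReal.ofReal C * ∫⁻ x, scaleSum U g κ δ x ∂σ := lintegral_const_mul _ hGm
      _ ≤ _ := by
          refine (mul_le_mul_right hG _).trans (le_of_eq ?_)
          rw [← mul_assoc, ← ENNReal.ofReal_mul hC0.le, mul_assoc C]
  -- A trace is not assumed measurable: it is an almost everywhere limit of measurable ball means.
  have hmeas : AEStronglyMeasurable t σ := by
    have hseq : Tendsto (fun k : ℕ => 1 / ((k : ℝ) + 1)) atTop (𝓝[>] 0) :=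
      tendsto_nhdsWithin_iff.2 ⟨tendsto_one_div_add_atTop_nhds_zero_nat,
        Eventually.of_forall fun k => by rw [mem_Ioi]; positivity⟩
    refine aestronglyMeasurable_of_tendsto_ae atTop
      (f := fun (k : ℕ) x => ballMean U u x (1 / ((k : ℝ) + 1)))
      (fun k => (measurable_ballMean hum _).aestronglyMeasurable) ?_
    filter_upwards [hlim] with x hx using hx.comp hseq
  refine ⟨⟨hmeas, ?_⟩, hle⟩
  have hbm := measurable_ballMean (U := U) hum δ
  rw [eLpNorm_lt_top_iff_lintegral_rpow_enorm_lt_top (by simp) (by simp)]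
  simp only [ENNReal.toReal_ofNat, ENNReal.rpow_ofNat]
  set c₀ := unitVol n * (κ / 4 * δ) ^ n with hc₀
  have hc₀0 : 0 < c₀ := by positivity
  calc ∫⁻ x, ‖t x‖ₑ ^ 2 ∂σ
      ≤ ∫⁻ x, (2 * ‖t x - ballMean U u x δ‖ₑ ^ 2 +
          2 * (ENNReal.ofReal (1 / c₀) * ∫⁻ y in U, ‖u y‖ₑ ^ 2)) ∂σ := by
        refine lintegral_mono_ae ?_
        filter_upwards [hcone] with x hx
        have h1 := enorm_sub_sq_le (t x) 0 (ballMean U u x δ)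
        rw [sub_zero, zero_sub, enorm_neg] at h1
        refine h1.trans ?_
        gcongr
        exact h.enorm_ballMean_sq_le hc₀0 (hx.2.volume_ge hx.1 hκ hκ1 hδ le_rfl)
    _ = 2 * ∫⁻ x, ‖t x - ballMean U u x δ‖ₑ ^ 2 ∂σ +
          2 * (ENNReal.ofReal (1 / c₀) * ∫⁻ y in U, ‖u y‖ₑ ^ 2) * σ univ := by
        rw [lintegral_add_right _ measurable_const, lintegral_const, lintegral_const_mul' _ _
          (by simp)]
    _ < ⊤ := by
        have h2 := hle.trans_lt (ENNReal.mul_lt_top ENNReal.ofReal_lt_top h.energy_lt_top)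
        have h3 := lintegral_enorm_sq_lt_top h.memLp
        have h4 := measure_lt_top σ univ
        refine ENNReal.add_lt_top.2 ⟨ENNReal.mul_lt_top (by simp) h2, ENNReal.mul_lt_top
          (ENNReal.mul_lt_top (by simp) (ENNReal.mul_lt_top (by simp) h3)) h4⟩

/-- The boundary Poincaré inequality, for sets with the cone property near a connected set `T` that
carries the boundary measure `σ`. -/
theorem exists_boundary_poincare (hn : 1 ≤ n) {κ : ℝ} (hκ : 0 < κ) (hκ1 : κ ≤ 1) {c : ℝ}
    (hc : 0 < c) {c' : ℝ} (hc' : 0 < c') (R : ℝ) :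
    ∃ C : ℝ, 0 < C ∧ ∀ (U T : Set E) (u : E → ℝ) (g : E → E) (δ : ℝ) (σ : Measure E),
      IsOpen U → MemH1 U u g → Measurable u → 0 < δ → IsPreconnected T → T ⊆ closure U →
      (∀ x ∈ T, ConeAt U x (3 * δ) κ) → (∀ x ∈ T, ∀ y ∈ T, dist x y ≤ R * δ) →
      (∀ᵐ x ∂σ, x ∈ T) →
      (∀ y r, 0 < r → r ≤ 4 / κ * δ → σ (Metric.ball y r) ≤ ENNReal.ofReal (c * r ^ (n - 1))) →
      σ univ ≤ ENNReal.ofReal (c' * δ ^ (n - 1)) →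
      ∀ h : E → ℝ, (∀ᵐ x ∂σ,
        Tendsto (fun ε : ℝ => ⨍ y in U ∩ Metric.ball x ε, |u y - h x|) (𝓝[>] 0) (𝓝 0)) →
        ∫ x, (h x - ⨍ y, h y ∂σ) ^ 2 ∂σ ≤ C * δ * ∫ x in U, ‖g x‖ ^ 2 := by
  obtain ⟨C₁, hC₁0, hC₁⟩ := exists_trace_estimate (n := n) hn hκ hκ1 hc
  obtain ⟨C₂, hC₂0, hC₂⟩ := exists_ballMean_sub_le (n := n) hκ hκ1 R
  refine ⟨2 * C₁ + 2 * C₂ * c', by positivity, ?_⟩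
  intro U T u g δ σ hU h hum hδ hT hTU hcone hR hσT hσ hσu t ht
  have hσf : IsFiniteMeasure σ := ⟨hσu.trans_lt ENNReal.ofReal_lt_top⟩
  have hE := h.energy_lt_top.ne
  obtain ⟨htL, hle⟩ := (hC₁ U u g δ σ hU h hum hδ hσf (by
    filter_upwards [hσT] with x hx
    exact ⟨hTU hx, (hcone x hx).mono hκ (by linarith)⟩) hσ).2 t ht
  rw [integral_norm_sq_eq h]
  rcases T.eq_empty_or_nonempty with rfl | ⟨x₀, hx₀⟩
  · have : σ = 0 := by simpa using hσT
    rw [this, integral_zero_measure]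
    positivity
  -- One fixed mean suffices: the trace is near the mean at its own point, and chaining along `T`
  -- links that mean to the one at `x₀`.
  refine (integral_sub_average_sq_le htL (ballMean U u x₀ δ)).trans ?_
  rw [integral_sub_sq_eq htL.1]
  refine ENNReal.toReal_le_of_le_ofReal (by positivity) ?_
  rw [ENNReal.ofReal_mul (by positivity), ENNReal.ofReal_toReal hE]
  set F := energy U g univ with hF
  calc ∫⁻ x, ‖t x - ballMean U u x₀ δ‖ₑ ^ 2 ∂σ
      ≤ ∫⁻ x, (2 * ‖t x - ballMean U u x δ‖ₑ ^ 2 +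
          2 * (ENNReal.ofReal (C₂ * (δ ^ 2 / δ ^ n)) * F)) ∂σ := by
        refine lintegral_mono_ae ?_
        filter_upwards [hσT] with x hx
        refine (enorm_sub_sq_le _ _ (ballMean U u x δ)).trans ?_
        gcongr
        exact hC₂ U T δ u g hU h hum hδ hT hTU hcone hR x₀ hx₀ x hx
    _ = 2 * ∫⁻ x, ‖t x - ballMean U u x δ‖ₑ ^ 2 ∂σ +
          2 * (ENNReal.ofReal (C₂ * (δ ^ 2 / δ ^ n)) * F) * σ univ := by
        rw [lintegral_add_right _ measurable_const, lintegral_const, lintegral_const_mul' _ _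
          (by simp)]
    _ ≤ 2 * (ENNReal.ofReal (C₁ * δ) * F) +
          2 * (ENNReal.ofReal (C₂ * (δ ^ 2 / δ ^ n)) * F) * ENNReal.ofReal (c' * δ ^ (n - 1)) := by
        gcongr
    _ = (ENNReal.ofReal (2 * (C₁ * δ)) +
          ENNReal.ofReal (2 * (C₂ * (δ ^ 2 / δ ^ n)) * (c' * δ ^ (n - 1)))) * F := by
        rw [ENNReal.ofReal_mul (p := 2 * (C₂ * (δ ^ 2 / δ ^ n))) (by positivity),
          ENNReal.ofReal_mul (p := 2) (by norm_num), ENNReal.ofReal_mul (p := 2) (by norm_num),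
          ENNReal.ofReal_ofNat]
        ring
    _ = _ := by
        rw [← ENNReal.ofReal_add (by positivity) (by positivity)]
        congr 2
        obtain ⟨m, rfl⟩ : ∃ m, n = m + 1 := ⟨n - 1, by omega⟩
        rw [Nat.add_sub_cancel]
        field_simp
        ring

/-- The Poincaré inequality on a connected set with the cone property. -/
theorem exists_poincare {κ : ℝ} (hκ : 0 < κ) (hκ1 : κ ≤ 1) (R : ℝ) :
    ∃ C : ℝ, 0 < C ∧ ∀ (U : Set E) (u : E → ℝ) (g : E → E) (δ : ℝ),
      IsOpen U → MemH1 U u g → Measurable u → 0 < δ → IsPreconnected U → Bornology.IsBounded U →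
      (∀ x ∈ U, ConeAt U x (3 * δ) κ) → (∀ x ∈ U, ∀ y ∈ U, dist x y ≤ R * δ) →
        ∫ x in U, (u x - ⨍ y in U, u y) ^ 2 ≤ C * δ ^ 2 * ∫ x in U, ‖g x‖ ^ 2 := by
  obtain ⟨N, hN⟩ := exists_card_cover_le (n := n) R
  obtain ⟨C₂, hC₂0, hC₂⟩ := exists_ballMean_sub_le (n := n) hκ hκ1 R
  have hω := unitVol_pos n
  set C₀ := 2 * (4 * (4 / κ) ^ (2 * n + 2)) + 2 * C₂ * unitVol n with hC₀
  -- `N` may be zero; `N + 1` keeps the constant positive.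
  refine ⟨(N + 1 : ℕ) * C₀, by positivity, ?_⟩
  intro U u g δ hU h hum hδ hUc hUb hcone hR
  have hE := h.energy_lt_top.ne
  have : IsFiniteMeasure (volume.restrict U) :=
    ⟨by rw [Measure.restrict_apply_univ]; exact hUb.measure_lt_top⟩
  rw [integral_norm_sq_eq h]
  rcases U.eq_empty_or_nonempty with rfl | ⟨x₀, hx₀⟩
  · rw [Measure.restrict_empty, integral_zero_measure]
    positivity
  refine (integral_sub_average_sq_le h.memLp (ballMean U u x₀ δ)).trans ?_
  rw [integral_sub_sq_eq h.memLp.1]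
  refine ENNReal.toReal_le_of_le_ofReal (by positivity) ?_
  rw [ENNReal.ofReal_mul (by positivity), ENNReal.ofReal_toReal hE]
  set F := energy U g univ with hF
  obtain ⟨t, htU, htN, hcov⟩ := hN δ hδ U hR
  have hloc : ∀ x ∈ t, ∫⁻ y in U ∩ Metric.ball x δ, ‖u y - ballMean U u x₀ δ‖ₑ ^ 2 ≤
      ENNReal.ofReal (C₀ * δ ^ 2) * F := by
    intro x hxt
    have hx : x ∈ U := htU hxt
    calc ∫⁻ y in U ∩ Metric.ball x δ, ‖u y - ballMean U u x₀ δ‖ₑ ^ 2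
        ≤ ∫⁻ y in U ∩ Metric.ball x δ, (2 * ‖u y - ballMean U u x δ‖ₑ ^ 2 +
          2 * (ENNReal.ofReal (C₂ * (δ ^ 2 / δ ^ n)) * F)) := by
          refine lintegral_mono fun y => (enorm_sub_sq_le _ _ (ballMean U u x δ)).trans ?_
          gcongr
          exact hC₂ U U δ u g hU h hum hδ hUc subset_closure hcone hR x₀ hx₀ x hx
      _ = 2 * (∫⁻ y in U ∩ Metric.ball x δ, ‖u y - ballMean U u x δ‖ₑ ^ 2) +
          2 * (ENNReal.ofReal (C₂ * (δ ^ 2 / δ ^ n)) * F) * volume (U ∩ Metric.ball x δ) := by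
          rw [lintegral_add_right _ measurable_const, lintegral_const, lintegral_const_mul' _ _
            (by simp), Measure.restrict_apply_univ]
      _ ≤ 2 * (ENNReal.ofReal (4 * (4 / κ) ^ (2 * n + 2) * δ ^ 2) * F) +
          2 * (ENNReal.ofReal (C₂ * (δ ^ 2 / δ ^ n)) * F) *
            ENNReal.ofReal (unitVol n * δ ^ n) := by
          gcongr
          · exact (h.lintegral_sub_ballMean_le hU hum (hcone x hx) (subset_closure hx) hκ hκ1 hδ
              (by linarith)).trans (mul_le_mul_right (measure_mono (subset_univ _)) _)
          · rw [← volume_ball_eq x hδ]; exact measure_mono inter_subset_right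
      _ = (ENNReal.ofReal (2 * (4 * (4 / κ) ^ (2 * n + 2) * δ ^ 2)) +
          ENNReal.ofReal (2 * (C₂ * (δ ^ 2 / δ ^ n)) * (unitVol n * δ ^ n))) * F := by
        rw [ENNReal.ofReal_mul (p := 2 * (C₂ * (δ ^ 2 / δ ^ n))) (by positivity),
          ENNReal.ofReal_mul (p := 2) (by norm_num), ENNReal.ofReal_mul (p := 2) (by norm_num),
          ENNReal.ofReal_ofNat]
        ring
      _ = _ := by
        rw [← ENNReal.ofReal_add (by positivity) (by positivity), hC₀]
        congr 2
        field_simp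
  calc ∫⁻ y in U, ‖u y - ballMean U u x₀ δ‖ₑ ^ 2
      ≤ ∫⁻ y in ⋃ x ∈ t, U ∩ Metric.ball x δ, ‖u y - ballMean U u x₀ δ‖ₑ ^ 2 := by
        refine lintegral_mono_set fun y hy => ?_
        obtain ⟨x, hx, hyx⟩ := mem_iUnion₂.1 (hcov hy)
        exact mem_iUnion₂.2 ⟨x, hx, hy, hyx⟩
    _ ≤ ∑ x ∈ t, ∫⁻ y in U ∩ Metric.ball x δ, ‖u y - ballMean U u x₀ δ‖ₑ ^ 2 :=
        lintegral_biUnion_finset_le _ _ _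
    _ ≤ ∑ _x ∈ t, ENNReal.ofReal (C₀ * δ ^ 2) * F := Finset.sum_le_sum hloc
    _ = (t.card : ℝ≥0∞) * (ENNReal.ofReal (C₀ * δ ^ 2) * F) := by simp
    _ ≤ ((N + 1 : ℕ) : ℝ≥0∞) * (ENNReal.ofReal (C₀ * δ ^ 2) * F) := by
        gcongr; omega
    _ = _ := by
        rw [mul_assoc (_ : ℝ) C₀, ENNReal.ofReal_mul (p := ((N + 1 : ℕ) : ℝ)) (by positivity),
          ENNReal.ofReal_natCast, mul_assoc]

end BoundaryInequality

/-! ### Graph charts and bounds on surface measure. -/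

section Geometry
variable {n : ℕ}
local notation "E" => EuclideanSpace ℝ (Fin n)
local notation "E'" => EuclideanSpace ℝ (Fin (n - 1))

/-- Linear coordinates around a boundary point `P` of `D` in which `D` is the region above the graph
of an `L`-Lipschitz function. -/
structure GraphChart (D : Set E) (P : E) (ρ L : ℝ) where
  hor : E →ₗ[ℝ] E'
  ver : E →ₗ[ℝ] ℝ
  pt : E' → ℝ → E
  fn : E' → ℝ
  norm_hor_le : ∀ v, ‖hor v‖ ≤ ‖v‖
  abs_ver_le : ∀ v, |ver v| ≤ ‖v‖
  norm_le : ∀ v, ‖v‖ ≤ ‖hor v‖ + |ver v|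
  hor_pt : ∀ y t, hor (pt y t) = y
  ver_pt : ∀ y t, ver (pt y t) = t
  fn_zero : fn 0 = 0
  lipschitz : ∀ y z, ‖y‖ < 1 / (1 + L) * ρ → ‖z‖ < 1 / (1 + L) * ρ → |fn y - fn z| ≤ L * ‖y - z‖
  mem_iff : ∀ v, ‖hor v‖ < 1 / (1 + L) * ρ → |ver v| < ρ → (P + v ∈ D ↔ fn (hor v) < ver v)

/-- Since `0 ≤ a`, the norm bound gives `K ≤ L`. The horizontal radius is reduced from `ρ / L` to `ρ
/ (1 + L)`, over which the graph automatically stays at height below `ρ`. -/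
theorem IsLipschitzClass.nonempty_graphChart {D : Set E} {ρ L : ℝ} (hρ : 0 < ρ) (hL : 0 < L)
    (h : IsLipschitzClass D ρ L) {P : E} (hP : P ∈ frontier D) :
    Nonempty (GraphChart D P ρ L) := by
  obtain ⟨e, ψ, a, K, he, hψ0, hψa, hψK, haK, hD⟩ := h P hP
  have hκ : 1 / (1 + L) * ρ ≤ ρ / L := by
    rw [one_div, inv_mul_eq_div]
    gcongr; linarith
  have ha : 0 ≤ a := (abs_nonneg _).trans (hψa 0 (Metric.mem_ball_self (by positivity)))
  have hKL : (K : ℝ) ≤ L := by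
    have : ρ * K ≤ ρ * L := by linarith
    exact le_of_mul_le_mul_left this hρ
  set ℓ := e.linearIsometryEquiv with hℓ
  have heP : ∀ v, e (P + v) = ℓ v := by
    intro v
    have := e.map_vadd P v
    rw [vadd_eq_add, vadd_eq_add, he, add_zero, add_comm v P] at this
    exact this
  have hnorm : ∀ v, ‖v‖ ^ 2 = ‖(ℓ v).fst‖ ^ 2 + |(ℓ v).snd| ^ 2 := by
    intro v
    rw [← ℓ.norm_map v, WithLp.prod_norm_sq_eq_of_L2, Real.norm_eq_abs]
  exact ⟨{
    hor := { toFun := fun v => (ℓ v).fst, map_add' := by simp, map_smul' := by simp }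
    ver := { toFun := fun v => (ℓ v).snd, map_add' := by simp, map_smul' := by simp }
    pt := fun y t => ℓ.symm (WithLp.toLp 2 (y, t))
    fn := ψ
    norm_hor_le := fun v => by
      have := hnorm v
      exact abs_le_of_sq_le_sq'
        (by simp only [LinearMap.coe_mk, AddHom.coe_mk]; nlinarith [sq_nonneg |(ℓ v).snd|]) (norm_nonneg _) |>.2
    abs_ver_le := fun v => by
      have := hnorm v
      exact abs_le_of_sq_le_sq'
        (by simp only [LinearMap.coe_mk, AddHom.coe_mk]; nlinarith [sq_nonneg ‖(ℓ v).fst‖]) (norm_nonneg _) |>.2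
    norm_le := fun v => by
      have := hnorm v
      have h1 := norm_nonneg (ℓ v).fst
      have h2 := abs_nonneg (ℓ v).snd
      exact abs_le_of_sq_le_sq'
        (by simp only [LinearMap.coe_mk, AddHom.coe_mk]; nlinarith) (by positivity) |>.2
    hor_pt := fun y t => by simp
    ver_pt := fun y t => by simp
    fn_zero := hψ0
    lipschitz := fun y z hy hz => by
      have := hψK.dist_le_mul y (by simpa using hy.trans_le hκ) z (by simpa using hz.trans_le hκ)
      rw [Real.dist_eq, dist_eq_norm] at this
      exact this.trans (by gcongr)
    mem_iff := fun v h1 h2 => by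
      have := hD (P + v)
      rw [heP] at this
      exact this (h1.trans_le hκ) h2 }⟩

namespace GraphChart
variable {D : Set (EuclideanSpace ℝ (Fin n))} {P : EuclideanSpace ℝ (Fin n)} {ρ L : ℝ} (c : GraphChart D P ρ L)

/-- The vertical unit vector. -/
def up : E := c.pt 0 1

theorem hor_up : c.hor c.up = 0 := c.hor_pt 0 1

theorem ver_up : c.ver c.up = 1 := c.ver_pt 0 1

theorem norm_up : ‖c.up‖ = 1 := by
  refine le_antisymm ?_ ?_
  · simpa [hor_up, ver_up] using c.norm_le c.up
  · simpa [ver_up] using c.abs_ver_le c.up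

/-- A displacement of size `ε` changes the height above the graph by at most `(L + 1) * ε`, so a
small ball around the point stays below the graph. -/
theorem notMem_closure_of_lt (hL : 0 < L) {v : E} (h1 : ‖c.hor v‖ < 1 / (1 + L) * ρ)
    (h2 : |c.ver v| < ρ) (h : c.ver v < c.fn (c.hor v)) : P + v ∉ closure D := by
  intro hcl
  obtain ⟨ε, hε0, hε⟩ : ∃ ε, 0 < ε ∧ ε < 1 / (1 + L) * ρ - ‖c.hor v‖ ∧ ε < ρ - |c.ver v| ∧
      (L + 1) * ε < c.fn (c.hor v) - c.ver v := by
    have hlim : Tendsto (fun ε : ℝ => (L + 1) * ε) (𝓝[>] 0) (𝓝 ((L + 1) * 0)) :=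
      (tendsto_id.mono_left nhdsWithin_le_nhds).const_mul _
    have hlim' : Tendsto (fun ε : ℝ => ε) (𝓝[>] 0) (𝓝 0) :=
      tendsto_id.mono_left nhdsWithin_le_nhds
    have h0 : ∀ᶠ ε : ℝ in 𝓝[>] 0, 0 < ε := self_mem_nhdsWithin
    have ev := h0.and <|
      ((hlim'.eventually (gt_mem_nhds (sub_pos.2 h1))).and
      ((hlim'.eventually (gt_mem_nhds (sub_pos.2 h2))).and
      (hlim.eventually (gt_mem_nhds
        (show (L + 1) * 0 < c.fn (c.hor v) - c.ver v by linarith)))))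
    exact ev.exists
  obtain ⟨hε1, hε2, hε3⟩ := hε
  obtain ⟨y, hy, hyv⟩ := Metric.mem_closure_iff.1 hcl ε hε0
  obtain ⟨w, rfl⟩ : ∃ w, y = P + w := ⟨y - P, by abel⟩
  rw [dist_comm, dist_eq_norm, add_sub_add_left_eq_sub] at hyv
  have a1 : ‖c.hor w - c.hor v‖ < ε := by
    rw [← map_sub]; exact (c.norm_hor_le _).trans_lt hyv
  have a2 : |c.ver w - c.ver v| < ε := by
    rw [← map_sub]; exact (c.abs_ver_le _).trans_lt hyv
  have a3 : ‖c.hor w‖ < 1 / (1 + L) * ρ := by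
    linarith [norm_sub_norm_le (c.hor w) (c.hor v)]
  have a4 : |c.ver w| < ρ := by
    linarith [abs_sub_abs_le_abs_sub (c.ver w) (c.ver v)]
  have a5 := (c.mem_iff w a3 a4).1 hy
  have a6 := abs_le.1 (c.lipschitz _ _ a3 h1)
  have a7 := abs_lt.1 a2
  have a8 : L * ‖c.hor w - c.hor v‖ ≤ L * ε := by gcongr
  linarith [a6.1]

theorem mem_closure_of_le {v : E} (h1 : ‖c.hor v‖ < 1 / (1 + L) * ρ)
    (h2 : |c.ver v| < ρ) (h : c.fn (c.hor v) ≤ c.ver v) : P + v ∈ closure D := by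
  rw [Metric.mem_closure_iff]
  intro ε hε
  set s := min (ε / 2) ((ρ - |c.ver v|) / 2) with hs
  have hs0 : 0 < s := lt_min (by linarith) (by linarith)
  have hs1 : s ≤ ε / 2 := min_le_left _ _
  have hs2 : s ≤ (ρ - |c.ver v|) / 2 := min_le_right _ _
  refine ⟨P + (v + s • c.up), ?_, ?_⟩
  · rw [c.mem_iff]
    · simp only [map_add, map_smul, hor_up, ver_up, smul_zero, add_zero, smul_eq_mul, mul_one]
      linarith
    · simpa [hor_up] using h1
    · simp only [map_add, map_smul, ver_up, smul_eq_mul, mul_one]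
      have := abs_add_le (c.ver v) s
      rw [abs_of_pos hs0] at this
      linarith
  · rw [dist_eq_norm, add_sub_add_left_eq_sub, sub_add_cancel_left, norm_neg, norm_smul, norm_up,
      Real.norm_of_nonneg hs0.le]
    linarith

theorem notMem_closure_iff (hL : 0 < L) {v : E} (h1 : ‖c.hor v‖ < 1 / (1 + L) * ρ)
    (h2 : |c.ver v| < ρ) : P + v ∉ closure D ↔ c.ver v < c.fn (c.hor v) :=
  ⟨fun h => not_le.1 fun hle => h (c.mem_closure_of_le h1 h2 hle),
    c.notMem_closure_of_lt hL h1 h2⟩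

theorem mem_frontier_iff (hL : 0 < L) (hD : IsOpen D) {v : E}
    (h1 : ‖c.hor v‖ < 1 / (1 + L) * ρ) (h2 : |c.ver v| < ρ) :
    P + v ∈ frontier D ↔ c.fn (c.hor v) = c.ver v := by
  have h := not_iff_not.2 (c.notMem_closure_iff hL h1 h2)
  rw [not_not] at h
  rw [hD.frontier_eq, Set.mem_sdiff, c.mem_iff v h1 h2, h, not_lt, not_lt]
  exact ⟨fun h => le_antisymm h.1 h.2, fun h => ⟨h.le, h.ge⟩⟩

theorem norm_hor_lt (hL : 0 < L) (hρ : 0 < ρ) {v : E} (h : ‖v‖ < 1 / (1 + L) * ρ) :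
    ‖c.hor v‖ < 1 / (1 + L) * ρ ∧ |c.ver v| < ρ := by
  refine ⟨(c.norm_hor_le v).trans_lt h, (c.abs_ver_le v).trans_lt (h.trans_le ?_)⟩
  rw [one_div, inv_mul_eq_div]
  exact div_le_self hρ.le (by linarith)

/-- The choice `κ = 1 / (1 + L)` solves `L κ = 1 - κ`. Along `s • (c.up + w)` with `‖w‖ ≤ κ` the
height grows by at least `s * (1 - κ)`, which is the most the graph can rise; this is the cone
property. -/
theorem fn_add_le (hL : 0 < L) (hρ : 0 < ρ) {v w : E} {s : ℝ} (hs : 0 < s)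
    (hv : ‖v‖ < 1 / (1 + L) * ρ) (hw : ‖w‖ ≤ 1 / (1 + L))
    (hv' : ‖v + s • w‖ < 1 / (1 + L) * ρ) :
    |c.fn (c.hor (v + s • w)) - c.fn (c.hor v)| ≤ s * (1 - 1 / (1 + L)) := by
  refine (c.lipschitz _ _ (c.norm_hor_lt hL hρ hv').1 (c.norm_hor_lt hL hρ hv).1).trans ?_
  rw [← map_sub, add_sub_cancel_left, map_smul, norm_smul, Real.norm_of_nonneg hs.le]
  have h1 := (c.norm_hor_le w).trans hw
  calc L * (s * ‖c.hor w‖) ≤ L * (s * (1 / (1 + L))) := by gcongr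
    _ = _ := by field_simp; ring

theorem hor_add_up (v w : E) (s : ℝ) :
    c.hor (v + s • (c.up + w)) = c.hor (v + s • w) := by
  simp [hor_up]

theorem norm_add_smul_lt (hL : 0 < L) {v w : E} {s : ℝ} (hs : 0 < s) (hw : ‖w‖ ≤ 1 / (1 + L))
    (h : ‖v‖ + 2 * s < 1 / (1 + L) * ρ) :
    ‖v + s • w‖ < 1 / (1 + L) * ρ ∧ ‖v + s • (c.up + w)‖ < 1 / (1 + L) * ρ ∧
      ‖v - s • (c.up + w)‖ < 1 / (1 + L) * ρ := by
  have hκ1 : 1 / (1 + L) ≤ 1 := by rw [div_le_one (by linarith)]; linarith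
  have h1 : ‖s • w‖ ≤ s := by
    rw [norm_smul, Real.norm_of_nonneg hs.le]; nlinarith
  have h2 : ‖s • (c.up + w)‖ ≤ 2 * s := by
    rw [norm_smul, Real.norm_of_nonneg hs.le]
    have := norm_add_le c.up w
    rw [norm_up] at this
    nlinarith
  exact ⟨by linarith [norm_add_le v (s • w)], by linarith [norm_add_le v (s • (c.up + w))],
    by linarith [norm_sub_le v (s • (c.up + w))]⟩

theorem cone_mem (hL : 0 < L) (hρ : 0 < ρ) {v w : E} {s : ℝ} (hs : 0 < s)
    (hw : ‖w‖ ≤ 1 / (1 + L)) (h : ‖v‖ + 2 * s < 1 / (1 + L) * ρ) (hv : P + v ∈ D) :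
    P + v + s • (c.up + w) ∈ D := by
  have hv0 : ‖v‖ < 1 / (1 + L) * ρ := by linarith
  obtain ⟨a1, a2, -⟩ := c.norm_add_smul_lt hL hs hw h
  have b := c.norm_hor_lt hL hρ a2
  rw [c.mem_iff v (c.norm_hor_lt hL hρ hv0).1 (c.norm_hor_lt hL hρ hv0).2] at hv
  rw [add_assoc, c.mem_iff _ b.1 b.2, hor_add_up]
  have h3 := (abs_le.1 (c.fn_add_le hL hρ hs hv0 hw a1)).2
  have h4 := (abs_le.1 ((c.abs_ver_le w).trans hw)).1
  have e3 : c.ver (v + s • (c.up + w)) = c.ver v + s * (1 + c.ver w) := by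
    simp [ver_up, mul_add]
  rw [e3]
  nlinarith

theorem cone_notMem_closure (hL : 0 < L) (hρ : 0 < ρ) {v w : E} {s : ℝ} (hs : 0 < s)
    (hw : ‖w‖ ≤ 1 / (1 + L)) (h : ‖v‖ + 2 * s < 1 / (1 + L) * ρ) (hv : P + v ∉ closure D) :
    P + v + s • (-c.up + w) ∉ closure D := by
  have hv0 : ‖v‖ < 1 / (1 + L) * ρ := by linarith
  have hw' : ‖-w‖ ≤ 1 / (1 + L) := by rwa [norm_neg]
  obtain ⟨-, -, a3⟩ := c.norm_add_smul_lt hL hs hw' h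
  obtain ⟨a1, -, -⟩ := c.norm_add_smul_lt hL hs hw h
  have e1 : v + s • (-c.up + w) = v - s • (c.up + -w) := by
    rw [sub_eq_add_neg, ← smul_neg]; congr 2; abel
  rw [← e1] at a3
  have b := c.norm_hor_lt hL hρ a3
  rw [c.notMem_closure_iff hL (c.norm_hor_lt hL hρ hv0).1 (c.norm_hor_lt hL hρ hv0).2] at hv
  have e2 : c.hor (v + s • (-c.up + w)) = c.hor (v + s • w) := by simp [hor_up]
  rw [add_assoc, c.notMem_closure_iff hL b.1 b.2, e2]
  have h3 := (abs_le.1 (c.fn_add_le hL hρ hs hv0 hw a1)).1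
  have h4 := (abs_le.1 ((c.abs_ver_le w).trans hw)).2
  have e3 : c.ver (v + s • (-c.up + w)) = c.ver v + s * (-1 + c.ver w) := by
    simp [ver_up, mul_add]
  rw [e3]
  nlinarith

/-- The graph parametrization of the boundary. -/
def graph (y : E') : E := P + c.pt y (c.fn y)

theorem lipschitzOnWith_graph (hL : 0 < L) :
    LipschitzOnWith (1 + L).toNNReal c.graph (Metric.ball 0 (1 / (1 + L) * ρ)) := by
  refine LipschitzOnWith.of_dist_le_mul fun y hy z hz => ?_
  rw [mem_ball_zero_iff] at hy hz
  rw [Real.coe_toNNReal _ (by linarith), dist_eq_norm, dist_eq_norm, graph, graph,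
    add_sub_add_left_eq_sub]
  refine (c.norm_le _).trans ?_
  rw [map_sub, map_sub, hor_pt, hor_pt, ver_pt, ver_pt]
  linarith [c.lipschitz y z hy hz]

theorem abs_fn_lt (hL : 0 < L) (hρ : 0 < ρ) {y : E'} (hy : ‖y‖ < 1 / (1 + L) * ρ) :
    |c.fn y| ≤ L * ‖y‖ ∧ |c.fn y| < ρ := by
  have h := c.lipschitz y 0 hy (by rw [norm_zero]; positivity)
  rw [c.fn_zero, sub_zero, sub_zero] at h
  refine ⟨h, h.trans_lt ?_⟩
  calc L * ‖y‖ < L * (1 / (1 + L) * ρ) := by gcongr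
    _ = L / (1 + L) * ρ := by ring
    _ ≤ 1 * ρ := by
        gcongr
        rw [div_le_one (by linarith)]; linarith
    _ = ρ := one_mul _

theorem pt_hor_ver (v : E) : c.pt (c.hor v) (c.ver v) = v := by
  have h := c.norm_le (c.pt (c.hor v) (c.ver v) - v)
  rw [map_sub, map_sub, hor_pt, ver_pt, sub_self, sub_self, norm_zero, abs_zero, add_zero] at h
  exact sub_eq_zero.1 (norm_le_zero_iff.1 h)

/-- With the Lipschitz bound on `graph`, this gives the upper bound on surface measure. -/
theorem frontier_inter_ball_subset (hL : 0 < L) (hρ : 0 < ρ) (hD : IsOpen D) {R : ℝ}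
    (hR : R ≤ 1 / (1 + L) * ρ) :
    frontier D ∩ Metric.ball P R ⊆ c.graph '' Metric.ball 0 R := by
  rintro x ⟨hx, hxR⟩
  obtain ⟨v, rfl⟩ : ∃ v, x = P + v := ⟨x - P, by abel⟩
  rw [Metric.mem_ball, dist_eq_norm, add_sub_cancel_left] at hxR
  have hv := c.norm_hor_lt hL hρ (hxR.trans_le hR)
  refine ⟨c.hor v, by rw [mem_ball_zero_iff]; exact (c.norm_hor_le v).trans_lt hxR, ?_⟩
  rw [graph, (c.mem_frontier_iff hL hD hv.1 hv.2).1 hx, pt_hor_ver]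

/-- The horizontal projection is `1`-Lipschitz, so this gives the lower bound on surface measure. -/
theorem ball_subset_image_frontier (hL : 0 < L) (hρ : 0 < ρ) (hD : IsOpen D) {r : ℝ}
    (hr : r ≤ ρ) :
    Metric.ball 0 (1 / (1 + L) * r) ⊆ (fun x => c.hor (x - P)) '' (frontier D ∩ Metric.ball P r) := by
  intro y hy
  rw [mem_ball_zero_iff] at hy
  have hy' : ‖y‖ < 1 / (1 + L) * ρ := hy.trans_le (by gcongr)
  obtain ⟨h1, h2⟩ := c.abs_fn_lt hL hρ hy'
  refine ⟨c.graph y, ⟨?_, ?_⟩, ?_⟩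
  · rw [graph, c.mem_frontier_iff hL hD (by rwa [hor_pt]) (by rwa [ver_pt]), hor_pt, ver_pt]
  · rw [Metric.mem_ball, dist_eq_norm, graph, add_sub_cancel_left]
    refine (c.norm_le _).trans_lt ?_
    rw [hor_pt, ver_pt]
    calc ‖y‖ + |c.fn y| ≤ (1 + L) * ‖y‖ := by linarith
      _ < (1 + L) * (1 / (1 + L) * r) := by gcongr
      _ = r := by field_simp
  · simp only [graph, add_sub_cancel_left, hor_pt]

end GraphChart

theorem euclideanHausdorffMeasure_image_le {X Y : Type*} [MetricSpace X] [MeasurableSpace X]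
    [BorelSpace X] [MetricSpace Y] [MeasurableSpace Y] [BorelSpace Y] {f : X → Y} {s : Set X}
    {K : ℝ≥0} (hf : LipschitzOnWith K f s) (d : ℕ) :
    Measure.euclideanHausdorffMeasure d (f '' s) ≤
      (K : ℝ≥0∞) ^ d * Measure.euclideanHausdorffMeasure d s := by
  rw [Measure.euclideanHausdorffMeasure_def, Measure.euclideanHausdorffMeasure_def,
    Measure.smul_apply, Measure.smul_apply, ENNReal.smul_def, ENNReal.smul_def, smul_eq_mul,
    smul_eq_mul, mul_left_comm]
  gcongr
  have := hf.hausdorffMeasure_image_le (d := d) (Nat.cast_nonneg d)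
  rwa [ENNReal.rpow_natCast] at this

theorem surfaceMeasure_apply {D : Set E} {A : Set E} (hA : MeasurableSet A) :
    surfaceMeasure D A = Measure.euclideanHausdorffMeasure (n - 1) (frontier D ∩ A) := by
  rw [surfaceMeasure, Measure.restrict_apply hA, inter_comm]

theorem surfaceMeasure_ball_le {D : Set E} {ρ L : ℝ} (hρ : 0 < ρ) (hL : 0 < L) (hD : IsOpen D)
    (h : IsLipschitzClass D ρ L) (y : E) {r : ℝ} (hr : 0 < r) (hrρ : 2 * r ≤ 1 / (1 + L) * ρ) :
    surfaceMeasure D (Metric.ball y r) ≤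
      ENNReal.ofReal ((1 + L) ^ (n - 1) * unitVol (n - 1) * 2 ^ (n - 1) * r ^ (n - 1)) := by
  rw [surfaceMeasure_apply measurableSet_ball]
  rcases (frontier D ∩ Metric.ball y r).eq_empty_or_nonempty with h0 | ⟨P, hP, hPy⟩
  · rw [h0, measure_empty]; exact zero_le
  obtain ⟨c⟩ := h.nonempty_graphChart hρ hL hP
  rw [Metric.mem_ball] at hPy
  -- The centre `y` need not lie on the boundary; doubling the radius recentres at a boundary point.
  have hsub : Metric.ball y r ⊆ Metric.ball P (2 * r) :=
    Metric.ball_subset_ball' (by rw [dist_comm]; linarith)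
  refine (measure_mono ((inter_subset_inter_right _ hsub).trans
    (c.frontier_inter_ball_subset hL hρ hD hrρ))).trans ?_
  refine (euclideanHausdorffMeasure_image_le ((c.lipschitzOnWith_graph hL).mono
    (Metric.ball_subset_ball hrρ)) _).trans (le_of_eq ?_)
  have := unitVol_pos (n - 1)
  rw [EuclideanSpace.euclideanHausdorffMeasure_eq_volume, volume_ball_eq _ (by positivity),
    ← ENNReal.ofReal_coe_nnreal, Real.coe_toNNReal _ (by linarith),
    ← ENNReal.ofReal_pow (by linarith), ← ENNReal.ofReal_mul (by positivity), mul_pow]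
  congr 1; ring

theorem le_surfaceMeasure_ball {D : Set E} {ρ L : ℝ} (hρ : 0 < ρ) (hL : 0 < L) (hD : IsOpen D)
    (h : IsLipschitzClass D ρ L) {P : E} (hP : P ∈ frontier D) {r : ℝ} (hr : 0 < r)
    (hrρ : r ≤ ρ) :
    ENNReal.ofReal (unitVol (n - 1) * (1 / (1 + L) * r) ^ (n - 1)) ≤
      surfaceMeasure D (Metric.ball P r) := by
  obtain ⟨c⟩ := h.nonempty_graphChart hρ hL hP
  rw [surfaceMeasure_apply measurableSet_ball,
    ← volume_ball_eq (0 : E') (by positivity), ← EuclideanSpace.euclideanHausdorffMeasure_eq_volume]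
  have hlip : LipschitzOnWith 1 (fun x => c.hor (x - P)) (frontier D ∩ Metric.ball P r) := by
    refine LipschitzOnWith.of_dist_le_mul fun x _ z _ => ?_
    rw [dist_eq_norm, dist_eq_norm, ← map_sub, sub_sub_sub_cancel_right, NNReal.coe_one, one_mul]
    exact c.norm_hor_le _
  refine (measure_mono (c.ball_subset_image_frontier hL hρ hD hrρ)).trans
    ((euclideanHausdorffMeasure_image_le hlip _).trans (le_of_eq ?_))
  simp

end Geometry

/-! ### Unicoherence via lifting of circle-valued maps. -/

section Unicoherence

theorem eq_of_sub_mem_int {X : Type*} [TopologicalSpace X] {S : Set X} (hS : IsPreconnected S)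
    {f : X → ℝ} (hf : ContinuousOn f S) (hint : ∀ x ∈ S, ∃ m : ℤ, f x = m) {x y : X} (hx : x ∈ S)
    (hy : y ∈ S) : f x = f y :=
  hS.constant_of_mapsTo (T := range ((↑) : ℤ → ℝ))
    Int.isClosedEmbedding_coe_real.isEmbedding.isDiscrete_range hf
    (fun z hz => by obtain ⟨m, hm⟩ := hint z hz; exact ⟨m, hm.symm⟩) hx hy

theorem continuousOn_indicator_of_eq_zero {X : Type*} [TopologicalSpace X] {V A B : Set X}
    (hA : IsOpen A) (hB : IsOpen B) (hAB : Disjoint A B) {g : X → ℝ} (hg : Continuous g)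
    (h0 : ∀ x ∈ V, x ∉ A → x ∉ B → g x = 0) : ContinuousOn (A.indicator g) V := by
  intro x hx
  refine ContinuousAt.continuousWithinAt ?_
  by_cases hxA : x ∈ A
  · refine hg.continuousAt.congr ?_
    filter_upwards [hA.mem_nhds hxA] with y hy
    rw [indicator_of_mem hy]
  by_cases hxB : x ∈ B
  · refine (continuousAt_const (y := (0 : ℝ))).congr ?_
    filter_upwards [hB.mem_nhds hxB] with y hy
    rw [indicator_of_notMem (disjoint_right.1 hAB hy)]
  · rw [ContinuousAt, indicator_of_notMem hxA]
    have h1 : Tendsto (fun y => |g y|) (𝓝 x) (𝓝 0) := by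
      have := hg.abs.continuousAt (x := x)
      rwa [ContinuousAt, h0 x hx hxA hxB, abs_zero] at this
    refine squeeze_zero_norm (fun y => ?_) h1
    by_cases hy : y ∈ A <;> simp [hy]

/-- A simply connected, locally path-connected normal space is unicoherent: if it is the union of
two open connected sets, their intersection is connected. -/
theorem isPreconnected_inter_of_union_eq_univ {X : Type*} [TopologicalSpace X] [NormalSpace X]
    [SimplyConnectedSpace X] [LocallyPathConnectedSpace X] {V W : Set X} (hV : IsOpen V)
    (hW : IsOpen W) (hVc : IsPreconnected V) (hWc : IsPreconnected W) (hVW : V ∪ W = univ) :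
    IsPreconnected (V ∩ W) := by
  rw [isPreconnected_iff_subset_of_disjoint]
  intro s t hs ht hcov hdisj
  by_contra hcon
  rw [not_or, not_subset, not_subset] at hcon
  obtain ⟨⟨b, hb, hbs⟩, ⟨a, ha, hat⟩⟩ := hcon
  have has : a ∈ s := (hcov ha).resolve_right hat
  have hbt : b ∈ t := (hcov hb).resolve_left hbs
  set A := V ∩ W ∩ s with hAdef
  set B := V ∩ W ∩ t with hBdef
  have hA : IsOpen A := (hV.inter hW).inter hs
  have hB : IsOpen B := (hV.inter hW).inter ht
  have hAB : Disjoint A B := by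
    rw [disjoint_iff_inter_eq_empty, hAdef, hBdef, ← inter_inter_distrib_left, hdisj]
  have hVW' : ∀ x, x ∈ V ∩ W → x ∉ A → x ∉ B → False := fun x hx h1 h2 =>
    (hcov hx).elim (fun h => h1 ⟨hx, h⟩) fun h => h2 ⟨hx, h⟩
  -- Urysohn function equal to `0` off `W` and to `1` off `V`.
  obtain ⟨g, hg0, hg1, -⟩ := exists_continuous_zero_one_of_isClosed hW.isClosed_compl
    hV.isClosed_compl (by
      rw [disjoint_compl_left_iff_subset]
      intro x hx
      exact ((hVW ▸ mem_univ x : x ∈ V ∪ W)).resolve_left hx)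
  have hGV : ContinuousOn (A.indicator g) V :=
    continuousOn_indicator_of_eq_zero hA hB hAB g.continuous fun x hx h1 h2 =>
      hg0 fun hxW => hVW' x ⟨hx, hxW⟩ h1 h2
  have hGW : ContinuousOn (A.indicator fun x => g x - 1) W :=
    continuousOn_indicator_of_eq_zero hA hB hAB (g.continuous.sub continuous_const)
      fun x hx h1 h2 => sub_eq_zero.2 (hg1 fun hxV => hVW' x ⟨hxV, hx⟩ h1 h2)
  -- A circle map going once around along a loop from `A` to `B` through `V` and back through `W`.
  -- On `V` its phase `A.indicator g` is continuous; on `W` the phase `A.indicator (g - 1)`, which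
  -- differs from it by an integer, is continuous.
  let f : X → Circle := fun x => Circle.exp (2 * Real.pi * A.indicator g x)
  have hfW : ∀ x, f x = Circle.exp (2 * Real.pi * A.indicator (fun x => g x - 1) x) := by
    intro x
    by_cases hx : x ∈ A
    · simp only [f, indicator_of_mem hx]
      rw [Circle.exp_eq_exp]
      exact ⟨1, by push_cast; ring⟩
    · simp only [f, indicator_of_notMem hx]
  have hf : Continuous f := by
    rw [continuous_iff_continuousAt]
    intro x
    rcases (hVW ▸ mem_univ x : x ∈ V ∪ W) with hx | hx
    · exact Circle.exp.continuous.continuousAt.comp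
        (continuousAt_const.mul (hGV.continuousAt (hV.mem_nhds hx)))
    · have : f = fun x => Circle.exp (2 * Real.pi * A.indicator (fun x => g x - 1) x) :=
        funext hfW
      rw [this]
      exact Circle.exp.continuous.continuousAt.comp
        (continuousAt_const.mul (hGW.continuousAt (hW.mem_nhds hx)))
  obtain ⟨F, ⟨-, hF⟩, -⟩ := Circle.isCoveringMap_exp.existsUnique_continuousMap_lifts
    ⟨f, hf⟩ a (2 * Real.pi * A.indicator g a) rfl
  have hFf : ∀ x, Circle.exp (F x) = f x := fun x => congrFun hF x
  have hpi := Real.pi_pos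
  have hint : ∀ {G : ℝ} {x : X}, f x = Circle.exp (2 * Real.pi * G) →
      ∃ m : ℤ, F x / (2 * Real.pi) - G = m := by
    intro G x hx
    obtain ⟨m, hm⟩ := Circle.exp_eq_exp.1 ((hFf x).trans hx)
    refine ⟨m, ?_⟩
    rw [hm]; field_simp; ring
  -- On each of `V` and `W` the global lift differs from the local phase by a continuous
  -- integer-valued, hence constant, function. Going from `b` to `a`, the lift over `2 * π`
  -- increases by `g a` according to `V` and by `g a - 1` according to `W`.
  have h1 := eq_of_sub_mem_int hVc (f := fun x => F x / (2 * Real.pi) - A.indicator g x)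
    ((F.continuous.div_const _).continuousOn.sub hGV) (fun x _ => hint rfl) ha.1 hb.1
  have h2 := eq_of_sub_mem_int hWc
    (f := fun x => F x / (2 * Real.pi) - A.indicator (fun x => g x - 1) x)
    ((F.continuous.div_const _).continuousOn.sub hGW) (fun x _ => hint (hfW x)) ha.2 hb.2
  have haA : a ∈ A := ⟨ha, has⟩
  have hbA : b ∉ A := fun h => hbs h.2
  simp only [indicator_of_mem haA, indicator_of_notMem hbA] at h1 h2
  linarith

end Unicoherence

/-! ### Cone condition, connectedness and total surface measure for Lipschitz domains. -/

section ConeGeometry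
variable {n : ℕ}
local notation "E" => EuclideanSpace ℝ (Fin n)

theorem subset_of_disjoint_frontier {X : Type*} [TopologicalSpace X] {S D : Set X}
    (hS : IsPreconnected S) (hD : IsOpen D) (h : S ∩ frontier D = ∅) (hSD : (S ∩ D).Nonempty) :
    S ⊆ D := by
  refine hS.subset_left_of_subset_union hD isClosed_closure.isOpen_compl
    (disjoint_compl_right_iff_subset.2 subset_closure) (fun x hx => ?_) hSD
  by_contra hx'
  rw [mem_union, not_or, mem_compl_iff, not_not] at hx'
  have : x ∈ S ∩ frontier D := ⟨hx, by rw [hD.frontier_eq]; exact ⟨hx'.2, hx'.1⟩⟩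
  rw [h] at this
  exact this

theorem exists_mem_frontier_of_ball {D : Set E} (hD : IsOpen D) {x z : E} {r : ℝ}
    (hx : dist z x < r) (hxD : z ∉ D) (hcl : (Metric.ball x r ∩ D).Nonempty) :
    ∃ P ∈ frontier D, dist x P < r := by
  by_contra hcon
  push Not at hcon
  refine hxD (subset_of_disjoint_frontier (convex_ball x r).isPreconnected hD ?_ hcl hx)
  rw [eq_empty_iff_forall_notMem]
  rintro P ⟨hP1, hP2⟩
  rw [Metric.mem_ball, dist_comm] at hP1
  exact absurd hP1 (not_lt.2 (hcon P hP2))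

variable {D : Set (EuclideanSpace ℝ (Fin n))} {ρ L Δ : ℝ}

/-- Source of the factor `10`: with `κ = 1 / (1 + L)`, `‖v‖` is below `Δ + 5 Δ / κ ≤ 6 Δ / κ`, and
`2 * s` adds at most `4 Δ / κ`. The cone then stays inside the chart. -/
theorem norm_bound_aux (hL : 0 < L) (hΔ : 0 < Δ)
    (hΔρ : 10 * Δ / (1 / (1 + L)) ≤ 1 / (1 + L) * ρ) {P x v : E} {s : ℝ}
    (hxP : dist x P < 5 * Δ / (1 / (1 + L))) (hv : dist (P + v) x < Δ)
    (hs : s ≤ 2 * Δ / (1 / (1 + L))) : ‖v‖ + 2 * s < 1 / (1 + L) * ρ := by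
  have h1 : ‖v‖ ≤ dist (P + v) x + dist x P := by
    have := dist_triangle (P + v) x P
    rwa [dist_eq_norm (P + v) P, add_sub_cancel_left] at this
  have h2 : Δ ≤ Δ / (1 / (1 + L)) := by
    rw [div_div_eq_mul_div, div_one]; nlinarith
  rw [mul_div_assoc] at *
  linarith

/-- Either a ball of radius `5 Δ / κ` about `x` lies in `D` and contains the cones in every
direction, or a boundary point is that close and its chart provides the direction `c.up`. -/
theorem coneAt_of_mem_closure (hn : 1 ≤ n) (hD : IsOpen D) (h : IsLipschitzClass D ρ L)
    (hρ : 0 < ρ) (hL : 0 < L) (hΔ : 0 < Δ) (hΔρ : 10 * Δ / (1 / (1 + L)) ≤ 1 / (1 + L) * ρ)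
    {x : E} (hx : x ∈ closure D) : ConeAt D x Δ (1 / (1 + L)) := by
  have hκ : 0 < 1 / (1 + L) := by positivity
  have hκ1 : 1 / (1 + L) ≤ 1 := by rw [div_le_one (by linarith)]; linarith
  have hr : 0 < 5 * Δ / (1 / (1 + L)) := by positivity
  by_cases hball : Metric.ball x (5 * Δ / (1 / (1 + L))) ⊆ D
  · have : Nonempty (Fin n) := ⟨⟨0, hn⟩⟩
    obtain ⟨e, he⟩ := exists_norm_eq E zero_le_one
    refine ⟨e, he, fun y hy hyx s hs hsΔ v hv => hball ?_⟩
    rw [Metric.mem_ball, dist_eq_norm, show y + s • (e + v) - x = (y - x) + s • (e + v) by abel]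
    rw [dist_eq_norm] at hyx
    have h2 : Δ ≤ Δ / (1 / (1 + L)) := by
      rw [div_div_eq_mul_div, div_one]; nlinarith
    have h3 : ‖s • (e + v)‖ ≤ 2 * s := by
      rw [norm_smul, Real.norm_of_nonneg hs.le]
      have := norm_add_le e v
      rw [he] at this
      nlinarith
    rw [mul_div_assoc] at *
    linarith [norm_add_le (y - x) (s • (e + v))]
  · obtain ⟨z, hz, hzD⟩ := not_subset.1 hball
    obtain ⟨y, hy, hyx⟩ := Metric.mem_closure_iff.1 hx _ hr
    obtain ⟨P, hP, hxP⟩ := exists_mem_frontier_of_ball hD hz hzD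
      ⟨y, by rwa [Metric.mem_ball, dist_comm], hy⟩
    obtain ⟨c⟩ := h.nonempty_graphChart hρ hL hP
    refine ⟨c.up, c.norm_up, fun y hy hyx s hs hsΔ w hw => ?_⟩
    obtain ⟨v, rfl⟩ : ∃ v, y = P + v := ⟨y - P, by abel⟩
    exact c.cone_mem hL hρ hs hw (norm_bound_aux hL hΔ hΔρ hxP hyx hsΔ) hy

theorem mem_extNbhd_iff (hne : D.Nonempty) {δ : ℝ} {x : E} :
    x ∈ extNbhd D δ ↔ x ∉ closure D ∧ Metric.infDist x D < δ := by
  rw [extNbhd, Set.mem_ofPred_eq, Metric.infDist_pos_iff_notMem_closure hne]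

theorem isOpen_extNbhd (D : Set E) (δ : ℝ) : IsOpen (extNbhd D δ) :=
  (isOpen_lt continuous_const (Metric.continuous_infDist_pt D)).inter
    (isOpen_lt (Metric.continuous_infDist_pt D) continuous_const)

/-- The downward cone stays outside `closure D`, and within `κ ρ ≤ ρ` of the boundary point `P`, so
it does not leave the neighbourhood on its outer side. -/
theorem coneAt_extNbhd (hne : D.Nonempty) (h : IsLipschitzClass D ρ L)
    (hρ : 0 < ρ) (hL : 0 < L) (hΔ : 0 < Δ) (hΔρ : 10 * Δ / (1 / (1 + L)) ≤ 1 / (1 + L) * ρ)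
    {x P : E} (hP : P ∈ frontier D) (hxP : dist x P < 5 * Δ / (1 / (1 + L))) :
    ConeAt (extNbhd D ρ) x Δ (1 / (1 + L)) := by
  have hκ1 : 1 / (1 + L) ≤ 1 := by rw [div_le_one (by linarith)]; linarith
  obtain ⟨c⟩ := h.nonempty_graphChart hρ hL hP
  refine ⟨-c.up, by rw [norm_neg, c.norm_up], fun y hy hyx s hs hsΔ w hw => ?_⟩
  obtain ⟨v, rfl⟩ : ∃ v, y = P + v := ⟨y - P, by abel⟩
  have hb := norm_bound_aux hL hΔ hΔρ hxP hyx hsΔ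
  rw [mem_extNbhd_iff hne] at hy ⊢
  refine ⟨c.cone_notMem_closure hL hρ hs hw hb hy.1, ?_⟩
  have h1 := Metric.infDist_le_infDist_add_dist (s := D) (x := P + v + s • (-c.up + w)) (y := P)
  have h2 : Metric.infDist P D = 0 :=
    (Metric.mem_closure_iff_infDist_zero hne).1 (frontier_subset_closure hP)
  have h3 : dist (P + v + s • (-c.up + w)) P ≤ ‖v‖ + 2 * s := by
    rw [dist_eq_norm, add_assoc, add_sub_cancel_left]
    refine (norm_add_le _ _).trans ?_
    rw [norm_smul, Real.norm_of_nonneg hs.le]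
    have := norm_add_le (-c.up) w
    rw [norm_neg, c.norm_up] at this
    nlinarith
  have h4 : 1 / (1 + L) * ρ ≤ ρ := by nlinarith
  linarith

theorem exists_frontier_of_mem_extNbhd (hD : IsOpen D) (hne : D.Nonempty) {δ : ℝ} {x : E}
    (hx : x ∈ extNbhd D δ) : ∃ P ∈ frontier D, dist x P < δ := by
  rw [mem_extNbhd_iff hne] at hx
  obtain ⟨y, hy, hxy⟩ := (Metric.infDist_lt_iff hne).1 hx.2
  exact exists_mem_frontier_of_ball hD (z := x) (by rw [dist_self]; exact dist_nonneg.trans_lt hxy)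
    (fun h => hx.1 (subset_closure h)) ⟨y, by rwa [Metric.mem_ball, dist_comm], hy⟩

theorem frontier_subset_closure_extNbhd (hne : D.Nonempty) (h : IsLipschitzClass D ρ L)
    (hρ : 0 < ρ) (hL : 0 < L) {δ : ℝ} (hδ : 0 < δ) : frontier D ⊆ closure (extNbhd D δ) := by
  intro P hP
  obtain ⟨c⟩ := h.nonempty_graphChart hρ hL hP
  rw [Metric.mem_closure_iff]
  intro ε hε
  have hκ : 0 < 1 / (1 + L) * ρ := by positivity
  set s := min (min ε δ) (1 / (1 + L) * ρ) / 2 with hs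
  have hm : 0 < min (min ε δ) (1 / (1 + L) * ρ) := lt_min (lt_min hε hδ) hκ
  have hs0 : 0 < s := by positivity
  have h1 : s < min (min ε δ) (1 / (1 + L) * ρ) := by linarith
  have h2 := h1.trans_le (min_le_right _ _)
  have h3 := h1.trans_le ((min_le_left _ _).trans (min_le_left _ _))
  have h4 := h1.trans_le ((min_le_left _ _).trans (min_le_right _ _))
  have hns : ‖-(s • c.up)‖ = s := by
    rw [norm_neg, norm_smul, c.norm_up, Real.norm_of_nonneg hs0.le, mul_one]
  have hd : dist (P + -(s • c.up)) P = s := by rw [dist_eq_norm, add_sub_cancel_left, hns]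
  refine ⟨P + -(s • c.up), (mem_extNbhd_iff hne).2 ⟨?_, ?_⟩, by rw [dist_comm, hd]; exact h3⟩
  · have hb := c.norm_hor_lt hL hρ (v := -(s • c.up)) (by rw [hns]; exact h2)
    refine c.notMem_closure_of_lt hL hb.1 hb.2 ?_
    simp only [map_neg, map_smul, c.hor_up, c.ver_up, smul_zero, neg_zero, c.fn_zero, smul_eq_mul,
      mul_one]
    linarith
  · have h5 := Metric.infDist_le_infDist_add_dist (s := D) (x := P + -(s • c.up)) (y := P)
    rw [(Metric.mem_closure_iff_infDist_zero hne).1 (frontier_subset_closure hP), hd] at h5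
    linarith

/-- Unicoherence applied to the open `δ`-neighbourhood of `D`, connected as a union of `D` with
balls centred in it, and the exterior of `D`: together they fill the simply connected space. -/
theorem isPreconnected_extNbhd (hDc : IsConnected D) (hext : IsConnected (closure D)ᶜ) {δ : ℝ}
    (hδ : 0 < δ) : IsPreconnected (extNbhd D δ) := by
  obtain ⟨x₀, hx₀⟩ := hDc.nonempty
  have e : extNbhd D δ = {x | Metric.infDist x D < δ} ∩ (closure D)ᶜ := by
    ext x
    rw [mem_extNbhd_iff hDc.nonempty, and_comm]; rfl
  rw [e]
  refine isPreconnected_inter_of_union_eq_univ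
    (isOpen_lt (Metric.continuous_infDist_pt D) continuous_const) isClosed_closure.isOpen_compl
    ?_ hext.isPreconnected ?_
  · have hsub : ∀ z ∈ D, D ∪ Metric.ball z δ ⊆ {x | Metric.infDist x D < δ} := by
      rintro z hz x (hx | hx)
      · rw [Set.mem_ofPred_eq, Metric.infDist_zero_of_mem hx]; exact hδ
      · exact (Metric.infDist_lt_iff hDc.nonempty).2 ⟨z, hz, hx⟩
    refine isPreconnected_of_forall x₀ fun y hy => ?_
    obtain ⟨z, hz, hyz⟩ := (Metric.infDist_lt_iff hDc.nonempty).1 hy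
    exact ⟨D ∪ Metric.ball z δ, hsub z hz, Or.inl hx₀, Or.inr hyz,
      IsPreconnected.union z hz (Metric.mem_ball_self hδ) hDc.isPreconnected
        (convex_ball z δ).isPreconnected⟩
  · rw [eq_univ_iff_forall]
    intro x
    by_cases hx : x ∈ closure D
    · left
      rw [Set.mem_ofPred_eq, (Metric.mem_closure_iff_infDist_zero hDc.nonempty).1 hx]
      exact hδ
    · exact Or.inr hx

theorem exists_surfaceMeasure_univ_le (hL : 0 < L) (R : ℝ) :
    ∃ C : ℝ, 0 < C ∧ ∀ (D : Set E) (ρ δ : ℝ), 0 < ρ → 0 < δ → IsOpen D → IsLipschitzClass D ρ L →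
      2 * δ ≤ 1 / (1 + L) * ρ → (∀ x ∈ frontier D, ∀ y ∈ frontier D, dist x y ≤ R * δ) →
      surfaceMeasure D univ ≤ ENNReal.ofReal (C * δ ^ (n - 1)) := by
  obtain ⟨N, hN⟩ := exists_card_cover_le (n := n) R
  have hω := unitVol_pos (n - 1)
  refine ⟨(N + 1 : ℕ) * ((1 + L) ^ (n - 1) * unitVol (n - 1) * 2 ^ (n - 1)), by positivity, ?_⟩
  intro D ρ δ hρ hδ hD h hδρ hR
  obtain ⟨t, -, htN, hcov⟩ := hN δ hδ _ hR
  calc surfaceMeasure D univ ≤ surfaceMeasure D (⋃ x ∈ t, Metric.ball x δ) := by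
        have hm : MeasurableSet (⋃ x ∈ t, Metric.ball x δ) :=
          (isOpen_biUnion fun _ _ => Metric.isOpen_ball).measurableSet
        rw [surfaceMeasure_apply MeasurableSet.univ, surfaceMeasure_apply hm, inter_univ]
        exact measure_mono fun x hx => ⟨hx, hcov hx⟩
    _ ≤ ∑ x ∈ t, surfaceMeasure D (Metric.ball x δ) := measure_biUnion_finset_le _ _
    _ ≤ ∑ _x ∈ t, ENNReal.ofReal
          ((1 + L) ^ (n - 1) * unitVol (n - 1) * 2 ^ (n - 1) * δ ^ (n - 1)) :=
        Finset.sum_le_sum fun x _ => surfaceMeasure_ball_le hρ hL hD h x hδ hδρ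
    _ = (t.card : ℝ≥0∞) * ENNReal.ofReal
          ((1 + L) ^ (n - 1) * unitVol (n - 1) * 2 ^ (n - 1) * δ ^ (n - 1)) := by simp
    _ ≤ ((N + 1 : ℕ) : ℝ≥0∞) * ENNReal.ofReal
          ((1 + L) ^ (n - 1) * unitVol (n - 1) * 2 ^ (n - 1) * δ ^ (n - 1)) := by
        gcongr; omega
    _ = _ := by
        rw [mul_assoc (_ : ℝ) ((1 + L) ^ (n - 1) * unitVol (n - 1) * 2 ^ (n - 1)),
          ENNReal.ofReal_mul (p := ((N + 1 : ℕ) : ℝ)) (by positivity), ENNReal.ofReal_natCast]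

end ConeGeometry

/-! ### Functions with zero trace on the exterior neighbourhood. -/

section ZeroTrace
variable {n : ℕ}
local notation "E" => EuclideanSpace ℝ (Fin n)

theorem enorm_sq_le_add (a c : ℝ) : ‖a‖ₑ ^ 2 ≤ 2 * ‖a - c‖ₑ ^ 2 + 2 * ‖c‖ₑ ^ 2 := by
  have := enorm_sub_sq_le a 0 c
  rwa [sub_zero, zero_sub, enorm_neg] at this

theorem ae_surfaceMeasure_mem_frontier (D : Set E) : ∀ᵐ x ∂(surfaceMeasure D), x ∈ frontier D :=
  ae_restrict_mem isClosed_frontier.measurableSet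

/-- For zero trace, the trace estimate bounds the ball means themselves in `L²(∂D)`. Boundary points
near `P` have means close to the one at `P` and fill surface measure of order at least `δ ^ (n -
1)`, so the mean at `P` is small; the local Poincaré inequality then bounds `u` near `P`. -/
theorem exists_lintegral_ball_le_of_zero_trace (hn : 1 ≤ n) {L : ℝ} (hL : 0 < L) (R : ℝ) :
    ∃ C : ℝ, 0 < C ∧ ∀ (D : Set E) (ρ δ : ℝ) (u : E → ℝ) (g : E → E), 0 < ρ → 0 < δ → IsOpen D →
      D.Nonempty → IsLipschitzClass D ρ L → 10 * (3 * δ) / (1 / (1 + L)) ≤ 1 / (1 + L) * ρ →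
      (∀ x ∈ closure D, ∀ y ∈ closure D, dist x y ≤ R * δ) →
      MemH1 (extNbhd D ρ) u g → Measurable u → IsTrace (extNbhd D ρ) D u 0 →
      ∀ P ∈ frontier D, ∫⁻ y in extNbhd D ρ ∩ Metric.ball P (2 * δ), ‖u y‖ₑ ^ 2 ≤
        ENNReal.ofReal (C * δ ^ 2) * energy (extNbhd D ρ) g univ := by
  set κ := 1 / (1 + L) with hκdef
  have hκ : 0 < κ := by positivity
  have hκ1 : κ ≤ 1 := by rw [hκdef, div_le_one (by linarith)]; linarith
  have hω := unitVol_pos n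
  have hω' := unitVol_pos (n - 1)
  set a₁ := (1 + L) ^ (n - 1) * unitVol (n - 1) * 2 ^ (n - 1) with ha₁
  have ha₁0 : 0 < a₁ := by positivity
  obtain ⟨C₁, hC₁0, hC₁⟩ := exists_trace_estimate (n := n) hn hκ hκ1 ha₁0
  obtain ⟨C₂, hC₂0, hC₂⟩ := exists_surfaceMeasure_univ_le (n := n) hL R
  set c := unitVol n * (κ / 4 / 2) ^ n with hc
  have hc0 : 0 < c := by positivity
  set C₃ := 4 * unitVol n * (4 / κ) ^ (n + 2) / c ^ 2 * (2 ^ 2 / 2 ^ n) with hC₃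
  have hC₃0 : 0 < C₃ := by positivity
  set a₂ := unitVol (n - 1) * κ ^ (n - 1) with ha₂
  have ha₂0 : 0 < a₂ := by positivity
  set C₄ := (2 * C₃ * a₁ + 2 * C₁) / a₂ with hC₄
  have hC₄0 : 0 < C₄ := by positivity
  refine ⟨2 * (4 * (4 / κ) ^ (2 * n + 2) * 2 ^ 2) + 2 * C₄ * (unitVol n * 2 ^ n), by positivity, ?_⟩
  intro D ρ δ u g hρ hδ hD hne hLip hδρ hR h hum htr P hP
  set U := extNbhd D ρ with hU
  have hUo : IsOpen U := isOpen_extNbhd D ρ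
  set F := energy U g univ with hF
  set σ := surfaceMeasure D with hσ
  have hδκ : δ ≤ δ / κ := by rw [le_div_iff₀ hκ]; nlinarith
  have hδκρ : 30 * (δ / κ) ≤ κ * ρ := le_trans (le_of_eq (by ring)) hδρ
  have hκρ : κ * ρ ≤ ρ := by nlinarith
  have hreg : ∀ y r, 0 < r → r ≤ 4 / κ * δ →
      σ (Metric.ball y r) ≤ ENNReal.ofReal (a₁ * r ^ (n - 1)) := by
    intro y r hr hrδ
    refine surfaceMeasure_ball_le hρ hL hD hLip y hr ?_
    have : 4 / κ * δ = 4 * (δ / κ) := by ring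
    rw [← hκdef]; linarith
  have hcl : frontier D ⊆ closure U := frontier_subset_closure_extNbhd hne hLip hρ hL hρ
  have hcone : ∀ x ∈ frontier D, ConeAt U x (3 * δ) κ := fun x hx =>
    coneAt_extNbhd hne hLip hρ hL (by positivity) hδρ hx (by rw [dist_self]; positivity)
  have hσu := hC₂ D ρ δ hρ hδ hD hLip (by rw [← hκdef]; linarith)
    fun x hx y hy => hR x (frontier_subset_closure hx) y (frontier_subset_closure hy)
  have hσf : IsFiniteMeasure σ := ⟨hσu.trans_lt ENNReal.ofReal_lt_top⟩
  have htrace := ((hC₁ U u g δ σ hUo h hum hδ hσf (by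
    filter_upwards [ae_surfaceMeasure_mem_frontier D] with x hx
    exact ⟨hcl hx, (hcone x hx).mono hκ (by linarith)⟩) hreg).2 0 htr).2
  simp only [Pi.zero_apply, zero_sub, enorm_neg] at htrace
  set m := ballMean U u P (2 * δ) with hm
  have hvol : ∀ x ∈ frontier D, ∀ r, δ ≤ r →
      ENNReal.ofReal (c * (2 * δ) ^ n) ≤ volume (U ∩ Metric.ball x r) := by
    intro x hx r hr
    refine le_trans (le_of_eq ?_) (((hcone x hx).volume_ge (hcl hx) hκ hκ1 hδ (by linarith)).trans
      (measure_mono (inter_subset_inter_right _ (Metric.ball_subset_ball hr))))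
    rw [hc, mul_assoc, ← mul_pow]
    congr 3; ring
  have hmx : ∀ x ∈ frontier D, dist x P < δ →
      ‖m - ballMean U u x δ‖ₑ ^ 2 ≤ ENNReal.ofReal (C₃ * (δ ^ 2 / δ ^ n)) * F := by
    intro x hx hxP
    refine (h.ballMean_sub_ballMean_le hUo hum (hcone P hP) hκ hκ1 (η := 2 * δ) (by positivity)
      (by linarith) hc0 (y := P) (r := 2 * δ) (z := x) (t := δ) subset_rfl
      (Metric.ball_subset_ball' (by linarith)) (hvol P hP _ (by linarith))
      (hvol x hx _ le_rfl)).trans ?_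
    refine mul_le_mul' (le_of_eq ?_) (measure_mono (subset_univ _))
    rw [hC₃, mul_pow, mul_pow]
    congr 1
    field_simp
    rw [mul_pow]
  have hm2 : ‖m‖ₑ ^ 2 ≤ ENNReal.ofReal (C₄ * (δ ^ 2 / δ ^ n)) * F := by
    have h1 : ENNReal.ofReal (a₂ * δ ^ (n - 1)) * ‖m‖ₑ ^ 2 ≤
        ENNReal.ofReal ((2 * C₃ * a₁ + 2 * C₁) * δ) * F := by
      calc ENNReal.ofReal (a₂ * δ ^ (n - 1)) * ‖m‖ₑ ^ 2
          ≤ σ (Metric.ball P δ) * ‖m‖ₑ ^ 2 := by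
            gcongr
            refine le_trans (le_of_eq ?_) (le_surfaceMeasure_ball hρ hL hD hLip hP hδ
              (by linarith))
            rw [ha₂, mul_assoc, ← mul_pow]
        _ = ∫⁻ _ in Metric.ball P δ, ‖m‖ₑ ^ 2 ∂σ := by
            rw [lintegral_const, Measure.restrict_apply_univ, mul_comm]
        _ ≤ ∫⁻ x in Metric.ball P δ, (2 * ‖ballMean U u x δ‖ₑ ^ 2 +
              2 * (ENNReal.ofReal (C₃ * (δ ^ 2 / δ ^ n)) * F)) ∂σ := by
            refine setLIntegral_mono_ae' measurableSet_ball ?_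
            filter_upwards [ae_surfaceMeasure_mem_frontier D] with x hx hxP
            refine (enorm_sq_le_add m (ballMean U u x δ)).trans ?_
            rw [add_comm]
            gcongr
            exact hmx x hx hxP
        _ = 2 * (∫⁻ x in Metric.ball P δ, ‖ballMean U u x δ‖ₑ ^ 2 ∂σ) +
              2 * (ENNReal.ofReal (C₃ * (δ ^ 2 / δ ^ n)) * F) * σ (Metric.ball P δ) := by
            rw [lintegral_add_right _ measurable_const, lintegral_const, lintegral_const_mul' _ _
              (by simp), Measure.restrict_apply_univ]
        _ ≤ 2 * (ENNReal.ofReal (C₁ * δ) * F) +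
              2 * (ENNReal.ofReal (C₃ * (δ ^ 2 / δ ^ n)) * F) *
              ENNReal.ofReal (a₁ * δ ^ (n - 1)) := by
            gcongr
            · exact (setLIntegral_le_lintegral _ _).trans htrace
            · refine hreg P δ hδ ?_
              rw [div_mul_eq_mul_div, mul_div_assoc]; linarith
        _ = (ENNReal.ofReal (2 * (C₁ * δ)) +
              ENNReal.ofReal (2 * (C₃ * (δ ^ 2 / δ ^ n)) * (a₁ * δ ^ (n - 1)))) * F := by
            rw [ENNReal.ofReal_mul (p := 2 * (C₃ * (δ ^ 2 / δ ^ n))) (by positivity),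
              ENNReal.ofReal_mul (p := 2) (by norm_num), ENNReal.ofReal_mul (p := 2) (by norm_num),
              ENNReal.ofReal_ofNat]
            ring
        _ = _ := by
            rw [← ENNReal.ofReal_add (by positivity) (by positivity)]
            congr 2
            obtain ⟨k, rfl⟩ : ∃ k, n = k + 1 := ⟨n - 1, by omega⟩
            rw [Nat.add_sub_cancel]
            field_simp
            ring
    refine (le_ofReal_div_mul (by positivity) h1).trans (le_of_eq ?_)
    congr 2
    obtain ⟨k, rfl⟩ : ∃ k, n = k + 1 := ⟨n - 1, by omega⟩
    rw [hC₄, Nat.add_sub_cancel]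
    field_simp
    ring
  calc ∫⁻ y in U ∩ Metric.ball P (2 * δ), ‖u y‖ₑ ^ 2
      ≤ ∫⁻ y in U ∩ Metric.ball P (2 * δ), (2 * ‖u y - m‖ₑ ^ 2 + 2 * ‖m‖ₑ ^ 2) :=
        lintegral_mono fun y => enorm_sq_le_add _ _
    _ = 2 * (∫⁻ y in U ∩ Metric.ball P (2 * δ), ‖u y - m‖ₑ ^ 2) +
          2 * ‖m‖ₑ ^ 2 * volume (U ∩ Metric.ball P (2 * δ)) := by
        rw [lintegral_add_right _ measurable_const, lintegral_const, lintegral_const_mul' _ _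
          (by simp), Measure.restrict_apply_univ]
    _ ≤ 2 * (ENNReal.ofReal (4 * (4 / κ) ^ (2 * n + 2) * (2 * δ) ^ 2) * F) +
          2 * (ENNReal.ofReal (C₄ * (δ ^ 2 / δ ^ n)) * F) *
            ENNReal.ofReal (unitVol n * (2 * δ) ^ n) := by
        gcongr
        · exact (h.lintegral_sub_ballMean_le hUo hum (hcone P hP) (hcl hP) hκ hκ1 (by positivity)
            (by linarith)).trans (mul_le_mul_right (measure_mono (subset_univ _)) _)
        · rw [← volume_ball_eq P (by positivity)]; exact measure_mono inter_subset_right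
    _ = (ENNReal.ofReal (2 * (4 * (4 / κ) ^ (2 * n + 2) * (2 * δ) ^ 2)) +
          ENNReal.ofReal (2 * (C₄ * (δ ^ 2 / δ ^ n)) * (unitVol n * (2 * δ) ^ n))) * F := by
        rw [ENNReal.ofReal_mul (p := 2 * (C₄ * (δ ^ 2 / δ ^ n))) (by positivity),
          ENNReal.ofReal_mul (p := 2) (by norm_num), ENNReal.ofReal_mul (p := 2) (by norm_num),
          ENNReal.ofReal_ofNat]
        ring
    _ = _ := by
        rw [← ENNReal.ofReal_add (by positivity) (by positivity), mul_pow, mul_pow]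
        congr 2
        field_simp

/-- Pairs of points of the exterior neighbourhood that are joined by a segment in it, the second
one being close to `D`. -/
def exteriorPairs (D : Set E) (ρ δ : ℝ) : Set (E × E) :=
  {p | dist p.1 p.2 < Metric.infDist p.1 D ∧ Metric.infDist p.2 D < δ ∧
    ∃ z ∈ D, dist p.1 z < ρ ∧ dist p.2 z < ρ}

theorem isOpen_exteriorPairs (D : Set E) (ρ δ : ℝ) : IsOpen (exteriorPairs D ρ δ) := by
  have e : exteriorPairs D ρ δ = {p : E × E | dist p.1 p.2 < Metric.infDist p.1 D} ∩
      ({p : E × E | Metric.infDist p.2 D < δ} ∩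
        ⋃ z ∈ D, ({p : E × E | dist p.1 z < ρ} ∩ {p : E × E | dist p.2 z < ρ})) := by
    ext p; simp [exteriorPairs, and_left_comm]
  have hd : Continuous fun x : E => Metric.infDist x D := Metric.continuous_infDist_pt D
  rw [e]
  exact (isOpen_lt (by fun_prop) (by fun_prop)).inter
    ((isOpen_lt (by fun_prop) (by fun_prop)).inter (isOpen_biUnion fun z _ =>
      (isOpen_lt (by fun_prop) (by fun_prop)).inter (isOpen_lt (by fun_prop) (by fun_prop))))

/-- The segment lies in two balls: one about `p.1` that misses `D`, and one of radius `ρ` about a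
point of `D`. -/
theorem segment_subset_of_mem_exteriorPairs {D : Set E} {ρ δ : ℝ} {p : E × E}
    (hp : p ∈ exteriorPairs D ρ δ) : segment ℝ p.1 p.2 ⊆ extNbhd D ρ ∧ dist p.1 p.2 ≤ ρ := by
  obtain ⟨h1, -, z, hz, hz1, hz2⟩ := hp
  have h4 : Metric.infDist p.1 D ≤ dist p.1 z := Metric.infDist_le_dist_of_mem hz
  refine ⟨fun y hy => ?_, by linarith⟩
  have h2 : y ∈ Metric.ball p.1 (Metric.infDist p.1 D) :=
    (convex_ball _ _).segment_subset (Metric.mem_ball_self (dist_nonneg.trans_lt h1))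
      (by rwa [Metric.mem_ball, dist_comm]) hy
  have h3 : y ∈ Metric.ball z ρ := (convex_ball z ρ).segment_subset hz1 hz2 hy
  refine ⟨?_, (Metric.infDist_le_dist_of_mem hz).trans_lt h3⟩
  have h5 := Metric.infDist_le_infDist_add_dist (s := D) (x := p.1) (y := y)
  rw [Metric.mem_ball, dist_comm] at h2
  linarith

/-- Take an almost nearest point `p` of `D` and let `q` be the point at distance `δ / 2` from `p` on
the segment to `x`. The slack `δ / 4` in the choice of `p` leaves room for a ball of radius `δ / 4`
about `q`. -/
theorem exists_ball_exteriorPairs {D : Set E} (hne : D.Nonempty) {ρ δ : ℝ} (hδ : 0 < δ)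
    {x : E} (hx : x ∈ extNbhd D ρ) (hxδ : δ ≤ Metric.infDist x D) :
    ∃ q, ∀ z ∈ Metric.ball q (δ / 4), (x, z) ∈ exteriorPairs D ρ δ := by
  set d := Metric.infDist x D with hd
  obtain ⟨p, hp, hxp⟩ := (Metric.infDist_lt_iff hne).1
    (show d < min ρ (d + δ / 4) from lt_min hx.2 (by linarith))
  have hxp1 := hxp.trans_le (min_le_left _ _)
  have hxp2 := hxp.trans_le (min_le_right _ _)
  have hdp : d ≤ dist x p := Metric.infDist_le_dist_of_mem hp
  have hpos : 0 < ‖x - p‖ := by rw [← dist_eq_norm]; linarith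
  set t := δ / 2 / ‖x - p‖ with ht
  have ht0 : 0 ≤ t := by positivity
  have htn : t * ‖x - p‖ = δ / 2 := by rw [ht]; field_simp
  have ht1 : t ≤ 1 := by
    rw [ht, div_le_one hpos, ← dist_eq_norm]; linarith
  set q := p + t • (x - p) with hq
  have hqp : dist q p = δ / 2 := by
    rw [dist_eq_norm, hq, add_sub_cancel_left, norm_smul, Real.norm_of_nonneg ht0, htn]
  have hxq : dist x q = dist x p - δ / 2 := by
    have e : x - q = (1 - t) • (x - p) := by rw [hq, sub_smul, one_smul]; abel
    rw [dist_eq_norm, e, norm_smul, Real.norm_of_nonneg (by linarith), sub_mul, one_mul, htn,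
      dist_eq_norm]
  refine ⟨q, fun z hz => ?_⟩
  rw [Metric.mem_ball] at hz
  have hzp : dist z p < 3 * δ / 4 := by linarith [dist_triangle z q p]
  refine ⟨?_, (Metric.infDist_le_dist_of_mem hp).trans_lt (by linarith), p, hp, hxp1,
    hzp.trans_le (by linarith)⟩
  have := dist_triangle x q z
  rw [dist_comm q z] at this
  show dist x z < d
  linarith

/-- The layer of width `δ` is covered by boundedly many boundary balls of radius `2 * δ`. A point
outside it is compared, along exterior segments, with a ball inside the layer. Here `B` bounds `ρ /
δ`, hence the segment lengths and the volume of the far region in units of `δ`. -/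
theorem exists_poincare_of_zero_trace (hn : 1 ≤ n) {L : ℝ} (hL : 0 < L) (R B : ℝ) (hR0 : 0 ≤ R)
    (hB0 : 0 < B) :
    ∃ C : ℝ, 0 < C ∧ ∀ (D : Set E) (ρ δ : ℝ) (u : E → ℝ) (g : E → E), 0 < ρ → 0 < δ → IsOpen D →
      D.Nonempty → IsLipschitzClass D ρ L → 10 * (3 * δ) / (1 / (1 + L)) ≤ 1 / (1 + L) * ρ →
      ρ ≤ B * δ → (∀ x ∈ closure D, ∀ y ∈ closure D, dist x y ≤ R * δ) →
      MemH1 (extNbhd D ρ) u g → Measurable u → IsTrace (extNbhd D ρ) D u 0 →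
      ∫⁻ y in extNbhd D ρ, ‖u y‖ₑ ^ 2 ≤
        ENNReal.ofReal (C * δ ^ 2) * energy (extNbhd D ρ) g univ := by
  obtain ⟨C₁, hC₁0, hC₁⟩ := exists_lintegral_ball_le_of_zero_trace (n := n) hn hL R
  obtain ⟨N, hN⟩ := exists_card_cover_le (n := n) R
  have hω := unitVol_pos n
  set C₂ := (N + 1 : ℕ) * C₁ with hC₂
  have hC₂0 : 0 < C₂ := by positivity
  set C₃ := (2 * B ^ (n + 2) + 2 * (R + B) ^ n * C₂) * 4 ^ n with hC₃
  have hC₃0 : 0 < C₃ := by positivity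
  refine ⟨C₂ + C₃, by positivity, ?_⟩
  intro D ρ δ u g hρ hδ hD hne hLip hδρ hρB hR h hum htr
  set U := extNbhd D ρ with hU
  have hUo : IsOpen U := isOpen_extNbhd D ρ
  set F := energy U g univ with hF
  set S := U ∩ {x | Metric.infDist x D < δ} with hS
  have hdc : Continuous fun x : E => Metric.infDist x D := Metric.continuous_infDist_pt D
  have hSm : MeasurableSet S := (hUo.inter (isOpen_lt hdc continuous_const)).measurableSet
  have hstrip : ∫⁻ y in S, ‖u y‖ₑ ^ 2 ≤ ENNReal.ofReal (C₂ * δ ^ 2) * F := by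
    obtain ⟨t, htD, htN, hcov⟩ := hN δ hδ (frontier D) fun x hx y hy =>
      hR x (frontier_subset_closure hx) y (frontier_subset_closure hy)
    calc ∫⁻ y in S, ‖u y‖ₑ ^ 2
        ≤ ∫⁻ y in ⋃ P ∈ t, U ∩ Metric.ball P (2 * δ), ‖u y‖ₑ ^ 2 := by
          refine lintegral_mono_set fun y hy => ?_
          obtain ⟨P, hP, hyP⟩ := exists_frontier_of_mem_extNbhd hD hne (δ := δ) (x := y)
            ⟨hy.1.1, hy.2⟩
          obtain ⟨P', hP', hPP'⟩ := mem_iUnion₂.1 (hcov hP)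
          rw [Metric.mem_ball] at hPP'
          exact mem_iUnion₂.2 ⟨P', hP', hy.1, by
            rw [Metric.mem_ball]; linarith [dist_triangle y P P']⟩
      _ ≤ ∑ P ∈ t, ∫⁻ y in U ∩ Metric.ball P (2 * δ), ‖u y‖ₑ ^ 2 :=
          lintegral_biUnion_finset_le _ _ _
      _ ≤ ∑ _P ∈ t, ENNReal.ofReal (C₁ * δ ^ 2) * F := Finset.sum_le_sum fun P hP =>
          hC₁ D ρ δ u g hρ hδ hD hne hLip hδρ hR h hum htr P (htD hP)
      _ = (t.card : ℝ≥0∞) * (ENNReal.ofReal (C₁ * δ ^ 2) * F) := by simp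
      _ ≤ ((N + 1 : ℕ) : ℝ≥0∞) * (ENNReal.ofReal (C₁ * δ ^ 2) * F) := by
          gcongr; omega
      _ = _ := by
          rw [hC₂, mul_assoc (_ : ℝ) C₁, ENNReal.ofReal_mul (p := ((N + 1 : ℕ) : ℝ))
            (by positivity), ENNReal.ofReal_natCast, mul_assoc]
  set Z := exteriorPairs D ρ δ with hZ
  have hZm : MeasurableSet Z := (isOpen_exteriorPairs D ρ δ).measurableSet
  have hseg := h.lintegral_segment_le hUo hum hZm fun p hp =>
    segment_subset_of_mem_exteriorPairs hp
  set A := U ∩ {x | δ ≤ Metric.infDist x D} with hA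
  have hAm : MeasurableSet A := hUo.measurableSet.inter (isClosed_le continuous_const hdc).measurableSet
  set I := fun x => ∫⁻ w, Z.indicator (fun p : E × E => ‖u p.1 - u p.2‖ₑ ^ 2) (x, w) with hI
  have hindm : Measurable (Z.indicator (fun p : E × E => ‖u p.1 - u p.2‖ₑ ^ 2)) :=
    Measurable.indicator (by fun_prop) hZm
  have hIm : Measurable I := hindm.lintegral_prod_right'
  have hpt : ∀ x ∈ A, ENNReal.ofReal (unitVol n * (δ / 4) ^ n) * ‖u x‖ₑ ^ 2 ≤
      2 * I x + 2 * ∫⁻ y in S, ‖u y‖ₑ ^ 2 := by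
    intro x hx
    obtain ⟨q, hq⟩ := exists_ball_exteriorPairs hne hδ hx.1 hx.2
    have hqS : Metric.ball q (δ / 4) ⊆ S := fun z hz =>
      ⟨(segment_subset_of_mem_exteriorPairs (hq z hz)).1 (right_mem_segment ℝ _ _),
        (hq z hz).2.1⟩
    calc ENNReal.ofReal (unitVol n * (δ / 4) ^ n) * ‖u x‖ₑ ^ 2
        = ∫⁻ _ in Metric.ball q (δ / 4), ‖u x‖ₑ ^ 2 := by
          rw [lintegral_const, Measure.restrict_apply_univ, volume_ball_eq q (by positivity),
            mul_comm]
      _ ≤ ∫⁻ z in Metric.ball q (δ / 4), (2 * ‖u x - u z‖ₑ ^ 2 + 2 * ‖u z‖ₑ ^ 2) :=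
          lintegral_mono fun z => enorm_sq_le_add _ _
      _ = 2 * (∫⁻ z in Metric.ball q (δ / 4), ‖u x - u z‖ₑ ^ 2) +
            2 * ∫⁻ z in Metric.ball q (δ / 4), ‖u z‖ₑ ^ 2 := by
          rw [lintegral_add_left (by fun_prop), lintegral_const_mul' _ _ (by simp),
            lintegral_const_mul' _ _ (by simp)]
      _ ≤ _ := by
          gcongr
          · rw [hI, ← lintegral_indicator measurableSet_ball]
            refine lintegral_mono fun z => ?_
            by_cases hz : z ∈ Metric.ball q (δ / 4)
            · rw [indicator_of_mem hz, indicator_of_mem (hq z hz)]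
            · rw [indicator_of_notMem hz]; exact zero_le
  obtain ⟨x₀, hx₀⟩ := hne
  have hvolA : volume A ≤ ENNReal.ofReal (unitVol n * ((R + B) * δ) ^ n) := by
    rw [← volume_ball_eq x₀ (by positivity)]
    refine measure_mono fun x hx => ?_
    obtain ⟨z, hz, hxz⟩ := (Metric.infDist_lt_iff ⟨x₀, hx₀⟩).1 hx.1.2
    have := hR z (subset_closure hz) x₀ (subset_closure hx₀)
    rw [Metric.mem_ball]
    linarith [dist_triangle x z x₀]
  have hfar : ∫⁻ y in A, ‖u y‖ₑ ^ 2 ≤ ENNReal.ofReal (C₃ * δ ^ 2) * F := by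
    have h1 : ENNReal.ofReal (unitVol n * (δ / 4) ^ n) * ∫⁻ y in A, ‖u y‖ₑ ^ 2 ≤
        ENNReal.ofReal (unitVol n * δ ^ n *
          (2 * B ^ (n + 2) + 2 * (R + B) ^ n * C₂) * δ ^ 2) * F := by
      calc ENNReal.ofReal (unitVol n * (δ / 4) ^ n) * ∫⁻ y in A, ‖u y‖ₑ ^ 2
          = ∫⁻ y in A, ENNReal.ofReal (unitVol n * (δ / 4) ^ n) * ‖u y‖ₑ ^ 2 :=
            (lintegral_const_mul' _ _ ENNReal.ofReal_ne_top).symm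
        _ ≤ ∫⁻ x in A, (2 * I x + 2 * ∫⁻ y in S, ‖u y‖ₑ ^ 2) := setLIntegral_mono' hAm hpt
        _ = 2 * (∫⁻ x in A, I x) + 2 * (∫⁻ y in S, ‖u y‖ₑ ^ 2) * volume A := by
            rw [lintegral_add_right _ measurable_const, lintegral_const, lintegral_const_mul' _ _
              (by simp), Measure.restrict_apply_univ]
        _ ≤ 2 * (ENNReal.ofReal ((B * δ) ^ 2) * ENNReal.ofReal (unitVol n * (B * δ) ^ n) * F) +
              2 * (ENNReal.ofReal (C₂ * δ ^ 2) * F) *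
                ENNReal.ofReal (unitVol n * ((R + B) * δ) ^ n) := by
            gcongr
            refine (setLIntegral_le_lintegral _ _).trans (hseg.trans ?_)
            rw [volume_closedBall_eq _ hρ, ← ENNReal.ofReal_pow hρ.le, hF, energy_univ]
            gcongr
        _ = ENNReal.ofReal (2 * ((B * δ) ^ 2 * (unitVol n * (B * δ) ^ n)) +
              2 * (C₂ * δ ^ 2) * (unitVol n * ((R + B) * δ) ^ n)) * F := by
            rw [ENNReal.ofReal_add (by positivity) (by positivity),
              ENNReal.ofReal_mul (p := 2 * (C₂ * δ ^ 2)) (by positivity),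
              ENNReal.ofReal_mul (p := 2) (by norm_num), ENNReal.ofReal_mul (p := 2) (by norm_num),
              ENNReal.ofReal_mul (p := (B * δ) ^ 2) (by positivity), ENNReal.ofReal_ofNat]
            ring
        _ = _ := by
            congr 2
            rw [mul_pow, mul_pow, mul_pow]
            ring
    refine (le_ofReal_div_mul (by positivity) h1).trans (le_of_eq ?_)
    congr 2
    rw [hC₃, div_pow]
    field_simp
  have hcover : U ⊆ S ∪ A := fun x hx => by
    rcases lt_or_ge (Metric.infDist x D) δ with h1 | h1
    · exact Or.inl ⟨hx, h1⟩
    · exact Or.inr ⟨hx, h1⟩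
  refine (lintegral_mono_set hcover).trans ((lintegral_union_le _ _ _).trans
    ((add_le_add hstrip hfar).trans (le_of_eq ?_)))
  rw [← add_mul, ← ENNReal.ofReal_add (by positivity) (by positivity), ← add_mul]

end ZeroTrace

/-! ### Choice of scales and assembly. -/

theorem IsTrace.congr {n : ℕ} {U D : Set (EuclideanSpace ℝ (Fin n))}
    {u u' h : EuclideanSpace ℝ (Fin n) → ℝ} (huu : u =ᵐ[volume.restrict U] u')
    (H : IsTrace U D u h) : IsTrace U D u' h := by
  filter_upwards [H] with x hx
  refine hx.congr fun ε => ?_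
  refine average_congr ?_
  filter_upwards [ae_restrict_of_ae_restrict_of_subset inter_subset_left huu] with y hy
  rw [hy]

theorem exists_constants_of_lipschitz_boundary (n : ℕ) (hn : 2 ≤ n) (L Q : ℝ) (hL : 0 < L)
    (hQ : 0 < Q) :
    ∃ C₁ C₂ C₄ : ℝ, 0 < C₁ ∧ 0 < C₂ ∧ 0 < C₄ ∧
      ∀ (ρ : ℝ) (D : Set (EuclideanSpace ℝ (Fin n))), 0 < ρ →
        IsOpen D → IsConnected D → Bornology.IsBounded D →
        IsLipschitzClass D ρ L → Metric.diam D ≤ Q * ρ →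
        (∀ u g, MemH1 D u g → Measurable u →
          ∫ x in D, (u x - ⨍ y in D, u y) ^ 2 ≤ C₁ * ρ ^ 2 * ∫ x in D, ‖g x‖ ^ 2) ∧
        (∀ u g, MemH1 D u g → Measurable u →
          (∃ h, IsTrace D D u h) ∧
          ∀ h, IsTrace D D u h →
            MemLp h 2 (surfaceMeasure D) ∧
            ∫ x, (h x - ⨍ y, h y ∂(surfaceMeasure D)) ^ 2 ∂(surfaceMeasure D)
              ≤ C₂ * ρ * ∫ x in D, ‖g x‖ ^ 2) ∧
        (∀ u g, MemH1 (extNbhd D ρ) u g → Measurable u →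
          (∃ h, IsTrace (extNbhd D ρ) D u h) ∧
          ∀ h, IsTrace (extNbhd D ρ) D u h →
            MemLp h 2 (surfaceMeasure D) ∧
            (IsConnected (closure D)ᶜ →
              ∫ x, (h x - ⨍ y, h y ∂(surfaceMeasure D)) ^ 2 ∂(surfaceMeasure D)
                ≤ C₂ * ρ * ∫ x in extNbhd D ρ, ‖g x‖ ^ 2)) ∧
        (∀ u g, MemH1 (extNbhd D ρ) u g → Measurable u →
          IsTrace (extNbhd D ρ) D u 0 →
          ∫ x in extNbhd D ρ, u x ^ 2 ≤ C₄ * ρ ^ 2 * ∫ x in extNbhd D ρ, ‖g x‖ ^ 2) := by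
  have hn1 : 1 ≤ n := by omega
  set κ : ℝ := 1 / (1 + L) with hκdef
  have hκ : 0 < κ := by positivity
  have hκ1 : κ ≤ 1 := by rw [hκdef, div_le_one (by positivity)]; linarith
  -- With `δ = s * ρ` the chart condition `10 * (3 * δ) / κ ≤ κ * ρ` holds with equality.
  set s : ℝ := κ ^ 2 / 30 with hs
  have hs0 : 0 < s := by positivity
  have hs1 : 30 * s ≤ κ := by rw [hs]; nlinarith
  set R : ℝ := Q / s + 2 with hR
  have hRpos : 0 < R := by positivity
  have hω := unitVol_pos (n - 1)
  set c : ℝ := (1 + L) ^ (n - 1) * unitVol (n - 1) * 2 ^ (n - 1) with hc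
  have hc0 : 0 < c := by positivity
  obtain ⟨A, hA0, hA⟩ := exists_surfaceMeasure_univ_le (n := n) hL R
  obtain ⟨C₁, hC₁0, hC₁⟩ := exists_poincare (n := n) hκ hκ1 R
  obtain ⟨C₂, hC₂0, hC₂⟩ := exists_boundary_poincare hn1 hκ hκ1 hc0 hA0 R
  obtain ⟨C₃, -, hC₃⟩ := exists_trace_estimate hn1 hκ hκ1 hc0
  obtain ⟨C₄, hC₄0, hC₄⟩ := exists_poincare_of_zero_trace hn1 hL R (1 / s) hRpos.le (by positivity)
  refine ⟨C₁ * s ^ 2, C₂ * s, C₄ * s ^ 2, by positivity, by positivity, by positivity, ?_⟩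
  intro ρ D hρ hD hDc hDb hLip hdiam
  set δ : ℝ := s * ρ with hδdef
  have hδ : 0 < δ := by positivity
  have hδρ : 10 * (3 * δ) / κ ≤ κ * ρ := by
    rw [div_le_iff₀ hκ, hδdef, hs]
    exact le_of_eq (by ring)
  have hδκ : 30 * δ ≤ κ * ρ := by rw [hδdef]; nlinarith
  have hκρ : κ * ρ ≤ ρ := by nlinarith
  have hRδ : R * δ = Q * ρ + 2 * δ := by rw [hR, hδdef]; field_simp
  have hdist : ∀ x ∈ closure D, ∀ y ∈ closure D, dist x y ≤ Q * ρ := fun x hx y hy =>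
    (Metric.dist_le_diam_of_mem hDb.closure hx hy).trans ((Metric.diam_closure D).trans_le hdiam)
  have hdistR : ∀ x ∈ closure D, ∀ y ∈ closure D, dist x y ≤ R * δ := fun x hx y hy =>
    (hdist x hx y hy).trans (by linarith)
  have hδ5 : δ < 5 * (3 * δ) / κ := by rw [lt_div_iff₀ hκ]; nlinarith
  have hfr : frontier D ⊆ closure D := frontier_subset_closure
  have hσuniv : surfaceMeasure D univ ≤ ENNReal.ofReal (A * δ ^ (n - 1)) :=
    hA D ρ δ hρ hδ hD hLip (by linarith) fun x hx y hy => hdistR x (hfr hx) y (hfr hy)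
  have hσfin : IsFiniteMeasure (surfaceMeasure D) := ⟨hσuniv.trans_lt ENNReal.ofReal_lt_top⟩
  have hreg : ∀ y r, 0 < r → r ≤ 4 / κ * δ →
      surfaceMeasure D (Metric.ball y r) ≤ ENNReal.ofReal (c * r ^ (n - 1)) := by
    intro y r hr hr'
    refine surfaceMeasure_ball_le hρ hL hD hLip y hr ?_
    have e : 10 * (3 * δ) / κ = 15 / 2 * (4 / κ * δ) := by ring
    rw [e] at hδρ
    linarith
  have hcone : ∀ x ∈ closure D, ConeAt D x (3 * δ) κ := fun x hx =>
    coneAt_of_mem_closure hn1 hD hLip hρ hL (by positivity) hδρ hx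
  have hconeExt : ∀ P ∈ frontier D, ∀ x, dist x P < 5 * (3 * δ) / κ →
      ConeAt (extNbhd D ρ) x (3 * δ) κ := fun P hP x hx =>
    coneAt_extNbhd hDc.nonempty hLip hρ hL (by positivity) hδρ hP hx
  refine ⟨fun u g h hum => ?_, fun u g h hum => ?_, fun u g h hum => ?_, fun u g h hum htr => ?_⟩
  · refine (hC₁ D u g δ hD h hum hδ hDc.isPreconnected hDb (fun x hx => hcone x (subset_closure hx))
      fun x hx y hy => hdistR x (subset_closure hx) y (subset_closure hy)).trans (le_of_eq ?_)
    rw [hδdef]; ring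
  · obtain ⟨h1, h2⟩ := hC₃ D u g δ (surfaceMeasure D) hD h hum hδ hσfin (by
      filter_upwards [ae_surfaceMeasure_mem_frontier D] with x hx
      exact ⟨hfr hx, (hcone x (hfr hx)).mono hκ (by linarith)⟩) hreg
    refine ⟨h1, fun w hw => ⟨(h2 w hw).1, ?_⟩⟩
    refine (hC₂ D (closure D) u g δ (surfaceMeasure D) hD h hum hδ hDc.isPreconnected.closure
      subset_rfl hcone hdistR ((ae_surfaceMeasure_mem_frontier D).mono fun x hx => hfr hx)
      hreg hσuniv w hw).trans (le_of_eq ?_)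
    rw [hδdef]; ring
  · have hcl : ∀ {η : ℝ}, 0 < η → frontier D ⊆ closure (extNbhd D η) :=
      frontier_subset_closure_extNbhd hDc.nonempty hLip hρ hL
    obtain ⟨h1, h2⟩ := hC₃ (extNbhd D ρ) u g δ (surfaceMeasure D) (isOpen_extNbhd D ρ) h hum hδ
      hσfin (by
        filter_upwards [ae_surfaceMeasure_mem_frontier D] with x hx
        exact ⟨hcl hρ hx, (hconeExt x hx x (by rw [dist_self]; positivity)).mono hκ
          (by linarith)⟩) hreg
    refine ⟨h1, fun w hw => ⟨(h2 w hw).1, fun hext => ?_⟩⟩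
    have hT : ∀ x ∈ extNbhd D δ ∪ frontier D, ∃ P ∈ frontier D, dist x P < δ := by
      rintro x (hx | hx)
      · exact exists_frontier_of_mem_extNbhd hD hDc.nonempty hx
      · exact ⟨x, hx, by rwa [dist_self]⟩
    -- The chain runs in the thin layer of width `δ` with the boundary adjoined: the layer is
    -- connected, the boundary lies in its closure, and every point is near enough to `∂D` for the
    -- exterior cone condition.
    refine (hC₂ (extNbhd D ρ) (extNbhd D δ ∪ frontier D) u g δ (surfaceMeasure D)
      (isOpen_extNbhd D ρ) h hum hδ
      ((isPreconnected_extNbhd hDc hext hδ).subset_closure subset_union_left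
        (union_subset subset_closure (hcl hδ)))
      (union_subset (LE.le.trans (b := extNbhd D ρ)
        (fun x hx => ⟨hx.1, hx.2.trans_le (by linarith)⟩) subset_closure) (hcl hρ)) (fun x hx => ?_) (fun x hx y hy => ?_)
      ((ae_surfaceMeasure_mem_frontier D).mono fun x hx => Or.inr hx)
      hreg hσuniv w hw).trans (le_of_eq ?_)
    · obtain ⟨P, hP, hxP⟩ := hT x hx
      exact hconeExt P hP x (hxP.trans hδ5)
    · obtain ⟨P, hP, hxP⟩ := hT x hx
      obtain ⟨P', hP', hyP⟩ := hT y hy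
      have h3 := hdist P (hfr hP) P' (hfr hP')
      have h4 := dist_triangle4 x P P' y
      rw [dist_comm P' y] at h4
      linarith
    · rw [hδdef]; ring
  · have h1 := hC₄ D ρ δ u g hρ hδ hD hDc.nonempty hLip hδρ
      (le_of_eq (by rw [hδdef]; field_simp)) hdistR h hum htr
    have h2 := integral_sub_sq_eq h.memLp.aestronglyMeasurable 0
    simp only [sub_zero] at h2
    rw [h2, integral_norm_sq_eq h]
    refine ENNReal.toReal_le_of_le_ofReal (by positivity) (h1.trans (le_of_eq ?_))
    rw [ENNReal.ofReal_mul (p := C₄ * s ^ 2 * ρ ^ 2) (by positivity),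
      ENNReal.ofReal_toReal h.energy_lt_top.ne, hδdef]
    congr 2; ring

theorem proposition5p5 (n : ℕ) (hn : 2 ≤ n) (L Q : ℝ) (hL : 0 < L) (hQ : 0 < Q) :
    ∃ C₁ C₂ C₃ C₄ : ℝ, 0 < C₁ ∧ 0 < C₂ ∧ 0 < C₃ ∧ 0 < C₄ ∧
      ∀ (r ρ₀ : ℝ) (D : Set (EuclideanSpace ℝ (Fin n))), 0 < r → 0 < ρ₀ →
        IsOpen D → IsConnected D → Bornology.IsBounded D →
        IsLipschitzClass D (r * ρ₀) L → Metric.diam D ≤ Q * (r * ρ₀) →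
        -- the two inequalities for functions in `H¹(D)`
        (∀ u g, MemH1 D u g →
          ∫ x in D, (u x - ⨍ y in D, u y) ^ 2 ≤ C₁ * r ^ 2 * ρ₀ ^ 2 * ∫ x in D, ‖g x‖ ^ 2) ∧
        (∀ u g, MemH1 D u g →
          (∃ h, IsTrace D D u h) ∧
          ∀ h, IsTrace D D u h →
            MemLp h 2 (surfaceMeasure D) ∧
            ∫ x, (h x - ⨍ y, h y ∂(surfaceMeasure D)) ^ 2 ∂(surfaceMeasure D)
              ≤ C₂ * r * ρ₀ * ∫ x in D, ‖g x‖ ^ 2) ∧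
        -- the two inequalities for functions in `H¹` of the exterior neighbourhood
        (∀ u g, MemH1 (extNbhd D (r * ρ₀)) u g →
          (∃ h, IsTrace (extNbhd D (r * ρ₀)) D u h) ∧
          ∀ h, IsTrace (extNbhd D (r * ρ₀)) D u h →
            MemLp h 2 (surfaceMeasure D) ∧
            (IsConnected (closure D)ᶜ →
              ∫ x, (h x - ⨍ y, h y ∂(surfaceMeasure D)) ^ 2 ∂(surfaceMeasure D)
                ≤ C₃ * r * ρ₀ * ∫ x in extNbhd D (r * ρ₀), ‖g x‖ ^ 2)) ∧
        (∀ u g, MemH1 (extNbhd D (r * ρ₀)) u g →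
          IsTrace (extNbhd D (r * ρ₀)) D u 0 →
          ∫ x in extNbhd D (r * ρ₀), u x ^ 2
            ≤ C₄ * r ^ 2 * ρ₀ ^ 2 * ∫ x in extNbhd D (r * ρ₀), ‖g x‖ ^ 2) := by
  obtain ⟨C₁, C₂, C₄, h₁, h₂, h₄, H⟩ := exists_constants_of_lipschitz_boundary n hn L Q hL hQ
  refine ⟨C₁, C₂, C₂, C₄, h₁, h₂, h₂, h₄, ?_⟩
  intro r ρ₀ D hr hρ₀ hD hDc hDb hLip hdiam
  obtain ⟨H1, H2, H3, H4⟩ := H (r * ρ₀) D (mul_pos hr hρ₀) hD hDc hDb hLip hdiam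
  simp only [mul_pow, ← mul_assoc] at H1 H2 H3 H4 ⊢
  -- Passing to a measurable representative changes neither the integrals nor the traces.
  refine ⟨fun u g h => ?_, fun u g h => ?_, fun u g h => ?_, fun u g h htr => ?_⟩ <;>
    obtain ⟨u', hum, huu, h'⟩ := h.exists_measurable
  · rw [average_congr huu, integral_congr_ae (g := fun x => (u' x - ⨍ y in D, u' y) ^ 2)
      (huu.mono fun x hx => by simp only [hx])]
    exact H1 u' g h' hum
  · obtain ⟨⟨w, hw⟩, h2⟩ := H2 u' g h' hum
    exact ⟨⟨w, hw.congr huu.symm⟩, fun v hv => h2 v (hv.congr huu)⟩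
  · obtain ⟨⟨w, hw⟩, h2⟩ := H3 u' g h' hum
    exact ⟨⟨w, hw.congr huu.symm⟩, fun v hv => h2 v (hv.congr huu)⟩
  · rw [integral_congr_ae (g := fun x => u' x ^ 2) (huu.mono fun x hx => by simp only [hx])]
    exact H4 u' g h' hum (htr.congr huu)
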